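/- **Instances.** An instance $\mathcal I$ of $mRmD$ consists of finite sets $D$ (demands) and $R$ (resource types, indexed $1,\dots,|R|$); for each $r\in R$ a finite set $S^r$ of starting locations, with $l^r_s\in\mathbb Z_{\ge 0}$ resources of type $r$ at $s\in S^r$; for each $d\in D$ a nonempty set $M_d\subseteq R$ of required types, a start time $\tau_d\in\mathbb Z$, a duration $\Delta_d\in\mathbb Z_{\ge0}$ and a reward $w_d\in\mathbb Z$; and travel times $f_{sd},f_{ij}\in\mathbb Z_{\ge 0}$ from starting locations to demands and between demands, satisfying the triangle inequality ($f_{ik}\le f_{ij}+f_{jk}$ and $f_{sk}\le f_{sj}+f_{jk}$). A path of a resource of type $r$ from $s\in S^r$ is a finite sequence of distinct demands $d_1,d_2,\dots$, all with $r\in M_{d_i}$, such that $f_{sd_1}\le\tau_{d_1}$ and $\tau_{d_i}+\Delta_{d_i}+f_{d_id_{i+1}}\le\tau_{d_{i+1}}$ for all $i$. A feasible solution is a collection, for each $r\in R$ and $s\in S^r$, of at most $l^r_s$ paths of resources of type $r$ from $s$. A demand $d$ is met if for every $r\in M_d$ some path of type $r$ visits $d$. The objective value is the sum of $w_d$ over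 the demands met, and $OPT(\mathcal I)$ is its maximum over feasible solutions. **Conflict graph and coloring.** The conflict graph $G=(V,E)$ has as nodes the distinct sets among the $M_d$, $d\in D$; two distinct nodes $u,v$ are adjacent iff $u\cap v\neq\emptyset$. For integers $a\ge 0$ and $b\ge1$, an $a:b$-coloring assigns to each node a set of $b$ of the colors $1,\dots,a$ so that adjacent nodes receive disjoint sets; $S_i$ is the set of nodes whose set contains $i$. **Algorithm $\mathcal C$.** For $v\in V$ let $1R1\bar D^v$ be the single-type instance formed by the demands $d$ with $M_d=v$ and all resources of the type in $v$ that has the fewest resources (ties broken by smallest index). Start with value $0$ and the empty solution. For $i=1,\dots,a$: solve $1R1\bar D^v$ to optimality for every $v\in S_i$, with optimal value $\mathcal C_v$; if $\sum_{v\in S_i}\mathcal C_v$ is at least the current value, replace the current value by this sum and the current solution by the one in which, for each $v\in S_i$, every type in $v$ follows the paths found for $1R1\bar D^v$. Output the final value $\mathcal C(\mathcal I)$ and solution. **Theorem.** Let $\mathcal I$ be an instance in which all resources have the same starting location $s$ ($S^r=\{s\}$ for all $r$), and let an $a:b$-coloring of its conflict graph be given. Then Algorithm $\mathcal C$ is an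 $\frac ab$-approximation algorithm: 1. whichever optimal solutions of the subproblems are used, its output is a feasible solution of $\mathcal I$, whose objective value is $\mathcal C(\mathcal I)$, and $OPT(\mathcal I)\le\frac ab\,\mathcal C(\mathcal I)$; 2. it can be carried out in polynomial time: there are a single program and a single polynomial $p$ such that for every such instance and coloring the program halts with an output of Algorithm $\mathcal C$ within $p(N)$ steps, where $N$ is the length of the binary encoding of the input, i.e. of the instance together with the list $S_1,\dots,S_a$. (The program is in a WHILE language on trees with integer leaves, in which each basic operation costs the bit size of the data it acts on.) -/

import Mathlib

namespace MRMD

/-! ### Instances, schedules, feasible solutions -/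

/-- An instance of the heterogeneous multi-resource allocation problem, with demands `D`, resource
types `R` and starting locations `L`. -/
structure Instance (D R L : Type) where
  /-- the starting locations of each resource type -/
  S : R → Finset L
  /-- the number of resources of type `r` that start at location `s` -/
  l : L → R → ℕ
  /-- the resource types required by each demand -/
  M : D → Finset R
  M_nonempty : ∀ d, (M d).Nonempty
  /-- service start time -/
  τ : D → ℤ
  /-- service duration -/
  Δ : D → ℕ
  /-- reward -/
  w : D → ℤ
  /-- travel time from a starting location to a demand -/
  fStart : L → D → ℕ
  /-- travel time from a demand to a demand -/
  fDem : D → D → ℕ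

/-- A candidate solution: for each resource type `r` and each starting location `s`, the multiset of
the paths (given by the successive demands visited) of the resources of type `r` that leave `s`.
Resources that are not listed stay idle. -/
structure Solution (D R L : Type) where
  paths : R → L → Multiset (List D)

/-- The solution in which no resource is used. -/
def Solution.empty (D R L : Type) : Solution D R L := ⟨fun _ _ => 0⟩

namespace Instance

variable {D R L : Type}

/-- `A i j`: demand `j` can be served immediately after demand `i`, and their requirements meet. -/
def A (I : Instance D R L) (i j : D) : Prop :=
  I.τ i + I.Δ i + I.fDem i j ≤ I.τ j ∧ ∃ r, r ∈ I.M i ∧ r ∈ I.M j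

/-- `B s d`: a resource that starts at `s` and is required by `d` can serve `d` first. -/
def B (I : Instance D R L) (s : L) (d : D) : Prop :=
  (I.fStart s d : ℤ) ≤ I.τ d ∧ ∃ r, r ∈ I.M d ∧ s ∈ I.S r

/-- `p` lists the demands visited, in this order, by a path of a resource of type `r` from `s`. -/
def IsPath (I : Instance D R L) (r : R) (s : L) (p : List D) : Prop :=
  p.Nodup ∧ (∀ d ∈ p, r ∈ I.M d) ∧ (∀ d ∈ p.head?, I.B s d) ∧ p.IsChain I.A

/-- Feasibility: resources leave only from starting locations of their type, at most as many as
there are, and each one follows a path. -/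
def Feasible (I : Instance D R L) (σ : Solution D R L) : Prop :=
  (∀ r s, s ∉ I.S r → σ.paths r s = 0) ∧
  (∀ r s, (σ.paths r s).card ≤ I.l s r) ∧
  (∀ r s, ∀ p ∈ σ.paths r s, I.IsPath r s p)

/-- A demand is met if it is visited by a resource of each type that it requires. -/
def Met (I : Instance D R L) (σ : Solution D R L) (d : D) : Prop :=
  ∀ r ∈ I.M d, ∃ s, ∃ p ∈ σ.paths r s, d ∈ p

open Classical in
/-- The total reward of the demands that are met. -/
noncomputable def objective [Fintype D] (I : Instance D R L) (σ : Solution D R L) : ℤ :=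
  ∑ d with I.Met σ d, I.w d

/-- `v` is the optimal objective value of the instance. -/
def IsOptValue [Fintype D] (I : Instance D R L) (v : ℤ) : Prop :=
  IsGreatest {x | ∃ σ, I.Feasible σ ∧ I.objective σ = x} v

/-- `σ` is an optimal solution. -/
def IsOptimal [Fintype D] (I : Instance D R L) (σ : Solution D R L) : Prop :=
  I.Feasible σ ∧ ∀ σ', I.Feasible σ' → I.objective σ' ≤ I.objective σ

/-- Every resource (of every type) starts at `s`. -/
def SameStart (I : Instance D R L) (s : L) : Prop := ∀ r, I.S r = {s}

/-- Travel times satisfy the triangle inequality. -/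
def TriangleInequality (I : Instance D R L) : Prop :=
  (∀ i j k, I.fDem i k ≤ I.fDem i j + I.fDem j k) ∧
  (∀ s j k, I.fStart s k ≤ I.fStart s j + I.fDem j k)

/-! ### The conflict graph and the subproblems -/

/-- The nodes of the conflict graph: the distinct sets `M d`. -/
def Node (I : Instance D R L) : Type := {v : Finset R // ∃ d, I.M d = v}

/-- The node of a demand. -/
def node (I : Instance D R L) (d : D) : I.Node := ⟨I.M d, d, rfl⟩

/-- The conflict graph: distinct nodes are adjacent when the sets intersect. -/
def conflictGraph (I : Instance D R L) : SimpleGraph I.Node where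
  Adj u v := u ≠ v ∧ ¬ Disjoint u.1 v.1
  symm := ⟨fun _ _ h => ⟨h.1.symm, fun h' => h.2 h'.symm⟩⟩
  loopless := ⟨fun _ h => h.1 rfl⟩

theorem Node.nonempty {I : Instance D R L} (v : I.Node) : v.1.Nonempty := by
  obtain ⟨_, d, rfl⟩ := v
  exact I.M_nonempty d

/-- The number of resources of type `r`. -/
def numRes (I : Instance D R L) (r : R) : ℕ := ∑ s ∈ I.S r, I.l s r

/-- The type in `v` with the fewest resources, ties being broken by the smaller index. This is the
smallest index in `v` once the types are labelled so that `numRes` is nondecreasing. -/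
def scarcest [LinearOrder R] (I : Instance D R L) (v : I.Node) : R :=
  (ofLex ((v.1.image fun r => toLex (I.numRes r, r)).min' (v.nonempty.image _))).2

/-- The demands whose requirement is exactly `v`. -/
abbrev DBar (I : Instance D R L) (v : I.Node) : Type := {d : D // I.M d = v.1}

/-- The single-resource-type subproblem of `v`: the resources of the scarcest type of `v`, and the
demands whose requirement is exactly `v`. -/
def subproblem [LinearOrder R] (I : Instance D R L) (v : I.Node) :
    Instance (I.DBar v) Unit L where
  S _ := I.S (I.scarcest v)
  l s _ := I.l s (I.scarcest v)
  M _ := {()}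
  M_nonempty _ := Finset.singleton_nonempty _
  τ d := I.τ d.1
  Δ d := I.Δ d.1
  w d := I.w d.1
  fStart s d := I.fStart s d.1
  fDem d e := I.fDem d.1 e.1

end Instance

/-- An `a:b`-coloring: `b` out of `a` colors for each vertex, disjoint sets for adjacent ones. -/
structure ABColoring {V : Type} (G : SimpleGraph V) (a b : ℕ) where
  colors : V → Finset (Fin a)
  card_colors : ∀ v, (colors v).card = b
  disjoint_of_adj : ∀ u v, G.Adj u v → Disjoint (colors u) (colors v)

/-! ### Algorithm C -/

section AlgorithmC

variable {D R L : Type} [Fintype D] [Fintype R] [LinearOrder R]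

open Classical in
noncomputable instance (I : Instance D R L) : Fintype I.Node :=
  inferInstanceAs (Fintype {v : Finset R // ∃ d, I.M d = v})

/-- The set `S_i` of the nodes that have color `i` among their colors. -/
noncomputable def colorClass {I : Instance D R L} {a b : ℕ} (c : ABColoring I.conflictGraph a b)
    (i : Fin a) : Finset I.Node :=
  {v | i ∈ c.colors v}

/-- The solution for color `i`: for each node `v` of color `i`, every type in `v` follows the paths
of the given solution of the subproblem of `v`. -/
noncomputable def colorSolution {I : Instance D R L} {a b : ℕ}
    (c : ABColoring I.conflictGraph a b) (sub : ∀ v : I.Node, Solution (I.DBar v) Unit L)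
    (i : Fin a) : Solution D R L where
  paths r s := ∑ v ∈ colorClass c i with r ∈ v.1,
    ((sub v).paths () s).map (List.map Subtype.val)

/-- The value of color `i`: the sum of the values of the subproblems of its nodes. -/
noncomputable def colorValue {I : Instance D R L} {a b : ℕ}
    (c : ABColoring I.conflictGraph a b) (sub : ∀ v : I.Node, Solution (I.DBar v) Unit L)
    (i : Fin a) : ℤ :=
  ∑ v ∈ colorClass c i, (I.subproblem v).objective (sub v)

/-- Algorithm C, where `sub v` is the solution found for the subproblem of `v`: the colors are
scanned in order, and the current best value and solution are replaced whenever the value of the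
color is at least the current one. -/
noncomputable def algorithmC {I : Instance D R L} {a b : ℕ}
    (c : ABColoring I.conflictGraph a b) (sub : ∀ v : I.Node, Solution (I.DBar v) Unit L) :
    ℤ × Solution D R L :=
  (List.finRange a).foldl
    (fun cur i =>
      if cur.1 ≤ colorValue c sub i then (colorValue c sub i, colorSolution c sub i) else cur)
    (0, Solution.empty D R L)

end AlgorithmC

/-! ### A model of computation with a step count -/

/-- The data that programs work on: binary trees with integer leaves. -/
inductive Datum where
  | num (z : ℤ)
  | pair (x y : Datum)

namespace Datum

/-- The number of bits (up to a constant factor) of a datum, integers being written in binary. -/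
def size : Datum → ℕ
  | num z => z.natAbs.size + 1
  | pair x y => x.size + y.size + 1

def fst : Datum → Datum
  | pair x _ => x
  | num _ => num 0

def snd : Datum → Datum
  | pair _ y => y
  | num _ => num 0

/-- `1` on pairs and `0` on integers. -/
def isPair : Datum → Datum
  | pair _ _ => num 1
  | num _ => num 0

def add : Datum → Datum
  | pair (num x) (num y) => num (x + y)
  | _ => num 0

def sub : Datum → Datum
  | pair (num x) (num y) => num (x - y)
  | _ => num 0

def le : Datum → Datum
  | pair (num x) (num y) => num (if x ≤ y then 1 else 0)
  | _ => num 0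

/-- Lists are coded by nested pairs, with the integer `0` at the end. -/
def ofList : List Datum → Datum
  | [] => num 0
  | x :: xs => pair x (ofList xs)

/-- A finite table, as a list. -/
def ofTable {n : ℕ} (f : Fin n → Datum) : Datum := ofList (List.ofFn f)

def ofNat (n : ℕ) : Datum := num n

open Classical in
noncomputable def ofProp (p : Prop) : Datum := num (if p then 1 else 0)

end Datum

/-- Programs: a WHILE language on a single store that holds one datum. -/
inductive Prog where
  | id
  | const (z : ℤ)
  | fst
  | snd
  | isPair
  | add
  | sub
  | le
  | pair (f g : Prog)
  | seq (f g : Prog)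
  | ite (c f g : Prog)
  | while (c f : Prog)

/-- `P.Runs x y t`: started on `x`, the program `P` halts with output `y` after `t` steps. A basic
operation, and each copy of the store that is made, costs the size of the store. -/
inductive Prog.Runs : Prog → Datum → Datum → ℕ → Prop
  | id (x) : Runs .id x x x.size
  | const (z x) : Runs (.const z) x (.num z) (x.size + (Datum.num z).size)
  | fst (x) : Runs .fst x x.fst x.size
  | snd (x) : Runs .snd x x.snd x.size
  | isPair (x) : Runs .isPair x x.isPair x.size
  | add (x) : Runs .add x x.add x.size
  | sub (x) : Runs .sub x x.sub x.size
  | le (x) : Runs .le x x.le x.size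
  | pair {f g x y z t u} : Runs f x y t → Runs g x z u →
      Runs (.pair f g) x (.pair y z) (t + u + x.size)
  | seq {f g x y z t u} : Runs f x y t → Runs g y z u → Runs (.seq f g) x z (t + u + 1)
  | ite_true {c f g x y z t u} : Runs c x y t → y ≠ .num 0 → Runs f x z u →
      Runs (.ite c f g) x z (t + u + x.size)
  | ite_false {c f g x z t u} : Runs c x (.num 0) t → Runs g x z u →
      Runs (.ite c f g) x z (t + u + x.size)
  | while_true {c f x y x' z t u v} : Runs c x y t → y ≠ .num 0 → Runs f x x' u →
      Runs (.while c f) x' z v → Runs (.while c f) x z (t + u + v + x.size)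
  | while_false {c f x t} : Runs c x (.num 0) t → Runs (.while c f) x x (t + x.size)

/-! ### Coding of inputs and outputs -/

/-- The code of an instance: all of its parameters, as tables. -/
noncomputable def encodeInstance {n k q : ℕ} (I : Instance (Fin n) (Fin k) (Fin q)) : Datum :=
  .ofList [.ofNat n, .ofNat k, .ofNat q,
    .ofTable fun r => .ofTable fun s => .ofProp (s ∈ I.S r),
    .ofTable fun s => .ofTable fun r => .ofNat (I.l s r),
    .ofTable fun d => .ofTable fun r => .ofProp (r ∈ I.M d),
    .ofTable fun d => .num (I.τ d),
    .ofTable fun d => .ofNat (I.Δ d),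
    .ofTable fun d => .num (I.w d),
    .ofTable fun s => .ofTable fun d => .ofNat (I.fStart s d),
    .ofTable fun i => .ofTable fun j => .ofNat (I.fDem i j)]

/-- The code of an instance with the color classes of a coloring of its conflict graph; a node is
represented by the demands that have it as their requirement. -/
noncomputable def encodeInput {n k q : ℕ} (I : Instance (Fin n) (Fin k) (Fin q)) {a b : ℕ}
    (c : ABColoring I.conflictGraph a b) : Datum :=
  .ofList [encodeInstance I, .ofNat a,
    .ofTable fun i : Fin a => .ofTable fun d => .ofProp (I.node d ∈ colorClass c i)]

/-- The code of an output: a value, and for each type and starting location a list of paths. -/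
def encodeOutput {n k q : ℕ} (val : ℤ) (paths : Fin k → Fin q → List (List (Fin n))) : Datum :=
  .pair (.num val)
    (.ofTable fun r => .ofTable fun s =>
      .ofList ((paths r s).map fun p => .ofList (p.map fun d => .ofNat d.1)))

/-- `P` outputs, on input `x` and in at most `T` steps, the value `out.1` and the solution `out.2`,
the paths of each type from each location being listed in some order. -/
def OutputsWithin {n k q : ℕ} (P : Prog) (x : Datum)
    (out : ℤ × Solution (Fin n) (Fin k) (Fin q)) (T : ℕ) : Prop :=
  ∃ paths : Fin k → Fin q → List (List (Fin n)),
    (∀ r s, (paths r s : Multiset (List (Fin n))) = out.2.paths r s) ∧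
    ∃ t ≤ T, P.Runs x (encodeOutput out.1 paths) t

end MRMD

namespace MRMD

/-! ### Polynomial bounds -/

/-! Approximation ratio. The nodes partition the demands. Take a feasible solution, keep the paths
of the scarcest type of a node `v`, and delete from them all but the met demands of `v`. The result
is feasible for the subproblem of `v` and earns exactly what the solution earned on `v`
(`Instance.exists_restriction`). Hence OPT is at most the sum of the optima of the subproblems.
Every node lies in exactly `b` of the `a` color classes, so the color values add up to `b` times
that sum (`sum_colorValue`), while each of them is at most the value returned
(`optValue_le_algorithmC`). The nodes of one color are disjoint sets of types, so letting every type
of a node copy the paths of the scarcest one is unambiguous. It is feasible because all resources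
start at the same place and every other type of the node has at least as many of them
(`feasible_colorSolution`). The types of a node then visit the same demands, so the value of the
color is attained (`objective_colorSolution`).

Running time. By the triangle inequality, "can be served later by the same resource" is transitive,
so paths are chains (`Instance.isPath_iff`), and a subproblem asks for the most rewarding set of
demands that a bounded number of chains covers. This is an assignment problem with `2n` columns:
each demand is assigned a predecessor, a source that starts a chain, or itself at the price of its
reward (`chainCost`). It is solved by the Hungarian method, whose potentials certify optimality. A
dual change multiplies the bound on the potentials by at most 4, and there are at most `n` changes
for each of the `n` rows, so all numbers keep polynomially many bits (`PolyTime.assignment`).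

Programs are not written out. `PolyTime x y` states that one program serves a whole family of
inputs, and is shown to be closed under arithmetic, logic, tables, bounded quantifiers, search and
loops. The family may be cut down to a subtype, which makes branch conditions and loop invariants
available as hypotheses where they are needed (`PolyTime.cases`, `PolyTime.loop`). -/

theorem Datum.one_le_size (x : Datum) : 1 ≤ x.size := by
  cases x <;> simp [Datum.size]

theorem Datum.size_fst_le (x : Datum) : x.fst.size ≤ x.size := by
  cases x <;> simp [Datum.size, Datum.fst]; omega

theorem Datum.size_snd_le (x : Datum) : x.snd.size ≤ x.size := by
  cases x <;> simp [Datum.size, Datum.snd]; omega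

theorem size_natAbs_add_le (x y : ℤ) :
    (x + y).natAbs.size ≤ x.natAbs.size + y.natAbs.size + 1 := by
  rw [Nat.size_le]
  have h1 := Nat.lt_size_self x.natAbs
  have h2 := Nat.lt_size_self y.natAbs
  have h3 := Int.natAbs_add_le x y
  have h4 : 2 ^ x.natAbs.size ≤ 2 ^ (x.natAbs.size + y.natAbs.size) :=
    Nat.pow_le_pow_right (by norm_num) (by omega)
  have h5 : 2 ^ y.natAbs.size ≤ 2 ^ (x.natAbs.size + y.natAbs.size) :=
    Nat.pow_le_pow_right (by norm_num) (by omega)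
  rw [pow_succ]
  omega

/-- A possible carry bit is paid for by the nodes of the pair, which disappear. -/
theorem Datum.size_add_le (x : Datum) : x.add.size ≤ x.size := by
  rcases x with z | ⟨_ | _, _ | _⟩ <;> simp only [Datum.add, Datum.size] <;> try simp
  rename_i x y
  have := size_natAbs_add_le x y
  omega

theorem Datum.size_sub_le (x : Datum) : x.sub.size ≤ x.size := by
  rcases x with z | ⟨_ | _, _ | _⟩ <;> simp only [Datum.sub, Datum.size] <;> try simp
  rename_i x y
  have := size_natAbs_add_le x (-y)
  rw [Int.natAbs_neg, ← sub_eq_add_neg] at this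
  omega

/-- Every rule charges for what it copies or creates, so an output cannot outgrow the running time.
This controls intermediate values when programs are composed. -/
theorem Prog.Runs.size_le {P : Prog} {x y : Datum} {t : ℕ} (h : P.Runs x y t) : y.size ≤ t := by
  induction h with
  | id x => exact le_rfl
  | const z x => omega
  | fst x => exact x.size_fst_le
  | snd x => exact x.size_snd_le
  | isPair x =>
    cases x with
    | num z => simp [Datum.isPair, Datum.size]
    | pair x y =>
      have := x.one_le_size
      have := y.one_le_size
      simp [Datum.isPair, Datum.size]
      omega
  | add x => exact x.size_add_le
  | sub x => exact x.size_sub_le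
  | le x =>
    rcases x with z | ⟨_ | _, _ | _⟩ <;> simp only [Datum.le, Datum.size] <;> try simp
    split_ifs <;> simp <;> omega
  | @pair f g x y z t u _ _ h1 h2 =>
    have := x.one_le_size
    simp only [Datum.size]
    omega
  | seq _ _ h1 h2 => omega
  | ite_true _ _ _ h1 h2 => omega
  | ite_false _ _ h1 h2 => omega
  | while_true _ _ _ _ h1 h2 h3 => omega
  | while_false _ h1 => omega

/-- `f` is bounded by a polynomial in the size of `x`. -/
def PolyBdd {ι : Type} (x : ι → Datum) (f : ι → ℕ) : Prop :=
  ∃ k, ∀ i, f i ≤ ((x i).size + 2) ^ k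

namespace PolyBdd

variable {ι κ : Type} {x : ι → Datum} {f g : ι → ℕ}

theorem mono (hg : PolyBdd x g) (h : ∀ i, f i ≤ g i) : PolyBdd x f :=
  hg.imp fun _ hk i => (h i).trans (hk i)

theorem size (x : ι → Datum) : PolyBdd x fun i => (x i).size := ⟨1, fun i => by simp⟩

theorem const (x : ι → Datum) (c : ℕ) : PolyBdd x fun _ => c :=
  ⟨c, fun i => Nat.lt_two_pow_self.le.trans (Nat.pow_le_pow_left (by omega) _)⟩

/-- The base of the power is at least 2, so one further factor absorbs a sum of two terms. -/
theorem add (hf : PolyBdd x f) (hg : PolyBdd x g) : PolyBdd x fun i => f i + g i := by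
  obtain ⟨k, hk⟩ := hf
  obtain ⟨l, hl⟩ := hg
  refine ⟨k + l + 1, fun i => ?_⟩
  have h1 : ((x i).size + 2) ^ k ≤ ((x i).size + 2) ^ (k + l) :=
    Nat.pow_le_pow_right (by omega) (by omega)
  have h2 : ((x i).size + 2) ^ l ≤ ((x i).size + 2) ^ (k + l) :=
    Nat.pow_le_pow_right (by omega) (by omega)
  calc f i + g i ≤ ((x i).size + 2) ^ (k + l) * 2 := by have := hk i; have := hl i; omega
    _ ≤ _ := by rw [pow_succ]; exact Nat.mul_le_mul_left _ (by omega)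

theorem mul (hf : PolyBdd x f) (hg : PolyBdd x g) : PolyBdd x fun i => f i * g i := by
  obtain ⟨k, hk⟩ := hf
  obtain ⟨l, hl⟩ := hg
  exact ⟨k + l, fun i => by rw [pow_add]; exact Nat.mul_le_mul (hk i) (hl i)⟩

theorem pow (hf : PolyBdd x f) (l : ℕ) : PolyBdd x fun i => f i ^ l := by
  obtain ⟨k, hk⟩ := hf
  exact ⟨k * l, fun i => by rw [pow_mul]; exact Nat.pow_le_pow_left (hk i) l⟩

theorem comp {y : ι → Datum} (hf : PolyBdd y f) (hy : PolyBdd x fun i => (y i).size) :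
    PolyBdd x f := by
  obtain ⟨k, hk⟩ := hf
  obtain ⟨l, hl⟩ := hy.add (const x 2)
  refine ⟨l * k, fun i => (hk i).trans ?_⟩
  rw [pow_mul]
  exact Nat.pow_le_pow_left (hl i) _

theorem reindex (hf : PolyBdd x f) (σ : κ → ι) :
    PolyBdd (fun j => x (σ j)) fun j => f (σ j) :=
  hf.imp fun _ hk j => hk (σ j)

end PolyBdd

/-! ### Coding of data types -/

/-- Types whose elements are coded by data. -/
class Enc (α : Type) where
  enc : α → Datum

open Enc

/-- Types whose elements are coded by integers. -/
class IntCode (α : Type) where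
  toInt : α → ℤ
  inj : Function.Injective toInt

open IntCode (toInt)

instance : Enc Datum := ⟨fun x => x⟩
instance {α : Type} [IntCode α] : Enc α := ⟨fun a => .num (toInt a)⟩
instance : IntCode ℤ := ⟨fun z => z, fun _ _ h => h⟩
instance : IntCode ℕ := ⟨fun n => n, fun _ _ h => Int.ofNat.inj h⟩
instance {n : ℕ} : IntCode (Fin n) :=
  ⟨fun j => ((j : ℕ) : ℤ), fun _ _ h => Fin.ext (Int.ofNat.inj h)⟩
-- `some j` has the same code as `j`, so wrapping and unwrapping cost nothing; `-1` is free to stand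
-- for `none`.
instance {n : ℕ} : IntCode (Option (Fin n)) where
  toInt o := o.elim (-1) fun j => ((j : ℕ) : ℤ)
  inj
    | none, none, _ => rfl
    | none, some j, h => by simp at h
    | some j, none, h => by simp at h
    | some j, some k, h => by simp at h; simp [Fin.ext_iff, h]
noncomputable instance : Enc Prop := ⟨Datum.ofProp⟩
instance : Enc Unit := ⟨fun _ => .num 0⟩
instance {α β : Type} [Enc α] [Enc β] : Enc (α × β) := ⟨fun p => .pair (enc p.1) (enc p.2)⟩
instance {α : Type} [Enc α] : Enc (List α) := ⟨fun l => .ofList (l.map enc)⟩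
instance {n : ℕ} {α : Type} [Enc α] : Enc (Fin n → α) := ⟨fun f => .ofTable fun j => enc (f j)⟩

theorem enc_true : enc True = Datum.num 1 := by simp [enc, Datum.ofProp]

theorem enc_false : enc False = Datum.num 0 := by simp [enc, Datum.ofProp]

theorem enc_prop_eq_zero {p : Prop} : enc p = Datum.num 0 ↔ ¬p := by
  by_cases h : p <;> simp [h, enc, Datum.ofProp]

theorem Datum.size_ofList (l : List Datum) :
    (ofList l).size = (l.map fun x => x.size + 1).sum + 1 := by
  induction l with
  | nil => simp [ofList, size]
  | cons a l ih => simp [ofList, size, ih]; omega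

theorem Datum.length_le_size (l : List Datum) : l.length ≤ (ofList l).size := by
  induction l with
  | nil => simp
  | cons a l ih => simp [ofList, size]; omega

theorem Datum.size_ofList_le (l : List Datum) (B : ℕ) (h : ∀ x ∈ l, x.size ≤ B) :
    (ofList l).size ≤ l.length * (B + 1) + 1 := by
  rw [size_ofList]
  have := List.sum_le_card_nsmul (l.map fun x => x.size + 1) (B + 1) (by
    intro y hy
    obtain ⟨x, hx, rfl⟩ := List.mem_map.1 hy
    have := h x hx
    omega)
  rw [List.length_map, smul_eq_mul] at this
  omega

theorem Datum.size_ofTable_le {n : ℕ} (f : Fin n → Datum) (B : ℕ) (h : ∀ j, (f j).size ≤ B) :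
    (ofTable f).size ≤ n * (B + 1) + 1 := by
  have := size_ofList_le (List.ofFn f) B (by simpa [List.mem_ofFn] using h)
  simpa [ofTable] using this

theorem Datum.size_mem_le {l : List Datum} {x : Datum} (h : x ∈ l) : x.size ≤ (ofList l).size := by
  induction l with
  | nil => simp at h
  | cons a l ih =>
    simp only [ofList, size]
    rcases List.mem_cons.1 h with rfl | h
    · omega
    · have := ih h
      omega

theorem Datum.size_num_le {z : ℤ} {b : ℕ} (h : z.natAbs ≤ 2 ^ b) : (num z).size ≤ b + 2 := by
  have : z.natAbs.size ≤ b + 1 := Nat.size_le.2 (h.trans_lt (Nat.pow_lt_pow_right (by norm_num) (by omega)))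
  simp [size]
  omega

theorem Datum.natAbs_lt (z : ℤ) : z.natAbs < 2 ^ (num z).size :=
  (Nat.lt_size_self _).trans_le (Nat.pow_le_pow_right (by norm_num) (by simp [size]))

theorem Datum.size_num_natCast_le (n : ℕ) : (num (n : ℤ)).size ≤ n + 2 :=
  size_num_le (by simpa using Nat.lt_two_pow_self.le)

/-! ### Polynomial-time computability -/

/-- A single program computes `y i` from `x i`, for all `i`, in polynomial time. -/
def PolyTime {ι : Type} (x : ι → Datum) {α : ι → Type} [∀ i, Enc (α i)] (y : ∀ i, α i) : Prop :=
  ∃ (P : Prog) (t : ι → ℕ), PolyBdd x t ∧ ∀ i, P.Runs (x i) (enc (y i)) (t i)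

namespace PolyTime

variable {ι κ : Type} {x : ι → Datum} {α β : ι → Type} [∀ i, Enc (α i)] [∀ i, Enc (β i)]

theorem size_bdd {y : ∀ i, α i} (h : PolyTime x y) : PolyBdd x fun i => (enc (y i)).size := by
  obtain ⟨P, t, ht, hP⟩ := h
  exact ht.mono fun i => (hP i).size_le

theorem id (x : ι → Datum) : PolyTime x x := ⟨.id, _, PolyBdd.size x, fun i => .id (x i)⟩

theorem num (x : ι → Datum) (z : ℤ) : PolyTime x fun _ => Datum.num z :=
  ⟨.const z, _, (PolyBdd.size x).add (PolyBdd.const x _), fun i => .const z (x i)⟩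

theorem int (x : ι → Datum) (z : ℤ) : PolyTime x fun _ => z := num x z

theorem comp {y : ∀ i, α i} {z : ∀ i, β i} (hy : PolyTime x y)
    (hz : PolyTime (fun i => enc (y i)) z) : PolyTime x z := by
  have hs := hy.size_bdd
  obtain ⟨P, t, ht, hP⟩ := hy
  obtain ⟨Q, u, hu, hQ⟩ := hz
  exact ⟨.seq P Q, _, (ht.add (hu.comp hs)).add (PolyBdd.const x 1),
    fun i => .seq (hP i) (hQ i)⟩

theorem trans {y : ι → Datum} {z : ∀ i, β i} (hy : PolyTime x y) (hz : PolyTime y z) :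
    PolyTime x z := hy.comp hz

theorem reindex {y : ∀ i, α i} (hy : PolyTime x y) (σ : κ → ι) :
    PolyTime (fun j => x (σ j)) fun j => y (σ j) := by
  obtain ⟨P, t, ht, hP⟩ := hy
  exact ⟨P, _, ht.reindex σ, fun j => hP (σ j)⟩

theorem mk {y : ∀ i, α i} {z : ∀ i, β i} (hy : PolyTime x y) (hz : PolyTime x z) :
    PolyTime x fun i => (y i, z i) := by
  obtain ⟨P, t, ht, hP⟩ := hy
  obtain ⟨Q, u, hu, hQ⟩ := hz
  exact ⟨.pair P Q, _, (ht.add hu).add (PolyBdd.size x), fun i => .pair (hP i) (hQ i)⟩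

theorem pair {y z : ι → Datum} (hy : PolyTime x y) (hz : PolyTime x z) :
    PolyTime x fun i => Datum.pair (y i) (z i) := mk hy hz

/-- Only the code of the result matters. -/
theorem of_enc {y : ∀ i, α i} {z : ∀ i, β i} (hz : PolyTime x z) (h : ∀ i, enc (y i) = enc (z i)) :
    PolyTime x y := by
  obtain ⟨P, t, ht, hP⟩ := hz
  exact ⟨P, t, ht, fun i => by rw [h]; exact hP i⟩

theorem dfst {y : ι → Datum} (hy : PolyTime x y) : PolyTime x fun i => (y i).fst :=
  hy.comp ⟨.fst, _, PolyBdd.size y, fun i => .fst (y i)⟩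

theorem dsnd {y : ι → Datum} (hy : PolyTime x y) : PolyTime x fun i => (y i).snd :=
  hy.comp ⟨.snd, _, PolyBdd.size y, fun i => .snd (y i)⟩

theorem disPair {y : ι → Datum} (hy : PolyTime x y) : PolyTime x fun i => (y i).isPair :=
  hy.comp ⟨.isPair, _, PolyBdd.size y, fun i => .isPair (y i)⟩

theorem fst {y : ∀ i, α i × β i} (hy : PolyTime x y) : PolyTime x fun i => (y i).1 :=
  dfst (y := fun i => enc (y i)) hy

theorem snd {y : ∀ i, α i × β i} (hy : PolyTime x y) : PolyTime x fun i => (y i).2 :=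
  dsnd (y := fun i => enc (y i)) hy

theorem add {f g : ι → ℤ} (hf : PolyTime x f) (hg : PolyTime x g) :
    PolyTime x fun i => f i + g i :=
  (hf.mk hg).comp ⟨.add, _, PolyBdd.size _, fun _ => .add _⟩

theorem sub {f g : ι → ℤ} (hf : PolyTime x f) (hg : PolyTime x g) :
    PolyTime x fun i => f i - g i :=
  (hf.mk hg).comp ⟨.sub, _, PolyBdd.size _, fun _ => .sub _⟩

theorem le_int {f g : ι → ℤ} (hf : PolyTime x f) (hg : PolyTime x g) :
    PolyTime x fun i => f i ≤ g i := by
  refine (hf.mk hg).comp (of_enc (z := fun i => (enc (f i, g i)).le)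
    ⟨.le, _, PolyBdd.size _, fun i => .le _⟩ fun i => ?_)
  by_cases h : f i ≤ g i <;> simp [enc, Datum.le, Datum.ofProp, toInt, h]

open Classical in
theorem not {p : ι → Prop} (hp : PolyTime x p) : PolyTime x fun i => ¬p i :=
  -- Truth values are coded by 0 and 1, so connectives are arithmetic: here `1 - p`, and for `and`
  -- the test `2 ≤ p + q`.
  of_enc (sub (int x 1) (of_enc (y := fun i => if p i then (1 : ℤ) else 0) hp fun i => by
      by_cases h : p i <;> simp [enc, Datum.ofProp, toInt, h]))
    fun i => by by_cases h : p i <;> simp [enc, Datum.ofProp, toInt, h]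

open Classical in
theorem and {p q : ι → Prop} (hp : PolyTime x p) (hq : PolyTime x q) :
    PolyTime x fun i => p i ∧ q i := by
  have hp' : PolyTime x (fun i => if p i then (1 : ℤ) else 0) := of_enc hp fun i => by
    by_cases h : p i <;> simp [enc, Datum.ofProp, toInt, h]
  have hq' : PolyTime x (fun i => if q i then (1 : ℤ) else 0) := of_enc hq fun i => by
    by_cases h : q i <;> simp [enc, Datum.ofProp, toInt, h]
  have := le_int (int x 2) (hp'.add hq')
  convert this using 3 with i
  by_cases h : p i <;> by_cases h' : q i <;> simp [h, h']

theorem congr_prop {p q : ι → Prop} (hp : PolyTime x p) (h : ∀ i, q i ↔ p i) : PolyTime x q := by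
  rwa [show q = p from funext fun i => propext (h i)]

theorem or {p q : ι → Prop} (hp : PolyTime x p) (hq : PolyTime x q) :
    PolyTime x fun i => p i ∨ q i :=
  (hp.not.and hq.not).not.congr_prop fun i => by tauto

theorem imp {p q : ι → Prop} (hp : PolyTime x p) (hq : PolyTime x q) :
    PolyTime x fun i => p i → q i :=
  (hp.and hq.not).not.congr_prop fun i => by tauto

theorem iff {p q : ι → Prop} (hp : PolyTime x p) (hq : PolyTime x q) :
    PolyTime x fun i => (p i ↔ q i) :=
  ((hp.imp hq).and (hq.imp hp)).congr_prop fun i => by tauto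

theorem toInt {γ : ι → Type} [∀ i, IntCode (γ i)] {f : ∀ i, γ i} (hf : PolyTime x f) :
    PolyTime x fun i => IntCode.toInt (f i) := hf

theorem lt_int {f g : ι → ℤ} (hf : PolyTime x f) (hg : PolyTime x g) :
    PolyTime x fun i => f i < g i :=
  (hg.le_int hf).not.congr_prop fun i => by simp

theorem eq {γ : ι → Type} [∀ i, IntCode (γ i)] {f g : ∀ i, γ i} (hf : PolyTime x f)
    (hg : PolyTime x g) : PolyTime x fun i => f i = g i :=
  ((hf.toInt.le_int hg.toInt).and (hg.toInt.le_int hf.toInt)).congr_prop fun i => by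
    rw [← le_antisymm_iff, (IntCode.inj (α := γ i)).eq_iff]

theorem val {n : ι → ℕ} {f : ∀ i, Fin (n i)} (hf : PolyTime x f) :
    PolyTime x fun i => ((f i : ℕ) : ℤ) := hf

/-- Each branch has to be correct and fast only on the inputs that enter it, hence the restriction
of the family to subtypes. -/
theorem cases {y : ∀ i, α i} {p : ι → Prop} (hp : PolyTime x p)
    (h1 : PolyTime (fun i : {i // p i} => x i.1) fun i => y i.1)
    (h2 : PolyTime (fun i : {i // ¬p i} => x i.1) fun i => y i.1) : PolyTime x y := by
  classical
  obtain ⟨P, t, ht, hP⟩ := hp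
  obtain ⟨Q, u, ⟨k, hk⟩, hQ⟩ := h1
  obtain ⟨R, v, ⟨l, hl⟩, hR⟩ := h2
  let w : ι → ℕ := fun i => if h : p i then u ⟨i, h⟩ else v ⟨i, h⟩
  have hw : PolyBdd x w := by
    refine PolyBdd.mono (PolyBdd.add ⟨k, fun _ => le_rfl⟩ ⟨l, fun _ => le_rfl⟩) fun i => ?_
    by_cases h : p i
    · simp only [w, h, dite_true]
      exact (hk ⟨i, h⟩).trans (Nat.le_add_right _ _)
    · simp only [w, h, dite_false]
      exact (hl ⟨i, h⟩).trans (Nat.le_add_left _ _)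
  refine ⟨.ite P Q R, _, (ht.add hw).add (PolyBdd.size x), fun i => ?_⟩
  by_cases h : p i
  · simp only [w, h, dite_true]
    exact .ite_true (hP i) (by simpa [enc_prop_eq_zero] using h) (hQ ⟨i, h⟩)
  · simp only [w, h, dite_false]
    have := hP i
    rw [enc_prop_eq_zero.2 h] at this
    exact .ite_false this (hR ⟨i, h⟩)

theorem sub_index {y : ∀ i, α i} (h : PolyTime x y) (p : ι → Prop) :
    PolyTime (fun i : {i // p i} => x i.1) fun i => y i.1 := h.reindex Subtype.val

theorem ite {y z : ∀ i, α i} {p : ι → Prop} [∀ i, Decidable (p i)] (hp : PolyTime x p)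
    (hy : PolyTime x y) (hz : PolyTime x z) : PolyTime x fun i => if p i then y i else z i := by
  refine cases hp ?_ ?_
  · exact (hy.sub_index p).of_enc fun i => by rw [if_pos i.2]
  · exact (hz.sub_index fun i => ¬p i).of_enc fun i => by rw [if_neg i.2]

/-- Case distinction for results that are only specified. -/
theorem exists_cases {p : ι → Prop} {R : ∀ i, α i → Prop} (hp : PolyTime x p)
    (h1 : ∃ y : ∀ i : {i // p i}, α i.1, (∀ i, R i.1 (y i)) ∧
      PolyTime (fun i : {i // p i} => x i.1) y)
    (h2 : ∃ y : ∀ i : {i // ¬p i}, α i.1, (∀ i, R i.1 (y i)) ∧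
      PolyTime (fun i : {i // ¬p i} => x i.1) y) :
    ∃ y : ∀ i, α i, (∀ i, R i (y i)) ∧ PolyTime x y := by
  classical
  obtain ⟨y1, hR1, hy1⟩ := h1
  obtain ⟨y2, hR2, hy2⟩ := h2
  refine ⟨fun i => if h : p i then y1 ⟨i, h⟩ else y2 ⟨i, h⟩, fun i => ?_, cases hp ?_ ?_⟩
  · by_cases h : p i
    · simpa [h] using hR1 ⟨i, h⟩
    · simpa [h] using hR2 ⟨i, h⟩
  · exact hy1.of_enc fun i => by rw [dif_pos i.2]
  · exact hy2.of_enc fun i => by rw [dif_neg i.2]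

/-! ### Loops -/

/-- The cost of a round is polynomial in the size of the store at that round. `hs` bounds all these
sizes by one polynomial in the initial size, which excludes the blow-up of iterated polynomial
bounds. -/
theorem while_loop {s : ι → ℕ → Datum} {N : ι → ℕ}
    (hc : PolyTime (fun p : Σ i, Fin (N i + 1) => s p.1 p.2) fun p => (p.2 : ℕ) < N p.1)
    (hb : PolyTime (fun p : Σ i, Fin (N i) => s p.1 p.2) fun p => s p.1 (p.2 + 1))
    (hs : ∃ k, ∀ i t, t ≤ N i → (s i t).size ≤ ((s i 0).size + 2) ^ k)
    (hN : PolyBdd (fun i => s i 0) N) :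
    PolyTime (fun i => s i 0) fun i => s i (N i) := by
  obtain ⟨P, t, ⟨kt, ht⟩, hP⟩ := hc
  obtain ⟨Q, u, ⟨ku, hu⟩, hQ⟩ := hb
  obtain ⟨ks, hks⟩ := hs
  let tt : ι → ℕ → ℕ := fun i j => if h : j < N i + 1 then t ⟨i, j, h⟩ else 0
  let uu : ι → ℕ → ℕ := fun i j => if h : j < N i then u ⟨i, j, h⟩ else 0
  let T : ι → ℕ → ℕ := fun i m => tt i (N i) + (s i (N i)).size +
    ∑ j ∈ Finset.range m, (tt i (N i - 1 - j) + uu i (N i - 1 - j) + (s i (N i - 1 - j)).size)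
  -- The run is built backwards from the exit: `m` is the number of rounds that remain, and `T i m`
  -- their cost.
  have key : ∀ i m, m ≤ N i → (Prog.while P Q).Runs (s i (N i - m)) (s i (N i)) (T i m) := by
    intro i m
    induction m with
    | zero =>
      intro _
      have h := hP ⟨i, Fin.last _⟩
      rw [enc_prop_eq_zero.2 (by simp)] at h
      simpa [T, tt, Fin.last] using Prog.Runs.while_false (f := Q) h
    | succ m ih =>
      intro hm
      have hlt : N i - (m + 1) < N i := by omega
      have h1 := hP ⟨i, ⟨N i - (m + 1), by omega⟩⟩
      have h2 : Q.Runs (s i (N i - (m + 1))) (s i (N i - (m + 1) + 1)) _ := hQ ⟨i, ⟨N i - (m + 1), hlt⟩⟩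
      have h3 := ih (by omega)
      rw [show N i - (m + 1) + 1 = N i - m by omega] at h2
      have h4 := Prog.Runs.while_true h1 (fun h => enc_prop_eq_zero.1 h hlt) h2 h3
      convert h4 using 1
      simp only [T, Finset.sum_range_succ, show N i - 1 - m = N i - (m + 1) by omega, tt, uu, hlt,
        show N i - (m + 1) < N i + 1 by omega, dite_true]
      ring
  refine ⟨.while P Q, fun i => T i (N i), ?_, fun i => by
    have := key i (N i) le_rfl
    rwa [Nat.sub_self] at this⟩
  have hS : PolyBdd (fun i => s i 0) fun i => ((s i 0).size + 2) ^ ks := ⟨ks, fun _ => le_rfl⟩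
  have hS2 := hS.add (PolyBdd.const _ 2)
  refine (((hS2.pow kt).add hS).add (hN.mul (((hS2.pow kt).add (hS2.pow ku)).add hS))).mono
    fun i => ?_
  have htt : ∀ j ≤ N i, tt i j ≤ (((s i 0).size + 2) ^ ks + 2) ^ kt := fun j hj => by
    simp only [tt, Nat.lt_succ_of_le hj, dite_true]
    exact (ht _).trans (Nat.pow_le_pow_left (Nat.add_le_add_right (hks i j hj) 2) kt)
  have huu : ∀ j ≤ N i, uu i j ≤ (((s i 0).size + 2) ^ ks + 2) ^ ku := fun j hj => by
    simp only [uu]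
    split_ifs
    · exact (hu _).trans (Nat.pow_le_pow_left (Nat.add_le_add_right (hks i j hj) 2) ku)
    · exact Nat.zero_le _
  refine Nat.add_le_add (Nat.add_le_add (htt _ le_rfl) (hks i _ le_rfl)) ?_
  refine (Finset.sum_le_card_nsmul (Finset.range (N i)) _ _ fun j _ => ?_).trans
    (by rw [Finset.card_range, smul_eq_mul])
  exact Nat.add_le_add (Nat.add_le_add (htt _ (by omega)) (huu _ (by omega)))
    (hks i _ (by omega))

/-- Iteration over a list, the state after `t` elements being `s i t`. -/
theorem fold {e : ι → List Datum} (he : PolyTime x fun i => Datum.ofList (e i))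
    {s : ι → ℕ → Datum} (h0 : PolyTime x fun i => s i 0)
    (hs : PolyBdd (fun p : Σ i, Fin ((e i).length + 1) => x p.1) fun p => (s p.1 p.2).size)
    (hstep : PolyTime
      (fun p : Σ i, Fin (e i).length => Datum.pair (x p.1) (.pair ((e p.1)[p.2]) (s p.1 p.2)))
      fun p => s p.1 (p.2 + 1)) :
    PolyTime x fun i => s i (e i).length := by
  -- The store keeps the original input beside the rest of the list and the state, so that the body
  -- of the loop can consult it.
  let S : ι → ℕ → Datum := fun i t => .pair (x i) (.pair (.ofList ((e i).drop t)) (s i t))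
  have hlen : PolyBdd x fun i => (e i).length := he.size_bdd.mono fun i => Datum.length_le_size _
  have hx : ∀ i, (x i).size ≤ (S i 0).size := fun i => by simp only [S, Datum.size]; omega
  have hS0 : PolyTime x fun i => S i 0 := (id x).pair (he.pair h0)
  have hmono : ∀ f : ι → ℕ, PolyBdd x f → PolyBdd (fun i => S i 0) f := fun f ⟨k, hk⟩ =>
    ⟨k, fun i => (hk i).trans (Nat.pow_le_pow_left (Nat.add_le_add_right (hx i) 2) k)⟩
  have hdrop : ∀ i t, (Datum.ofList ((e i).drop t)).size ≤ (Datum.ofList (e i)).size := fun i t => by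
    rw [Datum.size_ofList, Datum.size_ofList]
    have := (((e i).drop_sublist t).map fun x => x.size + 1).sum_le_sum (by simp)
    omega
  refine hS0.comp ((dsnd (dsnd (while_loop (s := S) (N := fun i => (e i).length) ?_ ?_ ?_
    (hmono _ hlen)))))
  · refine of_enc (disPair (dfst (dsnd (id _)))) fun p => ?_
    change enc ((p.2 : ℕ) < (e p.1).length) = (Datum.ofList ((e p.1).drop p.2)).isPair
    by_cases h : (p.2 : ℕ) < (e p.1).length
    · rw [List.drop_eq_getElem_cons h, eq_true h]
      exact enc_true
    · rw [List.drop_eq_nil_of_le (not_lt.1 h), eq_false h]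
      exact enc_false
  · have hdrop : ∀ p : Σ i, Fin (e i).length,
        (e p.1).drop p.2 = (e p.1)[p.2] :: (e p.1).drop (p.2 + 1) := fun p =>
      List.drop_eq_getElem_cons p.2.2
    have hQ : PolyTime (fun p : Σ i, Fin (e i).length => S p.1 p.2)
        fun p => Datum.pair (x p.1) (.pair ((e p.1)[p.2]) (s p.1 p.2)) :=
      of_enc ((dfst (id _)).pair ((dfst (dfst (dsnd (id _)))).pair (dsnd (dsnd (id _)))))
        fun p => by
          change _ = Datum.pair (x p.1) (.pair (Datum.ofList ((e p.1).drop p.2)).fst (s p.1 p.2))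
          rw [hdrop]
          rfl
    refine of_enc ((dfst (id _)).pair ((dsnd (dfst (dsnd (id _)))).pair (hQ.comp hstep)))
      fun p => ?_
    change _ = Datum.pair (x p.1) (.pair (Datum.ofList ((e p.1).drop p.2)).snd (s p.1 (p.2 + 1)))
    rw [hdrop]
    rfl
  · obtain ⟨k, hk⟩ := hs
    have hk' : PolyBdd x fun i => ((x i).size + 2) ^ k := ⟨k, fun _ => le_rfl⟩
    obtain ⟨l, hl⟩ := hmono _ ((((PolyBdd.size x).add he.size_bdd).add hk').add
      (PolyBdd.const x 2))
    refine ⟨l, fun i t ht => le_trans ?_ (hl i)⟩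
    have h1 : (s i t).size ≤ ((x i).size + 2) ^ k := hk ⟨i, t, Nat.lt_succ_of_le ht⟩
    have h2 := hdrop i t
    simp only [S, Datum.size]
    change _ ≤ (x i).size + (Datum.ofList (e i)).size + _ + _
    omega

/-! ### Tables and bound indices -/

/-- The tables of length `n i` can be indexed. -/
abbrev Index (x : ι → Datum) (n : ι → ℕ) : Prop := PolyTime x fun i => fun j : Fin (n i) => j

/-- The data of the context, extended by an index. -/
abbrev Ext (x : ι → Datum) (n : ι → ℕ) : (Σ i, Fin (n i)) → Datum :=
  fun p => .pair (x p.1) (enc p.2)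

theorem lift {a b : ι → Datum} {y : ∀ i, α i} (h : PolyTime a y) :
    PolyTime (fun i => .pair (a i) (b i)) y := trans (dfst (id _)) h

theorem state (a : ι → Datum) (y : ∀ i, α i) : PolyTime (fun i => .pair (a i) (enc (y i))) y :=
  dsnd (id _)

/-- Together with `var`, this treats bound indices in de Bruijn style: each binder pairs one more
index to the input, `var` reads the innermost index, and each `wk` passes over one binder. -/
theorem wk {y : ∀ i, α i} (h : PolyTime x y) (n : ι → ℕ) : PolyTime (Ext x n) fun p => y p.1 :=
  comp (y := fun p : Σ i, Fin (n i) => x p.1) (dfst (id _)) (h.reindex Sigma.fst)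

theorem var (x : ι → Datum) (n : ι → ℕ) : PolyTime (Ext x n) fun p => p.2 :=
  dsnd (id (Ext x n))

theorem reverse {e : ι → List Datum} (he : PolyTime x fun i => Datum.ofList (e i)) :
    PolyTime x fun i => Datum.ofList (e i).reverse := by
  have := fold (s := fun i t => .ofList ((e i).take t).reverse) he (num x 0) ?_ ?_
  · simpa using this
  · refine (he.size_bdd.reindex Sigma.fst).mono fun p => ?_
    change _ ≤ (Datum.ofList (e p.1)).size
    rw [Datum.size_ofList, Datum.size_ofList, List.map_reverse, List.sum_reverse]
    have := (((e p.1).take_sublist p.2).map fun x => x.size + 1).sum_le_sum (by simp)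
    omega
  · refine of_enc ((dfst (dsnd (id _))).pair (dsnd (dsnd (id _)))) fun p => ?_
    change Datum.ofList ((e p.1).take (p.2 + 1)).reverse = Datum.ofList (_ :: _)
    rw [List.take_succ_eq_append_getElem p.2.2, List.reverse_append]
    rfl

/-- Iteration over a list from its end. -/
theorem foldr {e : ι → List Datum} (he : PolyTime x fun i => Datum.ofList (e i))
    {s : ι → ℕ → Datum} (h0 : PolyTime x fun i => s i (e i).length)
    (hs : PolyBdd (fun p : Σ i, Fin ((e i).length + 1) => x p.1) fun p => (s p.1 p.2).size)
    (hstep : PolyTime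
      (fun p : Σ i, Fin (e i).length =>
        Datum.pair (x p.1) (.pair ((e p.1)[p.2]) (s p.1 (p.2 + 1))))
      fun p => s p.1 p.2) :
    PolyTime x fun i => s i 0 := by
  have := fold (s := fun i t => s i ((e i).length - t)) he.reverse h0 ?_ ?_
  · simpa using this
  · have := hs.reindex fun p : Σ i, Fin ((e i).reverse.length + 1) =>
      (⟨p.1, (e p.1).length - p.2, by omega⟩ : Σ i, Fin ((e i).length + 1))
    exact this
  · have := hstep.reindex fun p : Σ i, Fin (e i).reverse.length =>
      (⟨p.1, (e p.1).length - 1 - p.2, by have := p.2.2; simp at this; omega⟩ :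
        Σ i, Fin (e i).length)
    convert this using 3 with p p
    · have := p.2.2
      simp at this
      simp
      congr 1
      omega
    · change _ = (e p.1).length - 1 - p.2
      omega

/-- A computed table has polynomial size, hence polynomially many rows; loops over its indices are
therefore affordable. -/
theorem bdd {n : ι → ℕ} (hn : Index x n) : PolyBdd x n :=
  PolyBdd.mono hn.size_bdd fun i =>
    (List.length_ofFn (f := fun j : Fin (n i) => enc j)).symm.le.trans (Datum.length_le_size _)

theorem _root_.MRMD.PolyBdd.of_ext {n : ι → ℕ} (hn : Index x n) {f : (Σ i, Fin (n i)) → ℕ}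
    (hf : PolyBdd (Ext x n) f) : PolyBdd (fun q : Σ i, Fin (n i) => x q.1) f := by
  refine hf.comp (((((PolyBdd.size x).add hn.size_bdd).add (PolyBdd.const x 1)).reindex
    Sigma.fst).mono fun q => ?_)
  have : (enc q.2).size ≤ (enc fun j : Fin (n q.1) => j).size :=
    Datum.size_mem_le (List.mem_ofFn.2 ⟨q.2, rfl⟩)
  simp only [Datum.size]
  omega

/-- The list of the values of a function at the indices that satisfy a condition. -/
theorem filter_map {n : ι → ℕ} (hn : Index x n) {p : ∀ i, Fin (n i) → Prop}
    [∀ i, DecidablePred (p i)] (hp : PolyTime (Ext x n) fun q => p q.1 q.2)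
    {f : ∀ i, Fin (n i) → α i} (hf : PolyTime (Ext x n) fun q => f q.1 q.2) :
    PolyTime x fun i => ((List.finRange (n i)).filter (p i)).map (f i) := by
  let e : ι → List Datum := fun i => List.ofFn fun j : Fin (n i) => enc j
  -- The list is processed from its end, so that putting each new value in front preserves the
  -- order.
  let s : ι → ℕ → Datum := fun i t =>
    enc ((((List.finRange (n i)).drop t).filter (p i)).map (f i))
  have hlen : ∀ i, (e i).length = n i := fun i => by simp [e]
  have he : PolyTime x fun i => Datum.ofList (e i) := hn
  refine of_enc (foldr (s := s) he ?_ ?_ ?_) fun i => by simp [s, enc]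
  · exact of_enc (num x 0) fun i => by simp [s, enc, e, Datum.ofList, List.drop_eq_nil_of_le]
  · obtain ⟨k, hk⟩ := PolyBdd.of_ext hn hf.size_bdd
    have hk' : PolyBdd x fun i => ((x i).size + 2) ^ k := ⟨k, fun _ => le_rfl⟩
    refine (((hn.bdd).mul (hk'.add (PolyBdd.const x 1))).add
      (PolyBdd.const x 1)).reindex Sigma.fst |>.mono fun q => ?_
    refine (Datum.size_ofList_le _ (((x q.1).size + 2) ^ k) ?_).trans ?_
    · intro d hd
      obtain ⟨a, ha, rfl⟩ := List.mem_map.1 hd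
      obtain ⟨j, -, rfl⟩ := List.mem_map.1 ha
      exact hk ⟨q.1, j⟩
    · refine Nat.add_le_add_right (Nat.mul_le_mul_right _ ?_) 1
      rw [List.length_map, List.length_map]
      refine (List.length_filter_le _ _).trans ?_
      simp
  · let σ : (Σ i, Fin (e i).length) → Σ i, Fin (n i) := fun q => ⟨q.1, q.2.cast (hlen q.1)⟩
    have hσ : PolyTime (fun q : Σ i, Fin (e i).length =>
        Datum.pair (x q.1) (.pair ((e q.1)[q.2]) (s q.1 (q.2 + 1)))) fun q => Ext x n (σ q) :=
      of_enc ((dfst (id _)).pair (dfst (dsnd (id _)))) fun q => by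
        change Datum.pair (x q.1) _ = .pair (x q.1) ((e q.1)[q.2])
        simp only [e, σ, Fin.getElem_fin, List.getElem_ofFn]
        rfl
    classical
    refine of_enc (ite (hσ.comp (hp.reindex σ))
      ((hσ.comp (hf.reindex σ)).of_enc (y := fun q => enc (f (σ q).1 (σ q).2)) (fun _ => rfl)
        |>.pair (dsnd (dsnd (id _)))) (dsnd (dsnd (id _)))) fun q => ?_
    have hq : (q.2 : ℕ) < (List.finRange (n q.1)).length := by simpa [hlen] using q.2.2
    change enc ((((List.finRange (n q.1)).drop q.2).filter (p q.1)).map (f q.1)) = _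
    rw [List.drop_eq_getElem_cons hq, List.filter_cons]
    have hget : (List.finRange (n q.1))[(q.2 : ℕ)] = (σ q).2 := by simp [σ]; rfl
    by_cases h : p q.1 (σ q).2
    · rw [hget, if_pos (by simpa using h), if_pos h]
      rfl
    · rw [hget, if_neg (by simpa using h), if_neg h]
      rfl

/-- The table of a function. -/
theorem lam {n : ι → ℕ} (hn : Index x n) {f : ∀ i, Fin (n i) → α i}
    (hf : PolyTime (Ext x n) fun q => f q.1 q.2) : PolyTime x f :=
  of_enc (filter_map hn (p := fun _ _ => True) (num _ 1 |>.of_enc fun _ => enc_true) hf) fun i => by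
    simp [enc, Datum.ofTable, List.ofFn_eq_map, Function.comp_def]

/-- A table with `n i` rows. -/
theorem index_of_list {e : ι → List Datum} (he : PolyTime x fun i => Datum.ofList (e i)) :
    Index x fun i => (e i).length := by
  let r : ℕ → List Datum := fun t => (List.range t).map fun j : ℕ => Datum.num (j : ℤ)
  -- A counter, with the indices already passed; these accumulate in reverse order and are turned
  -- round at the end.
  let s : ι → ℕ → Datum := fun _ t => .pair (.num t) (.ofList (r t).reverse)
  have hlen : PolyBdd x fun i => (e i).length := he.size_bdd.mono fun i => Datum.length_le_size _
  have h := fold (s := s) he ((num x 0).pair (num x 0)) ?_ ?_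
  · refine of_enc (reverse (e := fun i => (r (e i).length).reverse) (dsnd h)) fun i => ?_
    change Datum.ofList (List.ofFn fun j : Fin (e i).length => Datum.num ((j : ℕ) : ℤ)) = _
    rw [List.reverse_reverse]
    congr 1
    exact List.ext_getElem (by simp [r]) fun t _ _ => by simp [r]
  · refine ((((hlen.mul (hlen.add (PolyBdd.const x 3))).add hlen).add
      (PolyBdd.const x 4)).reindex Sigma.fst).mono fun p => ?_
    have hp : (p.2 : ℕ) ≤ (e p.1).length := Nat.lt_succ_iff.1 p.2.2
    have h1 := Datum.size_num_natCast_le p.2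
    have h2 := Datum.size_ofList_le (r p.2).reverse (p.2 + 2) fun d hd => by
      obtain ⟨j, hj, rfl⟩ := List.mem_map.1 (List.mem_reverse.1 hd)
      have := Datum.size_num_natCast_le j
      have := List.mem_range.1 hj
      omega
    have h3 : (r p.2).reverse.length * ((p.2 : ℕ) + 2 + 1) ≤
        (e p.1).length * ((e p.1).length + 3) :=
      Nat.mul_le_mul (by simpa [r] using hp) (by omega)
    change (Datum.num ((p.2 : ℕ) : ℤ)).size + (Datum.ofList (r p.2).reverse).size + 1 ≤ _
    omega
  · have ht : PolyTime (fun p : Σ i, Fin (e i).length =>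
        Datum.pair (x p.1) (.pair ((e p.1)[p.2]) (s p.1 p.2))) fun p => ((p.2 : ℕ) : ℤ) :=
      dfst (dsnd (dsnd (id _)))
    refine of_enc ((ht.add (int _ 1)).mk (pair ht (dsnd (dsnd (dsnd (id _)))))) fun p => ?_
    change Datum.pair _ (Datum.ofList (r (p.2 + 1)).reverse) =
      Datum.pair (.num (p.2 + 1)) (Datum.ofList (Datum.num (p.2 : ℕ) :: (r p.2).reverse))
    simp [r, List.range_succ]

/-- The index range of any computed table comes for free by counting its rows. -/
theorem index {n : ι → ℕ} {f : ∀ i, Fin (n i) → α i} (hf : PolyTime x f) : Index x n := by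
  have h := index_of_list (e := fun i => List.ofFn fun j => enc (f i j)) hf
  simpa using h

/-- Table lookup. -/
theorem app {n : ι → ℕ} {f : ∀ i, Fin (n i) → α i} {j : ∀ i, Fin (n i)} (hf : PolyTime x f)
    (hj : PolyTime x j) : PolyTime x fun i => f i (j i) := by
  let e : ι → List Datum := fun i => List.ofFn fun j => enc (f i j)
  let s : ι → ℕ → Datum := fun i t =>
    .pair (.num t) (if (j i : ℕ) < t then enc (f i (j i)) else .num 0)
  have hlen : ∀ i, (e i).length = n i := fun i => by simp [e]
  have he : PolyTime x fun i => Datum.ofList (e i) := hf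
  have h := fold (s := s) he ((num x 0).pair (of_enc (num x 0) fun i => by simp [enc])) ?_ ?_
  · exact of_enc (dsnd h) fun i => by
      have := (j i).2
      simp only [s, hlen, this, if_true]
      rfl
  · refine (((hf.index.bdd.add hf.size_bdd).add (PolyBdd.const x 6)).reindex
      Sigma.fst).mono fun p => ?_
    have hp : (p.2 : ℕ) ≤ n p.1 := by have := p.2.2; simp only [hlen] at this; omega
    have h1 := Datum.size_num_natCast_le p.2
    have h2 : (enc (f p.1 (j p.1))).size ≤ (enc (f p.1)).size :=
      Datum.size_mem_le (List.mem_ofFn.2 ⟨_, rfl⟩)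
    have h3 : (if (j p.1 : ℕ) < p.2 then enc (f p.1 (j p.1)) else .num 0).size ≤
        (enc (f p.1)).size + 1 := by
      split_ifs
      · omega
      · simp [Datum.size]
    change (Datum.num ((p.2 : ℕ) : ℤ)).size +
      (if (j p.1 : ℕ) < p.2 then enc (f p.1 (j p.1)) else .num 0 : Datum).size + 1 ≤ _
    omega
  · let X := fun p : Σ i, Fin (e i).length =>
        Datum.pair (x p.1) (.pair ((e p.1)[p.2]) (s p.1 p.2))
    have ht : PolyTime X fun p => ((p.2 : ℕ) : ℤ) := dfst (dsnd (dsnd (id _)))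
    have hj' : PolyTime X fun p => ((j p.1 : ℕ) : ℤ) := comp (dfst (id X)) (hj.reindex Sigma.fst)
    refine of_enc ((ht.add (int _ 1)).mk (ite (hj'.eq ht) (dfst (dsnd (id _)))
      (dsnd (dsnd (dsnd (id _)))))) fun p => ?_
    change Datum.pair (.num _) _ = Datum.pair (.num (p.2 + 1)) (if ((j p.1 : ℕ) : ℤ) = (p.2 : ℕ)
      then (e p.1)[(p.2 : ℕ)] else if (j p.1 : ℕ) < p.2 then enc (f p.1 (j p.1)) else .num 0)
    congr 1
    rcases lt_trichotomy (j p.1 : ℕ) p.2 with h | h | h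
    · rw [if_pos (by omega), if_neg (by omega), if_pos h]
    · have : j p.1 = ⟨p.2, by omega⟩ := Fin.ext h
      rw [if_pos (by omega), if_pos (by omega)]
      simp [e, ← h]
    · rw [if_neg (by omega), if_neg (by omega), if_neg (by omega)]

/-- Iteration over the indices, the state after `t` steps being `s i t`. -/
theorem fold_index {n : ι → ℕ} (hn : Index x n) {s : ∀ i, ℕ → α i}
    (h0 : PolyTime x fun i => s i 0)
    (hs : PolyBdd (fun p : Σ i, Fin (n i + 1) => x p.1) fun p => (enc (s p.1 p.2)).size)
    (hstep : PolyTime (fun q : Σ i, Fin (n i) => .pair (Ext x n q) (enc (s q.1 q.2)))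
      fun q => s q.1 (q.2 + 1)) :
    PolyTime x fun i => s i (n i) := by
  let e : ι → List Datum := fun i => List.ofFn fun j : Fin (n i) => enc j
  have hlen : ∀ i, (e i).length = n i := fun i => by simp [e]
  have he : PolyTime x fun i => Datum.ofList (e i) := hn
  have := fold (s := fun i t => enc (s i t)) he h0 ?_ ?_
  · exact of_enc this fun i => by rw [hlen]; rfl
  · exact hs.reindex fun p : Σ i, Fin ((e i).length + 1) =>
      (⟨p.1, p.2.cast (by rw [hlen])⟩ : Σ i, Fin (n i + 1))
  · let σ : (Σ i, Fin (e i).length) → Σ i, Fin (n i) := fun q => ⟨q.1, q.2.cast (hlen q.1)⟩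
    refine trans (of_enc ((pair (dfst (id _)) (dfst (dsnd (id _)))).pair (dsnd (dsnd (id _))))
      fun q => ?_) (of_enc (hstep.reindex σ) fun _ => rfl)
    change Datum.pair (.pair _ _) _ = Datum.pair (.pair (x q.1) ((e q.1)[q.2])) (enc (s q.1 q.2))
    simp only [e, Fin.getElem_fin, List.getElem_ofFn]
    rfl

/-! ### Quantifiers, search and sums over an index -/

/-- Existential quantification over an index. -/
theorem ex {n : ι → ℕ} (hn : Index x n) {p : ∀ i, Fin (n i) → Prop}
    (hp : PolyTime (Ext x n) fun q => p q.1 q.2) : PolyTime x fun i => ∃ j, p i j := by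
  refine congr_prop (fold_index hn (s := fun i t => ∃ j : Fin (n i), (j : ℕ) < t ∧ p i j)
    (of_enc (num x 0) fun i => by simp [enc_false]; rfl) ?_ ?_) fun i => by simp
  · refine (PolyBdd.const _ 2).mono fun p => ?_
    simp only [enc, Datum.ofProp]
    split_ifs <;> simp [Datum.size]
  · refine ((lift hp).or (state _ _)).congr_prop fun q => ?_
    constructor
    · rintro ⟨j, hj, h⟩
      rcases (Nat.lt_succ_iff_lt_or_eq.1 hj) with hj | hj
      · exact .inr ⟨j, hj, h⟩
      · exact .inl ((Fin.ext hj : j = q.2) ▸ h)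
    · rintro (h | ⟨j, hj, h⟩)
      · exact ⟨q.2, by omega, h⟩
      · exact ⟨j, by omega, h⟩

/-- Universal quantification over an index. -/
theorem all {n : ι → ℕ} (hn : Index x n) {p : ∀ i, Fin (n i) → Prop}
    (hp : PolyTime (Ext x n) fun q => p q.1 q.2) : PolyTime x fun i => ∀ j, p i j :=
  (ex hn (p := fun i j => ¬p i j) hp.not).not.congr_prop fun i => by simp

/-- Search for an index. -/
theorem find {n : ι → ℕ} (hn : Index x n) {p : ∀ i, Fin (n i) → Prop}
    (hp : PolyTime (Ext x n) fun q => p q.1 q.2) (hex : ∀ i, ∃ j, p i j) :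
    ∃ j : ∀ i, Fin (n i), (∀ i, p i (j i)) ∧ PolyTime x j := by
  classical
  -- The last index below `t` that has the property, or 0 if there is none. It is a natural number
  -- because the default need not be a legal index; only the final value must be one.
  let s : ι → ℕ → ℕ := fun i t =>
    Nat.rec 0 (fun t r => if ∃ h : t < n i, p i ⟨t, h⟩ then t else r) t
  have hs : ∀ i t, s i (t + 1) = if ∃ h : t < n i, p i ⟨t, h⟩ then t else s i t := fun _ _ => rfl
  have hst : ∀ i t, s i t ≤ t := fun i t => by
    induction t with
    | zero => exact le_rfl
    | succ t ih => rw [hs]; split_ifs <;> omega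
  have hp' : ∀ i t (j : Fin (n i)), p i j → (j : ℕ) < t → ∃ h : s i t < n i, p i ⟨s i t, h⟩ := by
    intro i t j hj
    induction t with
    | zero => intro h; omega
    | succ t ih =>
      intro h
      rw [hs]
      split_ifs with hif
      · exact hif
      · refine ih (lt_of_le_of_ne (Nat.lt_succ_iff.1 h) fun hjt => hif ?_)
        exact ⟨hjt ▸ j.2, by simpa [← hjt] using hj⟩
  have hfin : ∀ i, ∃ h : s i (n i) < n i, p i ⟨s i (n i), h⟩ := fun i =>
    (hex i).elim fun j hj => hp' i (n i) j hj j.2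
  refine ⟨fun i => ⟨s i (n i), (hfin i).1⟩, fun i => (hfin i).2,
    of_enc (y := fun i => (⟨s i (n i), (hfin i).1⟩ : Fin (n i)))
      (fold_index hn (s := s) (num x 0) ?_ ?_) fun i => rfl⟩
  · refine ((hn.bdd.add (PolyBdd.const x 2)).reindex Sigma.fst).mono fun q => ?_
    have h1 := Datum.size_num_natCast_le (s q.1 q.2)
    have h2 := hst q.1 q.2
    have h3 := q.2.2
    exact h1.trans (by omega)
  · refine of_enc (ite (α := fun _ => ℕ) (y := fun q => q.2) (z := fun q => s q.1 q.2)
      (lift hp) (lift (var x n)) (state _ _)) fun q => ?_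
    rw [hs]
    simp

/-- Finite sums. -/
theorem sum {n : ι → ℕ} (hn : Index x n) {f : ∀ i, Fin (n i) → ℤ}
    (hf : PolyTime (Ext x n) fun q => f q.1 q.2) : PolyTime x fun i => ∑ j, f i j := by
  refine of_enc (fold_index hn (s := fun i t => ∑ j : Fin (n i), if (j : ℕ) < t then f i j else 0)
    (of_enc (num x 0) fun i => by simp; rfl) ?_ ?_) fun i => by simp
  · obtain ⟨k, hk⟩ := PolyBdd.of_ext hn hf.size_bdd
    have hk' : PolyBdd x fun i => ((x i).size + 2) ^ k := ⟨k, fun _ => le_rfl⟩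
    refine (((hn.bdd.add hk').add (PolyBdd.const x 2)).reindex Sigma.fst).mono fun q => ?_
    -- A partial sum of at most `n` terms of absolute value at most `2 ^ B` is at most `n * 2 ^ B ≤
    -- 2 ^ (n + B)`.
    refine Datum.size_num_le ?_
    refine (Int.natAbs_sum_le _ _).trans ((Finset.sum_le_card_nsmul _ _ (2 ^ ((x q.1).size + 2) ^ k)
      fun j _ => ?_).trans ?_)
    · split_ifs
      · exact (Datum.natAbs_lt _).le.trans (Nat.pow_le_pow_right (by norm_num) (hk ⟨q.1, j⟩))
      · simp
    · rw [Finset.card_univ, Fintype.card_fin, smul_eq_mul, pow_add]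
      exact Nat.mul_le_mul_right _ Nat.lt_two_pow_self.le
  · refine of_enc (add (state _ _) (lift hf)) fun q => ?_
    congr 1
    rw [show f q.1 q.2 = ∑ j, if j = q.2 then f q.1 j else 0 by simp, ← Finset.sum_add_distrib]
    refine Finset.sum_congr rfl fun j _ => ?_
    rcases lt_trichotomy (j : ℕ) q.2 with h | h | h
    · rw [if_pos (by omega), if_pos h, if_neg (by omega), add_zero]
    · rw [if_pos (by omega), if_neg (by omega), if_pos (by omega), zero_add]
    · rw [if_neg (by omega), if_neg (by omega), if_neg (by omega), add_zero]

/-! ### Loops with invariants -/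

/-- The context of a step of a loop: the number of the step and a state that satisfies the
invariant. -/
structure LoopState (n : ι → ℕ) (Inv : ∀ i, ℕ → α i → Prop) where
  i : ι
  t : Fin (n i)
  s : α i
  inv : Inv i t s

/-- The data of the context of a step of a loop. -/
abbrev LoopState.data (x : ι → Datum) {n : ι → ℕ} {Inv : ∀ i, ℕ → α i → Prop}
    (q : LoopState n Inv) : Datum := .pair (Ext x n ⟨q.i, q.t⟩) (enc q.s)

/-- A loop with an invariant, which bounds the size of the state. -/
theorem loop {n : ι → ℕ} (hn : Index x n) (Inv : ∀ i, ℕ → α i → Prop) {s₀ : ∀ i, α i}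
    (h0 : PolyTime x s₀) (hI : ∀ i, Inv i 0 (s₀ i)) {B : ι → ℕ} (hB : PolyBdd x B)
    (hs : ∀ i t s, t ≤ n i → Inv i t s → (enc s).size ≤ B i)
    (hstep : ∃ s' : ∀ q : LoopState n Inv, α q.i,
      (∀ q, Inv q.i (q.t + 1) (s' q)) ∧ PolyTime (LoopState.data x) s') :
    ∃ s : ∀ i, α i, (∀ i, Inv i (n i) (s i)) ∧ PolyTime x s := by
  classical
  obtain ⟨s', hs', hP⟩ := hstep
  -- The step is defined only on states that satisfy the invariant. Elsewhere the state is left as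
  -- it is, a case that `hInv` shows never to occur.
  let S : ∀ i, ℕ → α i := fun i t =>
    Nat.rec (s₀ i) (fun t r => if h : ∃ ht : t < n i, Inv i t r then s' ⟨i, ⟨t, h.1⟩, r, h.2⟩ else r) t
  have hS : ∀ i t, S i (t + 1) =
    if h : ∃ ht : t < n i, Inv i t (S i t) then s' ⟨i, ⟨t, h.1⟩, S i t, h.2⟩ else S i t :=
    fun _ _ => rfl
  have hInv : ∀ i t, t ≤ n i → Inv i t (S i t) := by
    intro i t
    induction t with
    | zero => exact fun _ => hI i
    | succ t ih =>
      intro ht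
      rw [hS, dif_pos ⟨ht, ih (by omega)⟩]
      exact hs' ⟨i, ⟨t, ht⟩, S i t, ih (by omega)⟩
  refine ⟨fun i => S i (n i), fun i => hInv i _ le_rfl, fold_index hn h0 ?_ ?_⟩
  · exact (hB.reindex Sigma.fst).mono fun p =>
      hs p.1 p.2 _ (Nat.lt_succ_iff.1 p.2.2) (hInv p.1 p.2 (Nat.lt_succ_iff.1 p.2.2))
  · exact (hP.reindex fun q : Σ i, Fin (n i) =>
      (⟨q.1, q.2, S q.1 q.2, hInv q.1 q.2 q.2.2.le⟩ : LoopState n Inv)).of_enc fun q => by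
        rw [hS, dif_pos ⟨q.2.2, hInv q.1 q.2 q.2.2.le⟩]

theorem loop_data {n : ι → ℕ} {Inv : ∀ i, ℕ → α i → Prop} {y : ∀ i, β i} (hy : PolyTime x y) :
    PolyTime (LoopState.data x : LoopState n Inv → Datum) fun q => y q.i :=
  lift ((hy.wk n).reindex fun q : LoopState n Inv => (⟨q.i, q.t⟩ : Σ i, Fin (n i)))

theorem loop_index {n : ι → ℕ} {Inv : ∀ i, ℕ → α i → Prop} :
    PolyTime (LoopState.data x : LoopState n Inv → Datum) fun q => q.t :=
  lift ((var x n).reindex fun q : LoopState n Inv => (⟨q.i, q.t⟩ : Σ i, Fin (n i)))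

theorem loop_state {n : ι → ℕ} {Inv : ∀ i, ℕ → α i → Prop} :
    PolyTime (LoopState.data x : LoopState n Inv → Datum) fun q => q.s :=
  state _ _

/-! ### Lists and options -/

theorem append_data {e e' : ι → List Datum} (he : PolyTime x fun i => Datum.ofList (e i))
    (he' : PolyTime x fun i => Datum.ofList (e' i)) :
    PolyTime x fun i => Datum.ofList (e i ++ e' i) := by
  refine foldr (s := fun i t => .ofList ((e i).drop t ++ e' i)) he
    (he'.of_enc fun i => by simp) ?_ ?_
  · refine ((he.size_bdd.add he'.size_bdd).reindex Sigma.fst).mono fun p => ?_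
    change _ ≤ (Datum.ofList (e p.1)).size + (Datum.ofList (e' p.1)).size
    rw [Datum.size_ofList, Datum.size_ofList, Datum.size_ofList, List.map_append, List.sum_append]
    have := (((e p.1).drop_sublist p.2).map fun x => x.size + 1).sum_le_sum (by simp)
    omega
  · refine of_enc ((dfst (dsnd (id _))).pair (dsnd (dsnd (id _)))) fun p => ?_
    change Datum.ofList ((e p.1).drop p.2 ++ e' p.1) = Datum.ofList (_ :: _)
    rw [List.drop_eq_getElem_cons p.2.2]
    rfl

theorem fin_append {n m : ι → ℕ} {f : ∀ i, Fin (n i) → α i} {g : ∀ i, Fin (m i) → α i}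
    (hf : PolyTime x f) (hg : PolyTime x g) : PolyTime x fun i => Fin.append (f i) (g i) :=
  of_enc (append_data (e := fun i => List.ofFn fun j => enc (f i j))
    (e' := fun i => List.ofFn fun j => enc (g i j)) hf hg) fun i => by
      change Datum.ofList (List.ofFn fun j => enc (Fin.append (f i) (g i) j)) = Datum.ofList _
      rw [← List.ofFn_fin_append]
      congr 2
      funext j
      refine Fin.addCases (fun j => ?_) (fun j => ?_) j <;> simp

theorem nil : PolyTime x fun i => ([] : List (α i)) := num x 0

theorem cons {a : ∀ i, α i} {l : ∀ i, List (α i)} (ha : PolyTime x a) (hl : PolyTime x l) :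
    PolyTime x fun i => a i :: l i := ha.pair hl

theorem list_reverse {l : ∀ i, List (α i)} (hl : PolyTime x l) :
    PolyTime x fun i => (l i).reverse :=
  of_enc (reverse (e := fun i => (l i).map enc) hl) fun i => by
    change Datum.ofList _ = _
    rw [List.map_reverse]
    rfl

theorem none (n : ι → ℕ) : PolyTime x fun i => (Option.none : Option (Fin (n i))) :=
  of_enc (num x (-1)) fun _ => rfl

theorem some {n : ι → ℕ} {j : ∀ i, Fin (n i)} (hj : PolyTime x j) :
    PolyTime x fun i => Option.some (j i) := hj

theorem natCast {f : ι → ℕ} (hf : PolyTime x f) : PolyTime x fun i => (f i : ℤ) := hf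

end PolyTime

/-! ### The assignment problem -/

section Assignment

variable {n m : ℕ}

/-- A partial matching of the first `r` rows to columns, which is optimal as certified by the
potentials `u` and `v`. -/
structure PartialAssignment (c : Fin n → Fin m → ℤ) (r : ℕ) (u : Fin n → ℤ) (v : Fin m → ℤ)
    (a : Fin n → Option (Fin m)) : Prop where
  feasible : ∀ i j, u i + v j ≤ c i j
  nonpos : ∀ j, v j ≤ 0
  support : ∀ j, v j < 0 → ∃ i, a i = some j
  eq_none : ∀ i, a i = none ↔ r ≤ (i : ℕ)
  inj : ∀ i i' j, a i = some j → a i' = some j → i = i'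
  tight : ∀ i j, a i = some j → u i + v j = c i j

/-- A tree of tight alternating paths from the unmatched row `r` of a partial assignment `a`: it
reaches the rows in `S` and the columns in `T`, and `H k` is obtained from `a` by shifting along the
path to the row `k`, which is left unmatched. -/
structure AlternatingTree (c : Fin n → Fin m → ℤ) (a : Fin n → Option (Fin m)) (r : Fin n)
    (u : Fin n → ℤ) (v : Fin m → ℤ) (S : Fin n → Prop) (T : Fin m → Prop)
    (H : Fin n → Fin n → Option (Fin m)) : Prop where
  feasible : ∀ i j, u i + v j ≤ c i j
  nonpos : ∀ j, v j ≤ 0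
  support : ∀ j, v j < 0 → ∃ i, a i = some j
  fresh : a r = none
  root : S r
  le : ∀ k, S k → k ≤ r
  eq_none : ∀ k, S k → ∀ i, H k i = none ↔ i = k ∨ r < i
  inj : ∀ k, S k → ∀ i i' j, H k i = some j → H k i' = some j → i = i'
  image : ∀ k, S k → ∀ j, (∃ i, H k i = some j) ↔ ∃ i, a i = some j
  tight : ∀ k, S k → ∀ i j, H k i = some j → u i + v j = c i j
  closed : ∀ k, S k → ∀ i j, H k i = some j → (S i ↔ T j)
  agree : ∀ k, S k → ∀ i, ¬S i → H k i = a i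
  covered : ∀ j, T j → ∃ i, a i = some j

/-- Every search starts from this tree: only the root is reached, along the empty path, so nothing
is shifted. -/
theorem PartialAssignment.tree {c : Fin n → Fin m → ℤ} {r : Fin n} {u : Fin n → ℤ} {v : Fin m → ℤ}
    {a : Fin n → Option (Fin m)} (h : PartialAssignment c r u v a) :
    AlternatingTree c a r u v (fun k => k = r) (fun _ => False) (fun _ => a) where
  feasible := h.feasible
  nonpos := h.nonpos
  support := h.support
  fresh := (h.eq_none r).2 le_rfl
  root := rfl
  le k hk := hk.le
  eq_none k hk i := by rw [h.eq_none, hk]; omega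
  inj k hk := h.inj
  image k hk j := Iff.rfl
  tight k hk := h.tight
  closed k hk i j hij := by
    have := (h.eq_none i).not.1 (by simp [hij])
    simp only [iff_false]
    rintro rfl
    exact this le_rfl
  agree k hk i hi := rfl
  covered j hj := hj.elim

namespace AlternatingTree

variable {c : Fin n → Fin m → ℤ} {a : Fin n → Option (Fin m)} {r : Fin n}
  {u : Fin n → ℤ} {v : Fin m → ℤ} {S : Fin n → Prop} {T : Fin m → Prop}
  {H : Fin n → Fin n → Option (Fin m)}

/-- Reached columns are matched to distinct rows. If all columns were reached, `n ≤ m` would force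
every row to be matched, including the root, which is not. -/
theorem exists_not_mem (h : AlternatingTree c a r u v S T H) (hnm : n ≤ m) : ∃ j, ¬T j := by
  by_contra! hT
  choose f hf using fun j => h.covered j (hT j)
  have hinj : Function.Injective f := fun j j' hjj => by
    have h1 := hf j
    rw [hjj, hf j'] at h1
    exact (Option.some.inj h1).symm
  have hcard := Fintype.card_le_of_injective f hinj
  simp only [Fintype.card_fin] at hcard
  obtain rfl : n = m := le_antisymm hnm hcard
  obtain ⟨j, hj⟩ := Finite.surjective_of_injective hinj r
  have h1 := hf j
  rw [hj] at h1
  simp [h.fresh] at h1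

open Classical in
/-- The dual change, which makes a slack `δ` of minimal size vanish. -/
theorem shift (h : AlternatingTree c a r u v S T H) {δ : ℤ} (hδ : 0 ≤ δ)
    (hmin : ∀ i j, S i → ¬T j → δ ≤ c i j - u i - v j) :
    AlternatingTree c a r (fun i => if S i then u i + δ else u i)
      (fun j => if T j then v j - δ else v j) S T H where
  -- The sum of the two potentials grows only for a reached row and an unreached column, where the
  -- slack is at least `δ`.
  feasible i j := by
    have h1 := h.feasible i j
    have h2 := hmin i j
    by_cases hS : S i <;> by_cases hT : T j <;> simp only [hS, hT, if_true, if_false] <;>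
      simp [hS, hT] at h2 <;> linarith
  nonpos j := by
    have h1 := h.nonpos j
    split_ifs <;> linarith
  support j hj := by
    by_cases hT : T j
    · exact h.covered j hT
    · exact h.support j (by simpa [hT] using hj)
  fresh := h.fresh
  root := h.root
  le := h.le
  eq_none := h.eq_none
  inj := h.inj
  image := h.image
  -- By `closed`, the row and the column of a matched pair are both reached or both unreached, so
  -- their changes cancel.
  tight k hk i j hij := by
    have h1 := h.tight k hk i j hij
    have h2 := h.closed k hk i j hij
    by_cases hT : T j
    · simp only [hT, h2.2 hT, if_true]; linarith
    · have : ¬S i := fun hS => hT (h2.1 hS)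
      simp only [hT, this, if_false]; linarith
  closed := h.closed
  agree := h.agree
  covered := h.covered

open Classical in
/-- A tight edge to an unmatched column yields a larger assignment. -/
theorem augment (h : AlternatingTree c a r u v S T H) {i : Fin n} {j : Fin m} (hi : S i)
    (hij : u i + v j = c i j) (hj : ∀ i', H i i' ≠ some j) :
    PartialAssignment c (r + 1) u v (fun k => if k = i then some j else H i k) where
  feasible := h.feasible
  nonpos := h.nonpos
  -- Shifting along a tree path does not alter the set of matched columns, so no column with a
  -- negative potential becomes free.
  support j' hj' := by
    obtain ⟨i', hi'⟩ := (h.image i hi j').2 (h.support j' hj')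
    have := h.eq_none i hi i'
    refine ⟨i', ?_⟩
    grind
  eq_none k := by
    have := h.eq_none i hi k
    have := h.le i hi
    grind
  inj k k' j' := by
    have := h.inj i hi k k' j'
    grind
  tight k j' := by
    have := h.tight i hi k j'
    grind

open Classical in
/-- A tight edge to a matched column lets the tree grow. -/
theorem grow (h : AlternatingTree c a r u v S T H) {i i' : Fin n} {j : Fin m} (hi : S i)
    (hT : ¬T j) (hij : u i + v j = c i j) (hi' : H i i' = some j) :
    ¬S i' ∧ AlternatingTree c a r u v (fun k => S k ∨ k = i') (fun l => T l ∨ l = j)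
      -- The path to `i'` extends the path to `i`: row `i` takes the column `j`, which leaves `i'`
      -- free.
      (fun k l => if k = i' then if l = i' then none else if l = i then some j else H i l
        else H k l) := by
  have hS : ¬S i' := fun hS => hT ((h.closed i hi i' j hi').1 hS)
  -- Shifting has not touched unreached rows, so `i'` already held `j` in the original assignment.
  have ha : a i' = some j := (h.agree i hi i' hS).symm.trans hi'
  have hne : i' ≠ i := fun e => hS (e ▸ hi)
  have hir : i' ≤ r := by
    have := h.eq_none i hi i'
    grind
  refine ⟨hS, h.feasible, h.nonpos, h.support, h.fresh, .inl h.root, ?_, ?_, ?_, ?_, ?_, ?_, ?_, ?_⟩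
  · rintro k (hk | rfl)
    · exact h.le k hk
    · exact hir
  · rintro k hk l
    have := h.eq_none i hi l
    have := h.eq_none k
    have := h.le i hi
    grind
  · intro k hk l l' j'
    have := h.inj i hi l l' j'
    have := h.inj i hi l i' j
    have := h.inj i hi l' i' j
    have := h.inj k
    grind
  · intro k hk j'
    by_cases hk' : k = i'
    · simp only [hk', if_true]
      rw [← h.image i hi j']
      constructor
      · rintro ⟨l, hl⟩
        grind
      · rintro ⟨l, hl⟩
        have := h.eq_none i hi i
        by_cases hj' : j' = j
        · exact ⟨i, by grind⟩
        · exact ⟨l, by grind⟩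
    · simp only [hk', if_false]
      exact h.image k (hk.resolve_right hk') j'
  · intro k hk l j'
    have := h.tight i hi l j'
    have := h.tight k
    grind
  · intro k hk l j'
    have := h.closed i hi l j'
    have := h.closed k
    have := h.inj i hi l i' j
    have := h.inj k
    have := h.agree k
    grind
  · intro k hk l hl
    have := h.agree i hi l
    have := h.agree k
    grind
  · rintro l (hl | rfl)
    · exact h.covered l hl
    · exact ⟨i', ha⟩

end AlternatingTree

/-- A complete assignment with potentials is optimal. -/
theorem PartialAssignment.sum_le {c : Fin n → Fin m → ℤ} {u : Fin n → ℤ} {v : Fin m → ℤ}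
    {π : Fin n → Fin m} (h : PartialAssignment c n u v fun i => some (π i)) (π' : Fin n → Fin m)
    (hπ' : Function.Injective π') : ∑ i, c i (π i) ≤ ∑ i, c i (π' i) := by
  have hπ : Function.Injective π := fun i i' hii => h.inj i i' (π i') (by rw [hii]) rfl
  -- Unmatched columns have potential 0 by `support` and `nonpos`, so the cost equals the full dual
  -- value, a lower bound for every injective assignment.
  have h1 : ∑ i, c i (π i) = ∑ i, u i + ∑ j, v j := by
    rw [Finset.sum_congr rfl fun i _ => (h.tight i (π i) rfl).symm, Finset.sum_add_distrib,
      ← Finset.sum_image (f := v) (g := π) (fun i _ i' _ hii => hπ hii)]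
    congr 1
    refine Finset.sum_subset (Finset.subset_univ _) fun j _ hj => ?_
    refine le_antisymm (h.nonpos j) (not_lt.1 fun hlt => hj ?_)
    obtain ⟨i, hi⟩ := h.support j hlt
    exact Finset.mem_image.2 ⟨i, Finset.mem_univ _, Option.some.inj hi⟩
  have h2 : ∑ j, v j ≤ ∑ i, v (π' i) := by
    rw [← Finset.sum_image (f := v) (g := π') (fun i _ i' _ hii => hπ' hii)]
    exact Finset.sum_le_sum_of_subset_of_nonpos' (Finset.subset_univ _) fun j _ _ => h.nonpos j
  rw [h1]
  calc _ ≤ ∑ i, (u i + v (π' i)) := by rw [Finset.sum_add_distrib]; linarith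
    _ ≤ _ := Finset.sum_le_sum fun i _ => h.feasible i (π' i)

end Assignment

/-! ### The Hungarian method in polynomial time -/

/-- A state of the search for an augmenting path: an enlarged assignment `a` if it is `done`, and
an alternating tree otherwise. -/
structure SearchState (n m : ℕ) where
  done : Prop
  u : Fin n → ℤ
  v : Fin m → ℤ
  a : Fin n → Option (Fin m)
  S : Fin n → Prop
  T : Fin m → Prop
  H : Fin n → Fin n → Option (Fin m)

noncomputable instance {n m : ℕ} : Enc (SearchState n m) :=
  ⟨fun s => enc (s.done, s.u, s.v, s.a, s.S, s.T, s.H)⟩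

/-- The potentials are bounded by `B`. -/
def Bounded {n m : ℕ} (u : Fin n → ℤ) (v : Fin m → ℤ) (B : ℕ) : Prop :=
  (∀ i, (u i).natAbs ≤ B) ∧ ∀ j, (v j).natAbs ≤ B

theorem AlternatingTree.exists_min {n m : ℕ} {c : Fin n → Fin m → ℤ} {a : Fin n → Option (Fin m)}
    {r : Fin n} {u : Fin n → ℤ} {v : Fin m → ℤ} {S : Fin n → Prop} {T : Fin m → Prop}
    {H : Fin n → Fin n → Option (Fin m)} (h : AlternatingTree c a r u v S T H) (hnm : n ≤ m) :
    ∃ i, S i ∧ ∃ j, ¬T j ∧ ∀ i' j', S i' → ¬T j' →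
      c i j - u i - v j ≤ c i' j' - u i' - v j' := by
  classical
  obtain ⟨j₀, hj₀⟩ := h.exists_not_mem hnm
  obtain ⟨p, hp, hmin⟩ := Finset.exists_min_image
    (Finset.univ.filter fun p : Fin n × Fin m => S p.1 ∧ ¬T p.2)
    (fun p => c p.1 p.2 - u p.1 - v p.2) ⟨(r, j₀), by simpa using ⟨h.root, hj₀⟩⟩
  simp only [Finset.mem_filter, Finset.mem_univ, true_and] at hp hmin
  exact ⟨p.1, hp.1, p.2, hp.2, fun i' j' hi' hj' => hmin (i', j') ⟨hi', hj'⟩⟩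

namespace PolyTime

variable {ι : Type} {x : ι → Datum} {n m : ι → ℕ}

theorem slack {c : ∀ i, Fin (n i) → Fin (m i) → ℤ} {u : ∀ i, Fin (n i) → ℤ}
    {v : ∀ i, Fin (m i) → ℤ} {k : ∀ i, Fin (n i)} {l : ∀ i, Fin (m i)} (hc : PolyTime x c)
    (hu : PolyTime x u) (hv : PolyTime x v) (hk : PolyTime x k) (hl : PolyTime x l) :
    PolyTime x fun i => c i (k i) (l i) - u i (k i) - v i (l i) :=
  (((hc.app hk).app hl).sub (hu.app hk)).sub (hv.app hl)

theorem minimal_slack {c : ∀ i, Fin (n i) → Fin (m i) → ℤ} {u : ∀ i, Fin (n i) → ℤ}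
    {v : ∀ i, Fin (m i) → ℤ} {S : ∀ i, Fin (n i) → Prop} {T : ∀ i, Fin (m i) → Prop}
    {k : ∀ i, Fin (n i)} {l : ∀ i, Fin (m i)} (hn : Index x n) (hm : Index x m)
    (hc : PolyTime x c) (hu : PolyTime x u) (hv : PolyTime x v) (hS : PolyTime x S)
    (hT : PolyTime x T) (hk : PolyTime x k) (hl : PolyTime x l) :
    PolyTime x fun i => ¬T i (l i) ∧ ∀ k' l', S i k' → ¬T i l' →
      c i (k i) (l i) - u i (k i) - v i (l i) ≤ c i k' l' - u i k' - v i l' := by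
  refine (hT.app hl).not.and (all hn (all (hm.wk n) (imp ?_ (imp ?_ (le_int ?_ ?_)))))
  · exact ((hS.wk _).wk _).app ((var _ _).wk _)
  · exact (((hT.wk _).wk _).app (var _ _)).not
  · exact ((slack hc hu hv hk hl).wk _).wk _
  · exact slack ((hc.wk _).wk _) ((hu.wk _).wk _) ((hv.wk _).wk _) ((var _ _).wk _) (var _ _)

open Classical in
/-- One step of the search. -/
theorem search_step {c : ∀ i, Fin (n i) → Fin (m i) → ℤ} {a : ∀ i, Fin (n i) → Option (Fin (m i))}
    {r : ∀ i, Fin (n i)}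
    {s : ∀ i, SearchState (n i) (m i)} (hn : Index x n) (hm : Index x m) (hc : PolyTime x c)
    (hs : PolyTime x s) (hnm : ∀ i, n i ≤ m i) {B : ι → ℕ}
    (htree : ∀ i, AlternatingTree (c i) (a i) (r i) (s i).u (s i).v (s i).S (s i).T (s i).H)
    (hB : ∀ i, Bounded (s i).u (s i).v (B i)) (hcB : ∀ i j k, (c i j k).natAbs ≤ B i) :
    ∃ s' : ∀ i, SearchState (n i) (m i),
      (∀ i, Bounded (s' i).u (s' i).v (4 * B i) ∧
        ((s' i).done ∧ PartialAssignment (c i) (r i + 1) (s' i).u (s' i).v (s' i).a ∨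
        ¬(s' i).done ∧ (∃ k, ¬(s i).S k ∧ (s' i).S = fun l => (s i).S l ∨ l = k) ∧
          AlternatingTree (c i) (a i) (r i) (s' i).u (s' i).v (s' i).S (s' i).T (s' i).H)) ∧
      PolyTime x s' := by
  have hs0 : PolyTime x fun i => ((s i).done, (s i).u, (s i).v, (s i).a, (s i).S, (s i).T, (s i).H) :=
    hs
  have hu : PolyTime x fun i => (s i).u := hs0.snd.fst
  have hv : PolyTime x fun i => (s i).v := hs0.snd.snd.fst
  have hS : PolyTime x fun i => (s i).S := hs0.snd.snd.snd.snd.fst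
  have hT : PolyTime x fun i => (s i).T := hs0.snd.snd.snd.snd.snd.fst
  have hH : PolyTime x fun i => (s i).H := hs0.snd.snd.snd.snd.snd.snd
  -- A pair `(k, l)` of minimal slack, found by comparing every pair with all the others.
  obtain ⟨k, hk, hkP⟩ := find hn ((hS.wk n).app (var x n) |>.and
    (ex (hm.wk n) (minimal_slack ((hn.wk _).wk _) ((hm.wk _).wk _) ((hc.wk _).wk _) ((hu.wk _).wk _)
      ((hv.wk _).wk _) ((hS.wk _).wk _) ((hT.wk _).wk _) ((var x n).wk _) (var _ _))))
    fun i => (htree i).exists_min (hnm i)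
  obtain ⟨l, hl, hlP⟩ := find hm (minimal_slack (hn.wk _) (hm.wk _) (hc.wk _) (hu.wk _)
      (hv.wk _) (hS.wk _) (hT.wk _) (hkP.wk _) (var x m)) fun i => (hk i).2
  replace hk := fun i => (hk i).1
  have hδ := slack hc hu hv hkP hlP
  let δ : ι → ℤ := fun i => c i (k i) (l i) - (s i).u (k i) - (s i).v (l i)
  let u' : ∀ i, Fin (n i) → ℤ := fun i j => if (s i).S j then (s i).u j + δ i else (s i).u j
  let v' : ∀ i, Fin (m i) → ℤ := fun i j => if (s i).T j then (s i).v j - δ i else (s i).v j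
  have hu' : PolyTime x u' := lam hn (ite ((hS.wk n).app (var x n))
    (((hu.wk n).app (var x n)).add (hδ.wk n)) ((hu.wk n).app (var x n)))
  have hv' : PolyTime x v' := lam hm (ite ((hT.wk m).app (var x m))
    (((hv.wk m).app (var x m)).sub (hδ.wk m)) ((hv.wk m).app (var x m)))
  have hδ0 : ∀ i, 0 ≤ δ i := fun i => by
    have := (htree i).feasible (k i) (l i)
    simp only [δ]
    linarith
  have htree' : ∀ i, AlternatingTree (c i) (a i) (r i) (u' i) (v' i) (s i).S (s i).T (s i).H :=
    fun i => (htree i).shift (hδ0 i) fun k' l' hk' hl' => (hl i).2 k' l' hk' hl'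
  have htight : ∀ i, u' i (k i) + v' i (l i) = c i (k i) (l i) := fun i => by
    simp only [u', v', δ, hk i, (hl i).1, if_true, if_false]
    ring
  -- The change `δ` consists of three terms bounded by `B`, and it is applied to a potential that is
  -- also bounded by `B`.
  have hB' : ∀ i, Bounded (u' i) (v' i) (4 * B i) := fun i => by
    have h1 := hcB i (k i) (l i)
    have h2 := (hB i).1 (k i)
    have h3 := (hB i).2 (l i)
    constructor
    · intro j
      have h4 := (hB i).1 j
      simp only [u', δ]
      split_ifs <;> omega
    · intro j
      have h4 := (hB i).2 j
      simp only [v', δ]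
      split_ifs <;> omega
  -- After the dual change the edge `(k, l)` is tight: if `l` is matched the tree grows, otherwise
  -- `l` ends an augmenting path.
  let P : ι → Prop := fun i => ∃ k', (s i).H (k i) k' = Option.some (l i)
  have key := exists_cases (x := x) (α := fun i => SearchState (n i) (m i))
    (p := P) (R := fun i s' => s'.u = u' i ∧ s'.v = v' i ∧
        (s'.done ∧ PartialAssignment (c i) (r i + 1) (u' i) (v' i) s'.a ∨
        ¬s'.done ∧ (∃ k, ¬(s i).S k ∧ s'.S = fun l => (s i).S l ∨ l = k) ∧
          AlternatingTree (c i) (a i) (r i) (u' i) (v' i) s'.S s'.T s'.H))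
    (ex hn ((((hH.app hkP).wk n).app (var x n)).eq (hlP.some.wk n))) ?_ ?_
  · obtain ⟨s', hs', hs'P⟩ := key
    refine ⟨s', fun i => ?_, hs'P⟩
    obtain ⟨h1, h2, h3⟩ := hs' i
    rw [h1, h2]
    exact ⟨hB' i, h3⟩
  · obtain ⟨k', hk', hkP'⟩ := find (hn.sub_index P) (p := fun i k' => (s i.1).H (k i.1) k' =
      Option.some (l i.1)) ((((hH.app hkP).sub_index _).wk _).app (var _ _) |>.eq
        ((hlP.some.sub_index _).wk _)) fun i => i.2
    have hn0 := hn.sub_index P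
    have hm0 := hm.sub_index P
    have hg := fun i => (htree' i.1).grow (hk i.1) (hl i.1).1 (htight i.1) (hk' i)
    refine ⟨fun i => ⟨False, u' i.1, v' i.1, (s i.1).a, _, _, _⟩, fun i => ⟨rfl, rfl, .inr
      ⟨not_false, ⟨k' i, (hg i).1, rfl⟩, (hg i).2⟩⟩, ?_⟩
    refine (of_enc (num _ 0) fun _ => enc_false).mk ((hu'.sub_index _).mk ((hv'.sub_index _).mk
      ((hs0.snd.snd.snd.fst.sub_index _).mk (mk (lam hn0 ?_) (mk (lam hm0 ?_)
        (lam hn0 (lam (hn0.wk _) ?_)))))))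
    · exact (((hS.sub_index _).wk _).app (var _ _)).or ((var _ _).eq (hkP'.wk _))
    · exact (((hT.sub_index _).wk _).app (var _ _)).or ((var _ _).eq ((hlP.sub_index _).wk _))
    · refine ite (((var _ _).wk _).eq ((hkP'.wk _).wk _)) (ite ((var _ _).eq ((hkP'.wk _).wk _))
        (none _) (ite ((var _ _).eq (((hkP.sub_index _).wk _).wk _))
          ((((hlP.sub_index _).wk _).wk _).some)
          (((((hH.app hkP).sub_index _).wk _).wk _).app (var _ _)))) ?_
      exact ((((hH.sub_index _).wk _).wk _).app ((var _ _).wk _)).app (var _ _)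
  · have hn0 := hn.sub_index fun i => ¬P i
    refine ⟨fun i => ⟨True, u' i.1, v' i.1, _, (s i.1).S, (s i.1).T, (s i.1).H⟩,
      fun i => ⟨rfl, rfl, .inl ⟨trivial, (htree' i.1).augment (hk i.1) (htight i.1)
        fun k' h => i.2 ⟨k', h⟩⟩⟩, ?_⟩
    refine (of_enc (num _ 1) fun _ => enc_true).mk ((hu'.sub_index _).mk ((hv'.sub_index _).mk
      (mk (lam hn0 ?_) (hs0.snd.snd.snd.snd.sub_index _))))
    exact ite ((var _ _).eq ((hkP.sub_index _).wk _)) ((hlP.some.sub_index _).wk _)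
      ((((hH.app hkP).sub_index _).wk _).app (var _ _))

theorem _root_.MRMD.enc_apply_size_le {n : ℕ} {α : Type} [Enc α] (f : Fin n → α) (j : Fin n) :
    (enc (f j)).size ≤ (enc f).size :=
  Datum.size_mem_le (List.mem_ofFn.2 ⟨j, rfl⟩)

theorem _root_.MRMD.enc_prop_size_le (p : Prop) : (enc p).size ≤ 2 := by
  simp only [enc, Datum.ofProp]
  split_ifs <;> simp [Datum.size]

theorem _root_.MRMD.enc_option_size_le {n : ℕ} (o : Option (Fin n)) : (enc o).size ≤ n + 2 := by
  refine Datum.size_num_le ?_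
  have : n < 2 ^ n := Nat.lt_two_pow_self
  rcases o with _ | j
  · simp [IntCode.toInt]; omega
  · simp [IntCode.toInt]; omega

/-- Bounds for the sizes of the states of the search. -/
theorem _root_.MRMD.SearchState.size_le {n m : ℕ} (s : SearchState n m) {b : ℕ}
    (h : Bounded s.u s.v (2 ^ b)) :
    (enc s).size ≤ 9 * n + 6 * m + n * b + m * b + n * m + n * (n * (m + 3) + 2) + 30 := by
  have h1 := enc_prop_size_le s.done
  have h2 := Datum.size_ofTable_le (fun j => enc (s.u j)) (b + 2) fun j => Datum.size_num_le (h.1 j)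
  have h3 := Datum.size_ofTable_le (fun j => enc (s.v j)) (b + 2) fun j => Datum.size_num_le (h.2 j)
  have h4 := Datum.size_ofTable_le (fun j => enc (s.a j)) (m + 2) fun j => enc_option_size_le (s.a j)
  have h5 := Datum.size_ofTable_le (fun j => enc (s.S j)) 2 fun j => enc_prop_size_le _
  have h6 := Datum.size_ofTable_le (fun j => enc (s.T j)) 2 fun j => enc_prop_size_le _
  have h7 := Datum.size_ofTable_le (fun j => enc (s.H j)) _ fun j =>
    Datum.size_ofTable_le (fun i => enc (s.H j i)) (m + 2) fun i => enc_option_size_le (s.H j i)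
  change (enc s.done).size + ((Datum.ofTable fun j => enc (s.u j)).size +
    ((Datum.ofTable fun j => enc (s.v j)).size + ((Datum.ofTable fun j => enc (s.a j)).size +
    ((Datum.ofTable fun j => enc (s.S j)).size + ((Datum.ofTable fun j => enc (s.T j)).size +
    (Datum.ofTable fun j => enc (s.H j)).size + 1) + 1) + 1) + 1) + 1) + 1 ≤ _
  have e1 : n * (b + 2 + 1) = n * b + 3 * n := by ring
  have e2 : m * (b + 2 + 1) = m * b + 3 * m := by ring
  have e3 : n * (m + 2 + 1) = n * m + 3 * n := by ring
  have e4 : n * (n * (m + 2 + 1) + 1 + 1) = n * (n * (m + 3) + 2) := by ring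
  rw [e1] at h2
  rw [e2] at h3
  rw [e3] at h4
  rw [e4] at h7
  omega

theorem loop_bdd {N : ι → ℕ} {α : ι → Type} [∀ i, Enc (α i)] {Inv : ∀ i, ℕ → α i → Prop}
    {f : ι → ℕ} (hf : PolyBdd x f) :
    PolyBdd (LoopState.data x : LoopState N Inv → Datum) fun q => f q.i :=
  (hf.reindex fun q : LoopState N Inv => q.i).comp (loop_data (id x)).size_bdd

/-- The search for an augmenting path. -/
theorem search {c : ∀ i, Fin (n i) → Fin (m i) → ℤ} {a : ∀ i, Fin (n i) → Option (Fin (m i))}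
    {r : ∀ i, Fin (n i)} {u : ∀ i, Fin (n i) → ℤ} {v : ∀ i, Fin (m i) → ℤ}
    (hm : Index x m) (hc : PolyTime x c)
    (hr : PolyTime x r) (hu : PolyTime x u) (hv : PolyTime x v) (ha : PolyTime x a)
    (hnm : ∀ i, n i ≤ m i) {b : ι → ℕ} (hb : PolyBdd x b)
    (hpart : ∀ i, PartialAssignment (c i) (r i) (u i) (v i) (a i))
    (hB : ∀ i, Bounded (u i) (v i) (2 ^ b i)) (hcB : ∀ i j k, (c i j k).natAbs ≤ 2 ^ b i) :
    ∃ y : ∀ i, (Fin (n i) → ℤ) × (Fin (m i) → ℤ) × (Fin (n i) → Option (Fin (m i))),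
      (∀ i, Bounded (y i).1 (y i).2.1 (2 ^ (b i + 2 * n i)) ∧
        PartialAssignment (c i) (r i + 1) (y i).1 (y i).2.1 (y i).2.2) ∧ PolyTime x y := by
  have hn : Index x n := hc.index
  -- Each step costs the potentials two more bits and, unless it finishes, adds a row to `S`. After
  -- `n` steps an unfinished search would have reached more than `n` rows.
  let Inv : ∀ i, ℕ → SearchState (n i) (m i) → Prop := fun i t s =>
    Bounded s.u s.v (2 ^ (b i + 2 * t)) ∧
      (s.done ∧ PartialAssignment (c i) (r i + 1) s.u s.v s.a ∨
        ¬s.done ∧ t < {k | s.S k}.ncard ∧ AlternatingTree (c i) (a i) (r i) s.u s.v s.S s.T s.H)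
  have key := loop hn Inv (s₀ := fun i => ⟨False, u i, v i, a i, fun k => k = r i, fun _ => False,
    fun _ => a i⟩) ?_ ?_ (B := fun i => 9 * n i + 6 * m i + n i * (b i + 2 * n i) +
      m i * (b i + 2 * n i) + n i * m i + n i * (n i * (m i + 3) + 2) + 30) ?_ ?_ ?_
  · obtain ⟨s, hs, hsP⟩ := key
    have hs0 : PolyTime x fun i =>
      ((s i).done, (s i).u, (s i).v, (s i).a, (s i).S, (s i).T, (s i).H) := hsP
    refine ⟨fun i => ((s i).u, (s i).v, (s i).a), fun i => ⟨(hs i).1, ?_⟩,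
      hs0.snd.fst.mk (hs0.snd.snd.fst.mk hs0.snd.snd.snd.fst)⟩
    rcases (hs i).2 with h | h
    · exact h.2
    · have := h.2.1
      have h2 := Set.ncard_le_ncard (Set.subset_univ {k | (s i).S k})
      rw [Set.ncard_univ, Nat.card_fin] at h2
      omega
  · exact (of_enc (num _ 0) fun _ => enc_false).mk (hu.mk (hv.mk (ha.mk (mk
      (lam hn ((var _ _).eq (hr.wk _))) (mk (lam hm (of_enc (num _ 0) fun _ => enc_false))
        (lam hn (ha.wk _)))))))
  · exact fun i => ⟨hB i, .inr ⟨not_false, by simp, (hpart i).tree⟩⟩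
  · have hnb := hn.bdd
    have hmb := hm.bdd
    have hbn := hb.add ((PolyBdd.const x 2).mul hnb)
    have := fun k => PolyBdd.const x k
    exact (((((((this 9).mul hnb).add ((this 6).mul hmb)).add (hnb.mul hbn)).add (hmb.mul hbn)).add
      (hnb.mul hmb)).add (hnb.mul ((hnb.mul (hmb.add (this 3))).add (this 2)))).add (this 30)
  · rintro i t s ht ⟨hs, -⟩
    refine s.size_le ⟨fun j => (hs.1 j).trans ?_, fun j => (hs.2 j).trans ?_⟩ <;>
    exact Nat.pow_le_pow_right (by norm_num) (by omega)
  · have hstate : PolyTime (LoopState.data x : LoopState n Inv → Datum) fun q =>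
      (q.s.done, q.s.u, q.s.v, q.s.a, q.s.S, q.s.T, q.s.H) := loop_state
    -- The loop always makes `n` rounds, so a finished state is carried along unchanged.
    refine exists_cases (p := fun q : LoopState n Inv => q.s.done) hstate.fst ⟨fun q => q.1.s, fun q => ?_,
      loop_state.sub_index fun q : LoopState n Inv => q.s.done⟩ ?_
    · have := q.1.inv
      refine ⟨⟨fun j => (this.1.1 j).trans ?_, fun j => (this.1.2 j).trans ?_⟩,
        .inl (this.2.resolve_right fun h => h.1 q.2)⟩ <;>
      exact Nat.pow_le_pow_right (by norm_num) (by omega)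
    · have hq := fun q : {q : LoopState n Inv // ¬q.s.done} =>
        q.1.inv.2.resolve_left fun h => q.2 h.1
      obtain ⟨s', hs', hsP'⟩ := search_step (ι := {q : LoopState n Inv // ¬q.s.done})
        (x := fun q => LoopState.data x q.1) (r := fun q => r q.1.i)
        (a := fun q => a q.1.i) (B := fun q => 2 ^ (b q.1.i + 2 * q.1.t))
        ((loop_data hn).sub_index _) ((loop_data hm).sub_index _) ((loop_data hc).sub_index _)
        (loop_state.sub_index _) (fun q => hnm q.1.i) (fun q => (hq q).2.2) (fun q => q.1.inv.1)
        (fun q j k => (hcB q.1.i j k).trans (Nat.pow_le_pow_right (by norm_num) (by omega)))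
      refine ⟨s', fun q => ⟨?_, ?_⟩, hsP'⟩
      · have := (hs' q).1
        rwa [show 4 * 2 ^ (b q.1.i + 2 * (q.1.t : ℕ)) = 2 ^ (b q.1.i + 2 * (q.1.t + 1)) by ring]
          at this
      · refine (hs' q).2.imp_right fun h => ⟨h.1, ?_, h.2.2⟩
        obtain ⟨k, hk, hS⟩ := h.2.1
        have h1 := Set.ncard_insert_of_notMem (a := k) (s := {k | q.1.s.S k}) hk
        have h2 := (hq q).2.1
        rw [hS, show {l | q.1.s.S l ∨ l = k} = insert k {l | q.1.s.S l} by ext; simp [or_comm], h1]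
        omega

/-- Optimal assignments can be computed in polynomial time. -/
theorem assignment {c : ∀ i, Fin (n i) → Fin (m i) → ℤ} (hm : Index x m) (hc : PolyTime x c)
    (hnm : ∀ i, n i ≤ m i) {l : ι → ℤ} (hl : PolyTime x l) (hlc : ∀ i j k, l i ≤ c i j k) :
    ∃ π : ∀ i, Fin (n i) → Fin (m i), (∀ i, Function.Injective (π i) ∧
      ∀ π' : Fin (n i) → Fin (m i), Function.Injective π' →
        ∑ j, c i j (π i j) ≤ ∑ j, c i j (π' j)) ∧ PolyTime x π := by
  have hn : Index x n := hc.index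
  let b : ι → ℕ := fun i => (enc (c i)).size + (enc (l i)).size
  have hb : PolyBdd x b := hc.size_bdd.add hl.size_bdd
  have hcb : ∀ i j k, (c i j k).natAbs ≤ 2 ^ b i := fun i j k =>
    (Datum.natAbs_lt _).le.trans (Nat.pow_le_pow_right (by norm_num)
      (((enc_apply_size_le (c i j) k).trans (enc_apply_size_le (c i) j)).trans
        (Nat.le_add_right _ _)))
  -- A search adds at most `2 * n` bits, so after `t` rows the potentials have gained `2 * n * t`
  -- bits: the growth is additive and remains polynomial.
  let Inv : ∀ i, ℕ → (Fin (n i) → ℤ) × (Fin (m i) → ℤ) × (Fin (n i) → Option (Fin (m i))) → Prop :=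
    fun i t s => Bounded s.1 s.2.1 (2 ^ (b i + 2 * n i * t)) ∧
      PartialAssignment (c i) t s.1 s.2.1 s.2.2
  -- The constant `l` for the rows and 0 for the columns are feasible potentials for the empty
  -- assignment.
  have key := loop hn Inv (s₀ := fun i => (fun _ => l i, fun _ => 0, fun _ => Option.none)) ?_ ?_
    (B := fun i => 9 * n i + 6 * m i + n i * (b i + 2 * n i * n i) +
      m i * (b i + 2 * n i * n i) + n i * m i + n i * (n i * (m i + 3) + 2) + 30) ?_ ?_ ?_
  · obtain ⟨s, hs, hsP⟩ := key
    have hsome : ∀ i j, ∃ k, (s i).2.2 j = Option.some k := fun i j =>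
      Option.ne_none_iff_exists'.1 (((hs i).2.eq_none j).not.2 (by omega))
    choose π hπ using hsome
    have hπ' : ∀ i, (s i).2.2 = fun j => Option.some (π i j) := fun i => funext (hπ i)
    refine ⟨π, fun i => ⟨fun j j' h => (hs i).2.inj j j' _ (hπ i j) (h ▸ hπ i j'), ?_⟩, ?_⟩
    · have := (hs i).2
      rw [hπ'] at this
      exact this.sum_le
    · have : PolyTime x fun i => fun j => Option.some (π i j) := by
        simpa only [hπ'] using hsP.snd.snd
      exact this
  · exact mk (lam hn (hl.wk _)) (mk (lam hm (int _ 0)) (lam hn (none _)))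
  · refine fun i => ⟨⟨fun j => (Datum.natAbs_lt _).le.trans (Nat.pow_le_pow_right (by norm_num)
      (Nat.le_add_left _ _)), fun j => by simp⟩, ?_⟩
    exact ⟨fun j k => by simpa using hlc i j k, by simp, by simp, by simp, by simp, by simp⟩
  · have hnb := hn.bdd
    have hmb := hm.bdd
    have := fun k => PolyBdd.const x k
    have hbn := hb.add (((this 2).mul hnb).mul hnb)
    exact (((((((this 9).mul hnb).add ((this 6).mul hmb)).add (hnb.mul hbn)).add (hmb.mul hbn)).add
      (hnb.mul hmb)).add (hnb.mul ((hnb.mul (hmb.add (this 3))).add (this 2)))).add (this 30)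
  · rintro i t s ht ⟨hs, -⟩
    -- The size bound for search states is reused by padding the triple with dummy components.
    have h1 := SearchState.size_le (n := n i) (m := m i) (b := b i + 2 * n i * n i)
      ⟨True, s.1, s.2.1, s.2.2, fun _ => True, fun _ => True, fun _ _ => Option.none⟩
      ⟨fun j => (hs.1 j).trans (Nat.pow_le_pow_right (by norm_num) (by gcongr)),
        fun j => (hs.2 j).trans (Nat.pow_le_pow_right (by norm_num) (by gcongr))⟩
    refine le_trans ?_ h1
    change (enc s.1).size + ((enc s.2.1).size + (enc s.2.2).size + 1) + 1 ≤
      _ + ((enc s.1).size + ((enc s.2.1).size + ((enc s.2.2).size + _ + 1) + 1) + 1) + 1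
    omega
  · have hstate : PolyTime (LoopState.data x : LoopState n Inv → Datum) fun q => q.s := loop_state
    obtain ⟨y, hy, hyP⟩ := search (x := (LoopState.data x : LoopState n Inv → Datum))
      (b := fun q => b q.i + 2 * n q.i * q.t) (loop_data hm) (loop_data hc) loop_index
      hstate.fst hstate.snd.fst hstate.snd.snd (fun q => hnm q.i)
      ((loop_bdd (hb.add (((PolyBdd.const x 2).mul hn.bdd).mul hn.bdd))).mono fun q =>
        Nat.add_le_add_left (Nat.mul_le_mul_left _ q.t.2.le) _) (fun q => q.inv.2)
      (fun q => q.inv.1) (fun q j k => (hcb q.i j k).trans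
        (Nat.pow_le_pow_right (by norm_num) (Nat.le_add_right _ _)))
    refine ⟨y, fun q => ⟨?_, (hy q).2⟩, hyP⟩
    have := (hy q).1
    rwa [show b q.i + 2 * n q.i * (q.t : ℕ) + 2 * n q.i = b q.i + 2 * n q.i * (q.t + 1) by ring]
      at this

end PolyTime

/-! ### Covering by chains, as an assignment problem -/

section ChainCost

variable {n : ℕ}

open Classical in
/-- The cost of assigning to the element `j` a predecessor `i`, the element itself (which means that
it is not covered), or one of `L` sources. -/
noncomputable def chainCost (E : Fin n → Prop) (lt : Fin n → Fin n → Prop) (w : Fin n → ℤ) (L : ℕ)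
    (M : ℤ) (j : Fin n) : Fin (n + n) → ℤ :=
  Fin.append (fun i => if i = j then w j else if E i ∧ E j ∧ lt i j then 0 else M)
    -- At most `n` chains are nonempty, so `n` source columns suffice. This matters because `L` is
    -- given in binary and may be exponentially large.
    fun s => if E j ∧ (s : ℕ) < L then 0 else M

/-- The assignment does not use forbidden pairs. -/
def IsChainAssignment (E : Fin n → Prop) (lt : Fin n → Fin n → Prop) (L : ℕ)
    (π : Fin n → Fin (n + n)) : Prop :=
  ∀ j, π j = Fin.castAdd n j ∨ (∃ i, π j = Fin.castAdd n i ∧ E i ∧ E j ∧ lt i j) ∨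
    ∃ s : Fin n, π j = Fin.natAdd n s ∧ E j ∧ (s : ℕ) < L

/-- A set of elements covered by `L` chains, `t d` being the number of the chain of `d`. -/
structure IsChainCover (E : Fin n → Prop) (lt : Fin n → Fin n → Prop) (L : ℕ) (X : Finset (Fin n))
    (t : Fin n → ℕ) : Prop where
  mem : ∀ d ∈ X, E d
  lt_card : ∀ d ∈ X, t d < L
  comparable : ∀ d ∈ X, ∀ d' ∈ X, t d = t d' → d ≠ d' → lt d d' ∨ lt d' d

variable {E : Fin n → Prop} {lt : Fin n → Fin n → Prop} {w : Fin n → ℤ} {L : ℕ}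

-- An element of `X` is assigned its immediate predecessor in its chain if it has one, and otherwise
-- a source reserved for the chain; elements outside `X` are assigned to themselves and alone pay.
-- Immediate predecessors are distinct because an element of a chain has only one immediate
-- successor.
open Classical in
theorem IsChainCover.exists_assignment {X : Finset (Fin n)} {t : Fin n → ℕ}
    (h : IsChainCover E lt L X t) (hirr : ∀ d, ¬lt d d)
    (htr : ∀ a b c, lt a b → lt b c → lt a c) (M : ℤ) :
    ∃ π : Fin n → Fin (n + n), Function.Injective π ∧
      ∑ j, chainCost E lt w L M j (π j) = ∑ j with j ∉ X, w j := by
  have hpred : ∀ j : Fin n, j ∈ X → (∃ i ∈ X, t i = t j ∧ lt i j) →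
      ∃ i ∈ X, t i = t j ∧ lt i j ∧ ∀ i' ∈ X, t i' = t j → lt i' j → i' = i ∨ lt i' i := by
    intro j _ hex
    have hwf : WellFounded fun a b => lt b a :=
      @Finite.wellFounded_of_trans_of_irrefl _ _ _ ⟨fun a b c h1 h2 => htr c b a h2 h1⟩ ⟨hirr⟩
    obtain ⟨i, ⟨hi, hti, hlt⟩, hmax⟩ := hwf.has_min {i | i ∈ X ∧ t i = t j ∧ lt i j} hex
    refine ⟨i, hi, hti, hlt, fun i' hi' hti' hlt' => ?_⟩
    by_contra! hne
    exact hmax i' ⟨hi', hti', hlt'⟩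
      ((h.comparable i' hi' i hi (hti'.trans hti.symm) hne.1).resolve_left hne.2)
  choose! P hPX hPt hPlt hPmax using hpred
  -- If `L ≤ n`, the number of the chain is a valid source. Otherwise all `n` sources are allowed
  -- and every element can have its own.
  have hsrc : ∃ g : Fin n → Fin n, (∀ j ∈ X, (g j : ℕ) < L) ∧
      ∀ j ∈ X, ∀ j' ∈ X, g j = g j' → j = j' ∨ t j = t j' := by
    by_cases hL : L ≤ n
    · refine ⟨fun j => if hj : j ∈ X then ⟨t j, (h.lt_card j hj).trans_le hL⟩ else j,
        fun j hj => by simpa [hj] using h.lt_card j hj, fun j hj j' hj' hjj => .inr ?_⟩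
      simpa [hj, hj'] using hjj
    · exact ⟨id, fun j _ => j.2.trans (not_le.1 hL), fun j _ j' _ hjj => .inl hjj⟩
  obtain ⟨g, hgL, hg⟩ := hsrc
  let π : Fin n → Fin (n + n) := fun j =>
    if j ∈ X then if ∃ i ∈ X, t i = t j ∧ lt i j then Fin.castAdd n (P j) else Fin.natAdd n (g j)
    else Fin.castAdd n j
  have hcn : ∀ a b : Fin n, Fin.castAdd n a ≠ Fin.natAdd n b := fun a b hab => by
    have := congrArg Fin.val hab
    simp at this
    omega
  refine ⟨π, fun j j' hjj => ?_, ?_⟩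
  · by_cases hj : j ∈ X <;> by_cases hj' : j' ∈ X
    · by_cases hp : ∃ i ∈ X, t i = t j ∧ lt i j <;> by_cases hp' : ∃ i ∈ X, t i = t j' ∧ lt i j'
      · simp only [π, hj, hj', hp, hp', if_true] at hjj
        have hP : P j = P j' := by simpa using hjj
        by_contra hne
        have ht : t j = t j' := by rw [← hPt j hj hp, hP, hPt j' hj' hp']
        rcases h.comparable j hj j' hj' ht hne with hlt | hlt
        · rcases hPmax j' hj' hp' j hj ht hlt with he | he
          · exact hirr j (by simpa [hP, ← he] using hPlt j hj hp)
          · exact hirr j (htr _ _ _ he (hP ▸ hPlt j hj hp))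
        · rcases hPmax j hj hp j' hj' ht.symm hlt with he | he
          · exact hirr j' (by simpa [← hP, ← he] using hPlt j' hj' hp')
          · exact hirr j' (htr _ _ _ he (hP ▸ hPlt j' hj' hp'))
      · simp only [π, hj, hj', hp, hp', if_true, if_false] at hjj
        exact (hcn _ _ hjj).elim
      · simp only [π, hj, hj', hp, hp', if_true, if_false] at hjj
        exact (hcn _ _ hjj.symm).elim
      · simp only [π, hj, hj', hp, hp', if_true, if_false] at hjj
        refine (hg j hj j' hj' (by simpa using hjj)).elim id fun ht => ?_
        by_contra hne
        rcases h.comparable j hj j' hj' ht hne with hlt | hlt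
        · exact hp' ⟨j, hj, ht, hlt⟩
        · exact hp ⟨j', hj', ht.symm, hlt⟩
    · by_cases hp : ∃ i ∈ X, t i = t j ∧ lt i j
      · simp only [π, hj, hj', hp, if_true, if_false] at hjj
        have : P j = j' := by simpa using hjj
        exact (hj' (this ▸ hPX j hj hp)).elim
      · simp only [π, hj, hj', hp, if_true, if_false] at hjj
        exact (hcn _ _ hjj.symm).elim
    · by_cases hp : ∃ i ∈ X, t i = t j' ∧ lt i j'
      · simp only [π, hj, hj', hp, if_true, if_false] at hjj
        have : j = P j' := by simpa using hjj
        exact (hj (this ▸ hPX j' hj' hp)).elim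
      · simp only [π, hj, hj', hp, if_true, if_false] at hjj
        exact (hcn _ _ hjj).elim
    · simpa [π, hj, hj'] using hjj
  · rw [Finset.sum_filter]
    refine Finset.sum_congr rfl fun j _ => ?_
    by_cases hj : j ∈ X
    · by_cases hp : ∃ i ∈ X, t i = t j ∧ lt i j
      · have hne : P j ≠ j := fun he => hirr j (by simpa [he] using hPlt j hj hp)
        simp [π, hj, hp, chainCost, hne, h.mem _ (hPX j hj hp), h.mem j hj, hPlt j hj hp]
      · simp only [π, hj, hp, if_true, if_false, chainCost, Fin.append_right, not_true]
        simp [h.mem j hj, hgL j hj]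
    · simp [π, hj, chainCost]

/-- Optimal assignments avoid forbidden pairs. -/
theorem isChainAssignment_of_optimal {π : Fin n → Fin (n + n)} {M : ℤ}
    (hM : 2 * ∑ j, |w j| < M)
    (hopt : ∀ π' : Fin n → Fin (n + n), Function.Injective π' →
      ∑ j, chainCost E lt w L M j (π j) ≤ ∑ j, chainCost E lt w L M j (π' j)) :
    IsChainAssignment E lt L π := by
  classical
  have hW : 0 ≤ ∑ j, |w j| := Finset.sum_nonneg fun j _ => abs_nonneg _
  -- The comparison is with covering nothing, which costs the sum of all `w j`.
  have h1 : ∑ j, chainCost E lt w L M j (π j) ≤ ∑ j, |w j| := by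
    refine (hopt _ (Fin.castAdd_injective n n)).trans (Finset.sum_le_sum fun j _ => ?_)
    simp [chainCost, le_abs_self]
  have h2 : ∀ j k, -|w j| ≤ chainCost E lt w L M j k := fun j k => by
    have := neg_abs_le (w j)
    have := abs_nonneg (w j)
    refine Fin.addCases (fun i => ?_) (fun s => ?_) k <;> simp only [chainCost, Fin.append_left,
      Fin.append_right] <;> split_ifs <;> linarith
  -- One forbidden pair costs `M`, and the other rows can recover at most the sum of the `|w j|`;
  -- the total would exceed the bound of `h1`.
  have h3 : ∀ j, chainCost E lt w L M j (π j) < M := fun j => by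
    by_contra! hj
    have h4 : ∑ i, (chainCost E lt w L M i (π i) + |w i|) ≥ chainCost E lt w L M j (π j) + |w j| :=
      Finset.single_le_sum (f := fun i => chainCost E lt w L M i (π i) + |w i|)
        (fun i _ => by have := h2 i (π i); linarith) (Finset.mem_univ j)
    rw [Finset.sum_add_distrib] at h4
    have := abs_nonneg (w j)
    linarith
  intro j
  have h4 := h3 j
  generalize π j = k at h4
  revert h4
  refine Fin.addCases (fun i => ?_) (fun s => ?_) k
  · intro h4
    by_cases hij : i = j
    · exact .inl (by rw [hij])
    · simp only [chainCost, Fin.append_left, hij, if_false] at h4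
      split_ifs at h4 with h5
      · exact .inr (.inl ⟨i, rfl, h5⟩)
      · exact (lt_irrefl _ h4).elim
  · intro h4
    simp only [chainCost, Fin.append_right] at h4
    split_ifs at h4 with h5
    · exact .inr (.inr ⟨s, rfl, h5⟩)
    · exact (lt_irrefl _ h4).elim

open Classical in
theorem IsChainAssignment.sum_cost {π : Fin n → Fin (n + n)} (h : IsChainAssignment E lt L π)
    (hirr : ∀ d, ¬lt d d) (M : ℤ) :
    ∑ j, chainCost E lt w L M j (π j) = ∑ j with π j = Fin.castAdd n j, w j := by
  rw [Finset.sum_filter]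
  refine Finset.sum_congr rfl fun j _ => ?_
  rcases h j with hj | ⟨i, hj, hi⟩ | ⟨s, hj, hs⟩
  · simp [hj, chainCost]
  · have hne : i ≠ j := fun he => hirr j (by simpa [he] using hi.2.2)
    simp [hj, chainCost, hne, hi]
  · have : Fin.natAdd n s ≠ Fin.castAdd n j := fun hab => by
      have := congrArg Fin.val hab
      simp at this
      omega
    rw [hj, if_neg this, chainCost, Fin.append_right, if_pos hs]

/-- Each element that is not assigned to itself lies in a set that contains the elements assigned
to sources and the successors of its elements. -/
theorem IsChainAssignment.induction {π : Fin n → Fin (n + n)} (h : IsChainAssignment E lt L π)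
    (hirr : ∀ d, ¬lt d d) (htr : ∀ a b c, lt a b → lt b c → lt a c) {C : Fin n → Prop}
    (hsrc : ∀ j (s : Fin n), (s : ℕ) < L → π j = Fin.natAdd n s → C j)
    (hsucc : ∀ i j, C i → j ≠ i → π j = Fin.castAdd n i → C j) (j : Fin n)
    (hj : π j ≠ Fin.castAdd n j) (hinj : Function.Injective π) : C j := by
  have hwf : WellFounded lt :=
    @Finite.wellFounded_of_trans_of_irrefl _ _ _ ⟨htr⟩ ⟨hirr⟩
  induction j using hwf.induction with
  | _ j ih =>
    rcases h j with h1 | ⟨i, h1, hi⟩ | ⟨s, h1, hs⟩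
    · exact (hj h1).elim
    · have hne : j ≠ i := fun he => hirr j (by simpa [← he] using hi.2.2)
      exact hsucc i j (ih i hi.2.2 fun h2 => hne (hinj (h1.trans h2.symm))) hne h1
    · exact hsrc j s hs.2 h1

end ChainCost

theorem length_filter_lt_le (n L : ℕ) [DecidablePred fun s : Fin n => (s : ℕ) < L] :
    ((List.finRange n).filter fun s : Fin n => (s : ℕ) < L).length ≤ L := by
  have h : (((List.finRange n).filter fun s : Fin n => (s : ℕ) < L).map Fin.val).Nodup :=
    ((List.nodup_finRange n).filter _).map Fin.val_injective
  have := (List.subperm_of_subset h (l₂ := List.range L) fun a ha => by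
    obtain ⟨s, hs, rfl⟩ := List.mem_map.1 ha
    simpa using (List.mem_filter.1 hs).2).length_le
  simpa using this

namespace PolyTime

variable {ι : Type} {x : ι → Datum} {n : ι → ℕ}

theorem card (hn : Index x n) : PolyTime x fun i => (n i : ℤ) :=
  (sum hn (f := fun _ _ => 1) (int _ 1)).of_enc fun i => by simp

theorem castAdd {m : ι → ℕ} {j : ∀ i, Fin (n i)} (hj : PolyTime x j) :
    PolyTime x fun i => Fin.castAdd (m i) (j i) := hj

theorem natAdd {j : ∀ i, Fin (n i)} (hn : Index x n) (hj : PolyTime x j) :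
    PolyTime x fun i => Fin.natAdd (n i) (j i) :=
  (hj.val.add hn.card).of_enc fun i => by
    simp only [enc, IntCode.toInt, Fin.val_natAdd]
    push_cast
    ring_nf

open Classical in
theorem abs {f : ι → ℤ} (hf : PolyTime x f) : PolyTime x fun i => |f i| :=
  (ite (le_int (int x 0) hf) hf ((int x 0).sub hf)).of_enc fun i => by
    split_ifs with h
    · rw [abs_of_nonneg h]
    · rw [abs_of_neg (not_le.1 h), zero_sub]

theorem lt_val {j : ∀ i, Fin (n i)} {L : ι → ℕ} (hj : PolyTime x j) (hL : PolyTime x L) :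
    PolyTime x fun i => (j i : ℕ) < L i :=
  (hj.val.lt_int hL.natCast).congr_prop fun i => by norm_cast

variable {E : ∀ i, Fin (n i) → Prop} {lt : ∀ i, Fin (n i) → Fin (n i) → Prop}
  {w : ∀ i, Fin (n i) → ℤ} {L : ι → ℕ}

open Classical in
theorem chainCost {M : ι → ℤ} (hE : PolyTime x E) (hlt : PolyTime x lt) (hw : PolyTime x w)
    (hL : PolyTime x L) (hM : PolyTime x M) :
    PolyTime x fun i => chainCost (E i) (lt i) (w i) (L i) (M i) := by
  have hn : Index x n := hw.index
  refine lam hn (fin_append (lam (hn.wk _) ?_) (lam (hn.wk _) ?_))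
  · exact ite ((var _ _).eq ((var _ _).wk _)) (((hw.wk _).wk _).app ((var _ _).wk _))
      (ite ((((hE.wk _).wk _).app (var _ _)).and ((((hE.wk _).wk _).app ((var _ _).wk _)).and
        ((((hlt.wk _).wk _).app (var _ _)).app ((var _ _).wk _)))) (int _ 0) ((hM.wk _).wk _))
  · exact ite ((((hE.wk _).wk _).app ((var _ _).wk _)).and ((var _ _).lt_val ((hL.wk _).wk _)))
      (int _ 0) ((hM.wk _).wk _)

/-- The chain from a given first element along the successors. -/
theorem follow {π : ∀ i, Fin (n i) → Fin (n i + n i)} {j : ∀ i, Fin (n i)}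
    (hπ : PolyTime x π) (hj : PolyTime x j) (hirr : ∀ i d, ¬lt i d d)
    (htr : ∀ i a b c, lt i a b → lt i b c → lt i a c) (hinj : ∀ i, Function.Injective (π i))
    (hch : ∀ i, IsChainAssignment (E i) (lt i) (L i) (π i))
    (hstart : ∀ i, π i (j i) ≠ Fin.castAdd (n i) (j i)) :
    ∃ p : ∀ i, List (Fin (n i)), (∀ i, j i ∈ p i ∧ (p i).Pairwise (lt i) ∧
      (∀ d ∈ p i, π i d ≠ Fin.castAdd (n i) d) ∧
      ∀ a ∈ p i, ∀ b, b ≠ a → π i b = Fin.castAdd (n i) a → b ∈ p i) ∧ PolyTime x p := by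
  have hn : Index x n := hπ.index
  -- The state is the last element so far and the earlier ones, latest first. Either the chain has
  -- grown in every round, or it has no further successor; a strict chain has at most `n` elements,
  -- so the second case holds after `n` rounds.
  let Inv : ∀ i, ℕ → Fin (n i) × List (Fin (n i)) → Prop := fun i t s =>
    j i ∈ s.1 :: s.2 ∧ (s.1 :: s.2).Pairwise (fun a b => lt i b a) ∧
      (∀ d ∈ s.1 :: s.2, π i d ≠ Fin.castAdd (n i) d) ∧
      (∀ a ∈ s.2, ∀ b, b ≠ a → π i b = Fin.castAdd (n i) a → b ∈ s.1 :: s.2) ∧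
      (t < (s.1 :: s.2).length ∨ ∀ b, b ≠ s.1 → π i b ≠ Fin.castAdd (n i) s.1)
  have hlen : ∀ i t s, Inv i t s → s.2.length < n i := fun i t s hs => by
    have : (s.1 :: s.2).Nodup := List.Pairwise.imp (S := (· ≠ ·))
      (fun {a b} hab he => hirr i a (by rwa [← he] at hab)) hs.2.1
    simpa using this.length_le_card
  have key := loop hn Inv (s₀ := fun i => (j i, [])) (hj.mk nil) ?_
    (B := fun i => n i * (n i + 2 + 1) + n i + 5) ?_ ?_ ?_
  · obtain ⟨s, hs, hsP⟩ := key
    refine ⟨fun i => (s i).1 :: (s i).2 |>.reverse, fun i => ?_, (hsP.fst.cons hsP.snd).list_reverse⟩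
    obtain ⟨h1, h2, h3, h4, h5⟩ := hs i
    have h6 := hlen i _ _ (hs i)
    refine ⟨List.mem_reverse.2 h1, List.pairwise_reverse.2 h2,
      fun d hd => h3 d (List.mem_reverse.1 hd), ?_⟩
    intro a ha b hb hba
    rw [List.mem_reverse] at ha ⊢
    rcases List.mem_cons.1 ha with rfl | ha
    · rcases h5 with h5 | h5
      · simp at h5
        omega
      · exact (h5 b hb hba).elim
    · exact h4 a ha b hb hba
  · exact fun i => ⟨by simp, by simp, by simpa using hstart i, by simp, by simp⟩
  · have := fun k => PolyBdd.const x k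
    exact ((hn.bdd.mul ((hn.bdd.add (this 2)).add (this 1))).add hn.bdd).add (this 5)
  · intro i t s _ hs
    have h1 : ∀ d : Fin (n i), (enc d).size ≤ n i + 2 := fun d =>
      (Datum.size_num_natCast_le d).trans (by omega)
    have h2 := Datum.size_ofList_le (s.2.map enc) (n i + 2) fun d hd => by
      obtain ⟨a, -, rfl⟩ := List.mem_map.1 hd
      exact h1 a
    rw [List.length_map] at h2
    have h3 := Nat.mul_le_mul_right (n i + 2 + 1) (hlen i t s hs).le
    have h4 := h1 s.1
    change (enc s.1).size + (Datum.ofList (s.2.map enc)).size + 1 ≤ _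
    omega
  · have hn' : Index (LoopState.data x : LoopState n Inv → Datum) fun q => n q.i := loop_data hn
    have hπ' : PolyTime (LoopState.data x : LoopState n Inv → Datum) fun q => π q.i := loop_data hπ
    have hs : PolyTime (LoopState.data x : LoopState n Inv → Datum) fun q => q.s := loop_state
    let Q : LoopState n Inv → Prop := fun q =>
      ∃ b, b ≠ q.s.1 ∧ π q.i b = Fin.castAdd (n q.i) q.s.1
    have hQ : PolyTime (Ext (LoopState.data x : LoopState n Inv → Datum) fun q => n q.i)
        fun p => p.2 ≠ p.1.s.1 ∧ π p.1.i p.2 = Fin.castAdd (n p.1.i) p.1.s.1 :=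
      ((var _ _).eq (hs.fst.wk _)).not.and (((hπ'.wk _).app (var _ _)).eq (hs.fst.wk _).castAdd)
    refine exists_cases (p := Q) (ex hn' hQ) ?_ ⟨fun q => q.1.s, fun q => ?_, hs.sub_index _⟩
    · obtain ⟨b, hb, hbP⟩ := find (ι := {q // Q q}) (x := fun q => LoopState.data x q.1)
        (n := fun q => n q.1.i) (p := fun q b => b ≠ q.1.s.1 ∧ π q.1.i b =
          Fin.castAdd (n q.1.i) q.1.s.1) (hn'.sub_index Q)
        (hQ.reindex fun p : Σ q : {q // Q q}, Fin (n q.1.i) => ⟨p.1.1, p.2⟩) fun q => q.2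
      refine ⟨fun q => (b q, q.1.s.1 :: q.1.s.2), fun q => ?_,
        hbP.mk ((hs.fst.cons hs.snd).sub_index _)⟩
      obtain ⟨h1, h2, h3, h4, h5⟩ := q.1.inv
      obtain ⟨hb1, hb2⟩ := hb q
      have hlt : lt q.1.i q.1.s.1 (b q) := by
        rcases hch q.1.i (b q) with h | ⟨a, h, ha⟩ | ⟨s, h, hs⟩
        · exact (hb1 (by simpa using h.symm.trans hb2)).elim
        · have : a = q.1.s.1 := by simpa using h.symm.trans hb2
          exact this ▸ ha.2.2
        · have := congrArg Fin.val (h.symm.trans hb2)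
          simp at this
          omega
      refine ⟨List.mem_cons_of_mem _ h1, List.pairwise_cons.2 ⟨fun a ha => ?_, h2⟩, ?_, ?_, ?_⟩
      · rcases List.mem_cons.1 ha with rfl | ha
        · exact hlt
        · exact htr _ _ _ _ ((List.pairwise_cons.1 h2).1 a ha) hlt
      · intro d hd
        rcases List.mem_cons.1 hd with rfl | hd
        · exact fun h => hb1 (by simpa using h.symm.trans hb2)
        · exact h3 d hd
      · intro a ha c hc hca
        rcases List.mem_cons.1 ha with rfl | ha
        · exact List.mem_cons.2 (.inl (hinj _ (hca.trans hb2.symm)))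
        · exact List.mem_cons_of_mem _ (h4 a ha c hc hca)
      · refine .inl ?_
        rcases h5 with h5 | h5
        · simpa using h5
        · exact (h5 _ hb1 hb2).elim
    · obtain ⟨h1, h2, h3, h4, h5⟩ := q.1.inv
      exact ⟨h1, h2, h3, h4, .inr fun b hb hb' => q.2 ⟨b, hb, hb'⟩⟩

open Classical in
/-- Optimal coverings by chains can be computed in polynomial time. -/
theorem chains (hE : PolyTime x E) (hlt : PolyTime x lt) (hw : PolyTime x w)
    (hL : PolyTime x L) (hirr : ∀ i d, ¬lt i d d)
    (htr : ∀ i a b c, lt i a b → lt i b c → lt i a c) :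
    ∃ y : ∀ i, ℤ × List (List (Fin (n i))),
      (∀ i, (y i).1 = ∑ d with ∃ p ∈ (y i).2, d ∈ p, w i d ∧
        (y i).2.length ≤ L i ∧ (∀ p ∈ (y i).2, p.Pairwise (lt i) ∧ ∀ d ∈ p, E i d) ∧
        ∀ X t, IsChainCover (E i) (lt i) (L i) X t → ∑ d ∈ X, w i d ≤ (y i).1) ∧
      PolyTime x y := by
  have hn : Index x n := hw.index
  -- The least integer above twice the sum of the `|w i j|`, as `isChainAssignment_of_optimal`
  -- requires.
  let M : ι → ℤ := fun i => ∑ j, |w i j| + ∑ j, |w i j| + 1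
  have hM : PolyTime x M := by
    have := sum hn (f := fun i j => |w i j|) ((hw.wk _).app (var _ _)).abs
    exact (this.add this).add (int x 1)
  have hnn : Index x fun i => n i + n i := (fin_append hn hn).index
  obtain ⟨π, hπ, hπP⟩ := assignment hnn (chainCost hE hlt hw hL hM) (fun i => Nat.le_add_left _ _)
    (l := fun i => -∑ j, |w i j|)
    (((int x 0).sub (sum hn (f := fun i j => |w i j|) ((hw.wk _).app (var _ _)).abs)).of_enc
      fun i => by rw [zero_sub]) fun i j k => by
    have h1 : |w i j| ≤ ∑ j, |w i j| :=
      Finset.single_le_sum (fun j _ => abs_nonneg (w i j)) (Finset.mem_univ j)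
    have := neg_abs_le (w i j)
    have := abs_nonneg (w i j)
    refine Fin.addCases (fun l => ?_) (fun s => ?_) k <;> simp only [MRMD.chainCost,
      Fin.append_left, Fin.append_right] <;> split_ifs <;> linarith
  have hch : ∀ i, IsChainAssignment (E i) (lt i) (L i) (π i) := fun i =>
    isChainAssignment_of_optimal (by simp only [M]; linarith) (hπ i).2
  -- The list of a source is closed under successors and contains any element assigned to that
  -- source. An unused source may have the empty list.
  let C : ∀ q : Σ i, Fin (n i), List (Fin (n q.1)) → Prop := fun q p =>
    p.Pairwise (lt q.1) ∧ (∀ d ∈ p, π q.1 d ≠ Fin.castAdd (n q.1) d) ∧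
      (∀ a ∈ p, ∀ b, b ≠ a → π q.1 b = Fin.castAdd (n q.1) a → b ∈ p) ∧
      ∀ j, π q.1 j = Fin.natAdd (n q.1) q.2 → j ∈ p
  have hQ : PolyTime (Ext (Ext x n) fun q => n q.1)
      fun p => π p.1.1 p.2 = Fin.natAdd (n p.1.1) p.1.2 :=
    (((hπP.wk _).wk _).app (var _ _)).eq (((hn.wk _).wk _).natAdd ((var _ _).wk _))
  have key : ∃ p : ∀ q : Σ i, Fin (n i), List (Fin (n q.1)), (∀ q, C q (p q)) ∧
      PolyTime (Ext x n) p := by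
    let Q : (Σ i, Fin (n i)) → Prop := fun q => ∃ j, π q.1 j = Fin.natAdd (n q.1) q.2
    refine exists_cases (p := Q) (ex (hn.wk _) hQ) ?_ ⟨fun _ => [], fun q => ⟨by simp, by simp, by simp,
      fun j hj => (q.2 ⟨j, hj⟩).elim⟩, nil⟩
    obtain ⟨j, hj, hjP⟩ := find (ι := {q // Q q}) (x := fun q => Ext x n q.1)
        (n := fun q => n q.1.1) (p := fun q j => π q.1.1 j = Fin.natAdd (n q.1.1) q.1.2)
        ((hn.wk _).sub_index Q)
        (hQ.reindex fun p : Σ q : {q // Q q}, Fin (n q.1.1) => ⟨p.1.1, p.2⟩) fun q => q.2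
    obtain ⟨p, hp, hpP⟩ := follow (ι := {q // Q q}) (x := fun q => Ext x n q.1)
      (π := fun q => π q.1.1) ((hπP.wk _).sub_index Q) hjP (fun q => hirr q.1.1)
      (fun q => htr q.1.1) (fun q => (hπ q.1.1).1) (fun q => hch q.1.1) fun q h => by
        have := congrArg Fin.val ((hj q).symm.trans h)
        simp at this
        omega
    exact ⟨p, fun q => ⟨(hp q).2.1, (hp q).2.2.1, (hp q).2.2.2, fun j' hj' =>
      (hπ q.1.1).1 (hj'.trans (hj q).symm) ▸ (hp q).1⟩, hpP⟩
  obtain ⟨p, hp, hpP⟩ := key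
  let l : ∀ i, List (List (Fin (n i))) := fun i =>
    ((List.finRange (n i)).filter fun s : Fin (n i) => (s : ℕ) < L i).map fun s => p ⟨i, s⟩
  have hl : ∀ i, ∀ r ∈ l i, ∃ s : Fin (n i), (s : ℕ) < L i ∧ p ⟨i, s⟩ = r := fun i r hr => by
    obtain ⟨s, hs, rfl⟩ := List.mem_map.1 hr
    exact ⟨s, by simpa using (List.mem_filter.1 hs).2, rfl⟩
  -- The lists cover precisely the elements not assigned to themselves: tracing predecessors back
  -- from such an element ends at a source.
  have hcov : ∀ i d, (∃ r ∈ l i, d ∈ r) ↔ π i d ≠ Fin.castAdd (n i) d := fun i d => by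
    constructor
    · rintro ⟨r, hr, hd⟩
      obtain ⟨s, -, rfl⟩ := hl i r hr
      exact (hp ⟨i, s⟩).2.1 d hd
    · intro hd
      refine (hch i).induction (hirr i) (htr i) (C := fun d => ∃ r ∈ l i, d ∈ r) ?_ ?_ d hd (hπ i).1
      · intro j s hs hj
        exact ⟨_, List.mem_map.2 ⟨s, by simpa using hs, rfl⟩, (hp ⟨i, s⟩).2.2.2 j hj⟩
      · rintro a b ⟨r, hr, ha⟩ hba hb
        refine ⟨r, hr, ?_⟩
        obtain ⟨s, -, rfl⟩ := hl i r hr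
        exact (hp ⟨i, s⟩).2.2.1 a ha b hba hb
  refine ⟨fun i => (∑ d, if π i d = Fin.castAdd (n i) d then 0 else w i d, l i), fun i =>
    ⟨?_, ?_, ?_, ?_⟩, mk (sum hn ?_) (filter_map hn ((var _ _).lt_val (hL.wk _)) hpP)⟩
  · dsimp only
    rw [Finset.sum_filter]
    refine Finset.sum_congr rfl fun d _ => ?_
    by_cases h : π i d = Fin.castAdd (n i) d
    · rw [if_pos h, if_neg (fun h' => (hcov i d).1 h' h)]
    · rw [if_neg h, if_pos ((hcov i d).2 h)]
  · simpa only [l, List.length_map] using length_filter_lt_le (n i) (L i)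
  · intro r hr
    refine ⟨?_, fun d hd => ?_⟩
    · obtain ⟨s, -, rfl⟩ := hl i r hr
      exact (hp ⟨i, s⟩).1
    · have hd' := (hcov i d).1 ⟨r, hr, hd⟩
      rcases hch i d with h | ⟨a, h, ha⟩ | ⟨s, h, hs⟩
      · exact (hd' h).elim
      · exact ha.2.1
      · exact hs.1
  -- Cost and covered reward always add up to the total reward, so an assignment of minimal cost
  -- covers the maximal reward.
  · intro X t hX
    obtain ⟨π', hinj, hcost⟩ := hX.exists_assignment (w := w i) (hirr i) (htr i) (M i)
    have h1 := (hπ i).2 π' hinj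
    rw [hcost, (hch i).sum_cost (hirr i)] at h1
    have h2 := Finset.sum_filter_add_sum_filter_not Finset.univ (fun j => j ∉ X) (w i)
    have h3 := Finset.sum_filter_add_sum_filter_not Finset.univ
      (fun j => π i j = Fin.castAdd (n i) j) (w i)
    have h4 : ∑ d, (if π i d = Fin.castAdd (n i) d then 0 else w i d) =
        ∑ d with ¬π i d = Fin.castAdd (n i) d, w i d := by
      rw [Finset.sum_filter]
      exact Finset.sum_congr rfl fun d _ => by split_ifs <;> rfl
    simp only [not_not, Finset.filter_univ_mem] at h2
    simp only [h4]
    linarith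
  · exact ite (((hπP.wk _).app (var _ _)).eq (var _ _).castAdd) (int _ 0) ((hw.wk _).app (var _ _))

end PolyTime

/-! ### Paths and subproblems -/

namespace Instance

section General

variable {D R L : Type}

/-- The same resource can serve `i` and then `j`. -/
def Before (I : Instance D R L) (i j : D) : Prop := I.τ i + I.Δ i + I.fDem i j ≤ I.τ j

/-- Going directly is no slower than the detour, and skipping `j` also saves its nonnegative
duration. -/
theorem TriangleInequality.before_trans {I : Instance D R L} (h : I.TriangleInequality) {i j k : D}
    (hij : I.Before i j) (hjk : I.Before j k) : I.Before i k := by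
  have := h.1 i j k
  simp only [Before] at *
  omega

theorem TriangleInequality.start_le {I : Instance D R L} (h : I.TriangleInequality) {s : L}
    {j k : D} (hj : (I.fStart s j : ℤ) ≤ I.τ j) (hjk : I.Before j k) :
    (I.fStart s k : ℤ) ≤ I.τ k := by
  have := h.2 s j k
  simp only [Before] at *
  omega

/-- Transitivity turns the conditions on consecutive demands into conditions on all pairs, and the
condition on the first demand into one on every demand. In this form they pass to sublists. -/
theorem isPath_iff {I : Instance D R L} (h : I.TriangleInequality) {r : R} {s : L}
    (hs : s ∈ I.S r) {p : List D} :
    I.IsPath r s p ↔ p.Nodup ∧ (∀ d ∈ p, r ∈ I.M d) ∧ (∀ d ∈ p, (I.fStart s d : ℤ) ≤ I.τ d) ∧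
      p.Pairwise I.Before := by
  have htrans : IsTrans D I.Before := ⟨fun _ _ _ => h.before_trans⟩
  constructor
  · rintro ⟨h1, h2, h3, h4⟩
    have h5 : p.Pairwise I.Before := List.isChain_iff_pairwise.1 (h4.imp fun _ _ hab => hab.1)
    refine ⟨h1, h2, ?_, h5⟩
    cases p with
    | nil => simp
    | cons d p =>
      have h6 := (h3 d rfl).1
      intro d' hd'
      rcases List.mem_cons.1 hd' with rfl | hd'
      · exact h6
      · exact h.start_le h6 ((List.pairwise_cons.1 h5).1 d' hd')
  · rintro ⟨h1, h2, h3, h4⟩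
    refine ⟨h1, h2, fun d hd => ?_, ?_⟩
    · have := List.mem_of_mem_head? hd
      exact ⟨h3 d this, r, h2 d this, hs⟩
    · have h5 : p.Pairwise I.A := List.Pairwise.imp_of_mem
        (fun {a b} ha hb hab => ⟨hab, r, h2 a ha, h2 b hb⟩) h4
      exact h5.isChain

theorem SameStart.numRes {I : Instance D R L} {s : L} (h : I.SameStart s) (r : R) :
    I.numRes r = I.l s r := by simp [Instance.numRes, h r]

variable [LinearOrder R]

theorem scarcest_spec (I : Instance D R L) (v : I.Node) : I.scarcest v ∈ v.1 ∧
    ∀ r ∈ v.1, toLex (I.numRes (I.scarcest v), I.scarcest v) ≤ toLex (I.numRes r, r) := by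
  have h1 := Finset.min'_mem (v.1.image fun r => toLex (I.numRes r, r)) (v.nonempty.image _)
  obtain ⟨r, hr, hmin⟩ := Finset.mem_image.1 h1
  have h2 : I.scarcest v = r := by
    simp only [scarcest, ← hmin]
    rfl
  refine ⟨h2 ▸ hr, fun r' hr' => ?_⟩
  rw [h2]
  exact hmin.le.trans (Finset.min'_le _ _ (Finset.mem_image_of_mem _ hr'))

theorem scarcest_eq (I : Instance D R L) (v : I.Node) {r : R} (hr : r ∈ v.1)
    (hmin : ∀ r' ∈ v.1, toLex (I.numRes r, r) ≤ toLex (I.numRes r', r')) : I.scarcest v = r := by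
  obtain ⟨h1, h2⟩ := I.scarcest_spec v
  have := le_antisymm (h2 r hr) (hmin _ h1)
  exact congrArg (fun p => (ofLex p).2) this

theorem numRes_scarcest_le (I : Instance D R L) (v : I.Node) {r : R} (hr : r ∈ v.1) :
    I.numRes (I.scarcest v) ≤ I.numRes r :=
  (Prod.Lex.monotone_fst _ _ ((I.scarcest_spec v).2 r hr) :)

theorem TriangleInequality.subproblem {I : Instance D R L} (h : I.TriangleInequality)
    (v : I.Node) : (I.subproblem v).TriangleInequality :=
  ⟨fun i j k => h.1 i.1 j.1 k.1, fun s j k => h.2 s j.1 k.1⟩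

theorem subproblem_met {I : Instance D R L} {v : I.Node} {σ : Solution (I.DBar v) Unit L}
    {d : I.DBar v} : (I.subproblem v).Met σ d ↔ ∃ s, ∃ p ∈ σ.paths () s, d ∈ p := by
  exact ⟨fun h => h () (Finset.mem_singleton_self _), fun h _ _ => h⟩

open Classical in
/-- The part of a path that consists of the demands of `v` with the property `Q`. -/
noncomputable def restrictPath (I : Instance D R L) (v : I.Node) (Q : D → Prop) (p : List D) :
    List (I.DBar v) :=
  p.filterMap fun d => if h : I.M d = v.1 ∧ Q d then some ⟨d, h.1⟩ else none

theorem mem_restrictPath {I : Instance D R L} {v : I.Node} {Q : D → Prop} {p : List D}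
    {d : I.DBar v} : d ∈ I.restrictPath v Q p ↔ d.1 ∈ p ∧ Q d.1 := by
  simp only [restrictPath, List.mem_filterMap]
  constructor
  · rintro ⟨e, he, h⟩
    split_ifs at h with hQ
    obtain rfl := Option.some.inj h
    exact ⟨he, hQ.2⟩
  · rintro ⟨h1, h2⟩
    exact ⟨d.1, h1, by rw [dif_pos ⟨d.2, h2⟩]⟩

open Classical in
theorem map_restrictPath (I : Instance D R L) (v : I.Node) (Q : D → Prop) (p : List D) :
    (I.restrictPath v Q p).map Subtype.val = p.filter fun d => I.M d = v.1 ∧ Q d := by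
  induction p with
  | nil => rfl
  | cons d p ih =>
    by_cases h : I.M d = v.1 ∧ Q d
    · rw [List.filter_cons_of_pos (by simpa using h), ← ih]
      simp [restrictPath, h]
    · rw [List.filter_cons_of_neg (by simpa using h), ← ih]
      simp [restrictPath, h]

/-- A sublist of a path is a path. The timing conditions do not involve the type, so a path of any
type of the instance may be used. -/
theorem isPath_restrictPath {I : Instance D R L} (h : I.TriangleInequality) {v : I.Node}
    {s : L} (hs : s ∈ I.S (I.scarcest v)) {Q : D → Prop} {p : List D} (h1 : p.Nodup)
    (h2 : ∀ d ∈ p, (I.fStart s d : ℤ) ≤ I.τ d) (h3 : p.Pairwise I.Before) :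
    (I.subproblem v).IsPath () s (I.restrictPath v Q p) := by
  classical
  have hsub : ((I.restrictPath v Q p).map Subtype.val).Sublist p := by
    rw [map_restrictPath]
    exact List.filter_sublist
  refine (isPath_iff (h.subproblem v) hs).2 ⟨(hsub.nodup h1).of_map _, fun d _ => ?_,
    fun d hd => h2 d.1 (mem_restrictPath.1 hd).1, ?_⟩
  · exact Finset.mem_singleton_self ()
  · have := h3.sublist hsub
    have h4 : (I.restrictPath v Q p).Pairwise fun a b => I.Before a.1 b.1 := List.pairwise_map.1 this
    exact h4

open Classical in
theorem subproblem_objective [Fintype D] (I : Instance D R L) (v : I.Node)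
    (σ : Solution (I.DBar v) Unit L) (X : D → Prop)
    (hX : ∀ d : I.DBar v, (I.subproblem v).Met σ d ↔ X d.1) :
    (I.subproblem v).objective σ = ∑ d with I.M d = v.1 ∧ X d, I.w d := by
  refine (Finset.sum_map _ (Function.Embedding.subtype fun d => I.M d = v.1) I.w).symm.trans ?_
  refine Finset.sum_congr (Finset.ext fun d => ?_) fun _ _ => rfl
  simp [hX, and_comm]

end General

/-! ### Subproblems and chains -/

section Chains

variable {n : ℕ} {R L : Type}

/-- `Before`, with ties broken by the index. -/
def StrictBefore (I : Instance (Fin n) R L) (i j : Fin n) : Prop :=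
  I.Before i j ∧ ¬(I.Before j i ∧ j ≤ i)

theorem StrictBefore.irrefl (I : Instance (Fin n) R L) (i : Fin n) : ¬I.StrictBefore i i :=
  fun h => h.2 ⟨h.1, le_rfl⟩

/-- Two demands can precede each other when they start at the same time and the durations and travel
times involved are zero. A cycle would make all three demands mutually comparable and their indices
increase around it. -/
theorem StrictBefore.trans {I : Instance (Fin n) R L} (h : I.TriangleInequality) (i j k : Fin n)
    (hij : I.StrictBefore i j) (hjk : I.StrictBefore j k) : I.StrictBefore i k := by
  refine ⟨h.before_trans hij.1 hjk.1, fun hki => ?_⟩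
  have h1 : ¬j ≤ i := fun hle => hij.2 ⟨h.before_trans hjk.1 hki.1, hle⟩
  have h2 : ¬k ≤ j := fun hle => hjk.2 ⟨h.before_trans hki.1 hij.1, hle⟩
  have := hki.2
  omega

/-- The demands of `v` that can be reached from `s`. -/
def Eligible (I : Instance (Fin n) R L) (s : L) (v : I.Node) (d : Fin n) : Prop :=
  I.M d = v.1 ∧ (I.fStart s d : ℤ) ≤ I.τ d

variable [LinearOrder R]

/-- This makes the optimality of chain covers apply to all feasible solutions: the paths become
chains, and the met demands the covered set. -/
theorem exists_chainCover {I : Instance (Fin n) R L} {s : L} (hs : I.SameStart s)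
    (h : I.TriangleInequality) (v : I.Node) {σ : Solution (I.DBar v) Unit L}
    (hσ : (I.subproblem v).Feasible σ) :
    ∃ X t, IsChainCover (I.Eligible s v) I.StrictBefore (I.l s (I.scarcest v)) X t ∧
      (I.subproblem v).objective σ = ∑ d ∈ X, I.w d := by
  classical
  have hS : s ∈ I.S (I.scarcest v) := by simp [hs _]
  obtain ⟨hσ1, hσ2, hσ3⟩ := hσ
  let ps := (σ.paths () s).toList
  have hps : ∀ p ∈ ps, (I.subproblem v).IsPath () s p := fun p hp =>
    hσ3 () s p (Multiset.mem_toList.1 hp)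
  have hmet : ∀ d, (I.subproblem v).Met σ d ↔ ∃ p ∈ ps, d ∈ p := fun d => by
    rw [subproblem_met]
    constructor
    · rintro ⟨s', p, hp, hd⟩
      by_cases hs' : s' = s
      · exact ⟨p, by simpa [ps, ← hs'] using hp, hd⟩
      · rw [hσ1 () s' (by simpa [Instance.subproblem, hs _] using hs')] at hp
        simp at hp
    · rintro ⟨p, hp, hd⟩
      exact ⟨s, p, Multiset.mem_toList.1 hp, hd⟩
  -- A demand may be visited by several paths; it is put into the chain of the first one.
  let t : Fin n → ℕ := fun d => ps.findIdx fun p => d ∈ p.map Subtype.val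
  let X : Finset (Fin n) := (Finset.univ.filter ((I.subproblem v).Met σ)).map
    (Function.Embedding.subtype _)
  have hX : ∀ d ∈ X, ∃ hd : I.M d = v.1, ∃ hlt : t d < ps.length,
      (⟨d, hd⟩ : I.DBar v) ∈ ps[t d] := by
    intro d hd
    obtain ⟨e, he, rfl⟩ := Finset.mem_map.1 hd
    obtain ⟨p, hp, hep⟩ := (hmet e).1 (Finset.mem_filter.1 he).2
    have hlt : t e.1 < ps.length := List.findIdx_lt_length_of_exists
      ⟨p, hp, decide_eq_true (List.mem_map_of_mem hep)⟩
    refine ⟨e.2, hlt, ?_⟩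
    have := of_decide_eq_true (List.findIdx_getElem (w := hlt))
    obtain ⟨e', he', hee⟩ := List.mem_map.1 this
    obtain rfl : e' = e := Subtype.ext hee
    exact he'
  refine ⟨X, t, ⟨fun d hd => ?_, fun d hd => ?_, fun d hd d' hd' htt hne => ?_⟩, ?_⟩
  · obtain ⟨h1, h2, h3⟩ := hX d hd
    exact ⟨h1, ((isPath_iff (h.subproblem v) hS).1 (hps _ (List.getElem_mem h2))).2.2.1 _ h3⟩
  · obtain ⟨h1, h2, h3⟩ := hX d hd
    refine h2.trans_le ?_
    rw [Multiset.length_toList]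
    exact hσ2 () s
  · obtain ⟨h1, h2, h3⟩ := hX d hd
    obtain ⟨h1', h2', h3'⟩ := hX d' hd'
    have h4 := ((isPath_iff (h.subproblem v) hS).1 (hps _ (List.getElem_mem h2))).2.2.2
    simp only [← htt] at h3'
    have h5 : I.Before d d' ∨ I.Before d' d := by
      have h6 : ps[t d].Pairwise fun a b => I.Before a.1 b.1 ∨ I.Before b.1 a.1 :=
        h4.imp fun hab => .inl hab
      have : Std.Symm fun a b : I.DBar v => I.Before a.1 b.1 ∨ I.Before b.1 a.1 :=
        ⟨fun _ _ hab => hab.symm⟩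
      exact h6.forall h3 h3' fun he => hne (congrArg Subtype.val he)
    rcases h5 with h5 | h5
    · by_cases h6 : I.Before d' d ∧ d' ≤ d
      · exact .inr ⟨h6.1, fun h7 => hne (le_antisymm h7.2 h6.2)⟩
      · exact .inl ⟨h5, h6⟩
    · by_cases h6 : I.Before d d' ∧ d ≤ d'
      · exact .inl ⟨h6.1, fun h7 => hne (le_antisymm h6.2 h7.2)⟩
      · exact .inr ⟨h5, h6⟩
  · exact (Finset.sum_map (Finset.univ.filter ((I.subproblem v).Met σ))
      (Function.Embedding.subtype fun d => I.M d = v.1) I.w).symm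

open Classical in
/-- The solution of the subproblem of `v` given by lists of demands. -/
noncomputable def chainSolution (I : Instance (Fin n) R L) (s : L) (v : I.Node)
    (ps : List (List (Fin n))) : Solution (I.DBar v) Unit L where
  paths _ s' := if s' = s then (ps.map (I.restrictPath v fun _ => True) : Multiset _) else 0

/-- Chains of eligible demands are paths, so `V` is attained; every feasible solution earns the
reward of some chain cover, so `V` is not exceeded. -/
theorem chainSolution_isOptimal {I : Instance (Fin n) R L} {s : L} (hs : I.SameStart s)
    (h : I.TriangleInequality) (v : I.Node) {ps : List (List (Fin n))}
    (hlen : ps.length ≤ I.l s (I.scarcest v))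
    (hps : ∀ p ∈ ps, p.Pairwise I.StrictBefore ∧ ∀ d ∈ p, I.Eligible s v d) {V : ℤ}
    (hV : by classical exact V = ∑ d with ∃ p ∈ ps, d ∈ p, I.w d)
    (hmax : ∀ X t, IsChainCover (I.Eligible s v) I.StrictBefore (I.l s (I.scarcest v)) X t →
      ∑ d ∈ X, I.w d ≤ V) :
    (I.subproblem v).IsOptimal (I.chainSolution s v ps) ∧
      (I.subproblem v).objective (I.chainSolution s v ps) = V := by
  classical
  have hS : s ∈ I.S (I.scarcest v) := by simp [hs _]
  have hmet : ∀ d : I.DBar v, (I.subproblem v).Met (I.chainSolution s v ps) d ↔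
      ∃ p ∈ ps, d.1 ∈ p := fun d => by
    rw [subproblem_met]
    constructor
    · rintro ⟨s', p, hp, hd⟩
      simp only [chainSolution] at hp
      split_ifs at hp
      · obtain ⟨p', hp', rfl⟩ := List.mem_map.1 (Multiset.mem_coe.1 hp)
        exact ⟨p', hp', (mem_restrictPath.1 hd).1⟩
      · simp at hp
    · rintro ⟨p, hp, hd⟩
      refine ⟨s, I.restrictPath v (fun _ => True) p, ?_, mem_restrictPath.2 ⟨hd, trivial⟩⟩
      simp only [chainSolution, if_true]
      exact Multiset.mem_coe.2 (List.mem_map_of_mem hp)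
  have hobj : (I.subproblem v).objective (I.chainSolution s v ps) = V := by
    rw [subproblem_objective I v _ (fun d => ∃ p ∈ ps, d ∈ p) hmet, hV]
    refine Finset.sum_congr (Finset.ext fun d => ?_) fun _ _ => rfl
    simp only [Finset.mem_filter, Finset.mem_univ, true_and, and_iff_right_iff_imp]
    rintro ⟨p, hp, hd⟩
    exact ((hps p hp).2 d hd).1
  refine ⟨⟨⟨?_, ?_, ?_⟩, fun σ' hσ' => ?_⟩, hobj⟩
  · intro _ s' hs'
    have : s' ≠ s := by simpa [Instance.subproblem, hs _] using hs'
    simp [chainSolution, this]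
  · intro _ s'
    simp only [chainSolution]
    split_ifs with hs'
    · simpa [Instance.subproblem, hs'] using hlen
    · simp
  · intro _ s' p hp
    simp only [chainSolution] at hp
    split_ifs at hp with hs'
    · obtain ⟨p', hp', rfl⟩ := List.mem_map.1 (Multiset.mem_coe.1 hp)
      rw [hs']
      refine isPath_restrictPath h hS ?_ (fun d hd => ((hps p' hp').2 d hd).2)
        ((hps p' hp').1.imp fun hab => hab.1)
      exact List.Pairwise.imp (S := (· ≠ ·))
        (fun {a b} hab he => StrictBefore.irrefl I a (by rwa [← he] at hab)) (hps p' hp').1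
    · simp at hp
  · obtain ⟨X, t, hX, hobj'⟩ := exists_chainCover hs h v hσ'
    rw [hobj, hobj']
    exact hmax X t hX

end Chains

end Instance

/-! ### The approximation ratio of Algorithm C -/

namespace Instance

variable {D R L : Type}

theorem feasible_empty (I : Instance D R L) : I.Feasible (Solution.empty D R L) :=
  ⟨fun _ _ _ => rfl, fun _ _ => Nat.zero_le _, fun _ _ p hp => (Multiset.notMem_zero p hp).elim⟩

theorem objective_empty [Fintype D] (I : Instance D R L) :
    I.objective (Solution.empty D R L) = 0 := by
  classical
  refine Finset.sum_eq_zero fun d hd => ?_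
  obtain ⟨r, hr⟩ := I.M_nonempty d
  obtain ⟨s, p, hp, -⟩ := (Finset.mem_filter.1 hd).2 r hr
  exact (Multiset.notMem_zero p hp).elim

/-- There may be infinitely many candidate solutions, but objective values are sums over subsets of
the finite set of demands. -/
theorem exists_isOptValue [Fintype D] (I : Instance D R L) :
    ∃ σ, I.Feasible σ ∧ I.IsOptValue (I.objective σ) := by
  classical
  have hfin : {x | ∃ σ, I.Feasible σ ∧ I.objective σ = x}.Finite := by
    refine (Set.finite_range fun X : Finset D => ∑ d ∈ X, I.w d).subset ?_
    rintro x ⟨σ, -, rfl⟩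
    exact ⟨_, rfl⟩
  obtain ⟨x, hx⟩ := hfin.exists_maximal ⟨_, _, I.feasible_empty, rfl⟩
  obtain ⟨σ, hσ, rfl⟩ := hx.1
  exact ⟨σ, hσ, ⟨σ, hσ, rfl⟩, fun y hy => not_lt.1 fun hlt => absurd (hx.2 hy hlt.le) (not_le.2 hlt)⟩

variable [LinearOrder R]

open Classical in
/-- The part of a feasible solution that concerns the node `v`. -/
theorem exists_restriction [Fintype D] {I : Instance D R L} {s : L} (hs : I.SameStart s)
    (h : I.TriangleInequality) {σ : Solution D R L} (hσ : I.Feasible σ) (v : I.Node) :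
    ∃ σ', (I.subproblem v).Feasible σ' ∧
      (I.subproblem v).objective σ' = ∑ d with I.M d = v.1 ∧ I.Met σ d, I.w d := by
  have hS : ∀ r, s ∈ I.S r := fun r => by simp [hs r]
  let r := I.scarcest v
  have hr : r ∈ v.1 := (I.scarcest_spec v).1
  -- Demands that are visited by the scarcest type but not met must be deleted, since their rewards,
  -- possibly negative, would otherwise be counted.
  refine ⟨⟨fun _ s' => (σ.paths r s').map (I.restrictPath v (I.Met σ))⟩, ⟨?_, ?_, ?_⟩,
    subproblem_objective I v _ _ fun d => ?_⟩
  · intro _ s' hs'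
    simp [hσ.1 r s' hs']
  · intro _ s'
    rw [Multiset.card_map]
    exact hσ.2.1 r s'
  · intro _ s' p hp
    obtain ⟨p', hp', rfl⟩ := Multiset.mem_map.1 hp
    by_cases hss : s' = s
    · rw [hss] at hp' ⊢
      obtain ⟨h1, -, h2, h3⟩ := (isPath_iff h (hS r)).1 (hσ.2.2 r s p' hp')
      exact isPath_restrictPath h (hS _) h1 h2 h3
    · rw [hσ.1 r s' (by simpa [hs r] using hss)] at hp'
      simp at hp'
  · rw [subproblem_met]
    constructor
    · rintro ⟨s', p, hp, hd⟩
      obtain ⟨p', hp', rfl⟩ := Multiset.mem_map.1 hp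
      exact (mem_restrictPath.1 hd).2
    · intro hd
      obtain ⟨s', p, hp, hdp⟩ := hd r (by rw [d.2]; exact hr)
      exact ⟨s', _, Multiset.mem_map_of_mem _ hp, mem_restrictPath.2 ⟨hdp, hd⟩⟩

end Instance

section AlgorithmC

variable {D R L : Type} [Fintype D] [Fintype R] [LinearOrder R] {I : Instance D R L} {a b : ℕ}
  (c : ABColoring I.conflictGraph a b) (sub : ∀ v : I.Node, Solution (I.DBar v) Unit L)

theorem mem_colorClass {i : Fin a} {v : I.Node} : v ∈ colorClass c i ↔ i ∈ c.colors v := by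
  simp [colorClass]

/-- Nodes with a common color are not adjacent, so distinct ones share no type; the sum that defines
`colorSolution` has at most one term. -/
theorem colorClass_unique {i : Fin a} {u v : I.Node} (hu : u ∈ colorClass c i)
    (hv : v ∈ colorClass c i) {r : R} (hru : r ∈ u.1) (hrv : r ∈ v.1) : u = v := by
  by_contra hne
  refine Finset.disjoint_left.1 (c.disjoint_of_adj u v ⟨hne, fun hd => ?_⟩)
    ((mem_colorClass c).1 hu) ((mem_colorClass c).1 hv)
  exact Finset.disjoint_left.1 hd hru hrv

theorem colorSolution_paths_of_mem {i : Fin a} {v : I.Node} (hv : v ∈ colorClass c i) {r : R}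
    (hr : r ∈ v.1) (s : L) :
    (colorSolution c sub i).paths r s = ((sub v).paths () s).map (List.map Subtype.val) := by
  classical
  have : (colorClass c i).filter (fun v => r ∈ v.1) = {v} := by
    ext u
    simp only [Finset.mem_filter, Finset.mem_singleton]
    exact ⟨fun hu => colorClass_unique c hu.1 hv hu.2 hr, fun hu => hu ▸ ⟨hv, hr⟩⟩
  simp only [colorSolution]
  rw [Finset.sum_congr (by convert this) fun _ _ => rfl, Finset.sum_singleton]

theorem colorSolution_paths_of_notMem {i : Fin a} {r : R}
    (hr : ∀ v ∈ colorClass c i, r ∉ v.1) (s : L) : (colorSolution c sub i).paths r s = 0 :=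
  Finset.sum_eq_zero fun v hv => ((hr v (Finset.mem_filter.1 hv).1) (Finset.mem_filter.1 hv).2).elim

variable {s : L}

/-- With a common start, comparing total numbers of resources is comparing numbers at `s`, so each
type of a node has enough resources to copy the paths of the scarcest one. -/
theorem feasible_colorSolution (hs : I.SameStart s) (htri : I.TriangleInequality)
    (hsub : ∀ v, (I.subproblem v).Feasible (sub v)) (i : Fin a) :
    I.Feasible (colorSolution c sub i) := by
  have key : ∀ r s', (colorSolution c sub i).paths r s' = 0 ∨ ∃ v : I.Node, r ∈ v.1 ∧
      (colorSolution c sub i).paths r s' = ((sub v).paths () s').map (List.map Subtype.val) := by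
    intro r s'
    by_cases h : ∃ v ∈ colorClass c i, r ∈ v.1
    · obtain ⟨v, hv, hr⟩ := h
      exact .inr ⟨v, hr, colorSolution_paths_of_mem c sub hv hr s'⟩
    · exact .inl (colorSolution_paths_of_notMem c sub (by simpa using h) s')
  refine ⟨fun r s' hs' => ?_, fun r s' => ?_, fun r s' p hp => ?_⟩
  · rcases key r s' with h | ⟨v, hr, h⟩
    · exact h
    · rw [h, (hsub v).1 () s' (by simpa [Instance.subproblem, hs _] using hs')]
      rfl
  · rcases key r s' with h | ⟨v, hr, h⟩
    · simp [h]
    · rw [h, Multiset.card_map]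
      by_cases hss : s' = s
      · have h1 := I.numRes_scarcest_le v hr
        rw [hs.numRes, hs.numRes] at h1
        rw [hss]
        exact ((hsub v).2.1 () s).trans h1
      · rw [(hsub v).1 () s' (by simpa [Instance.subproblem, hs _] using hss)]
        simp
  · rcases key r s' with h | ⟨v, hr, h⟩
    · simp [h] at hp
    · rw [h] at hp
      obtain ⟨p', hp', rfl⟩ := Multiset.mem_map.1 hp
      have hss : s' = s := by
        by_contra hss
        rw [(hsub v).1 () s' (by simpa [Instance.subproblem, hs _] using hss)] at hp'
        simp at hp'
      rw [hss] at hp' ⊢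
      obtain ⟨h1, -, h2, h3⟩ := (Instance.isPath_iff (htri.subproblem v)
        (by simp [Instance.subproblem, hs _])).1 ((hsub v).2.2 () s p' hp')
      refine (Instance.isPath_iff htri (by simp [hs _])).2 ⟨h1.map Subtype.val_injective, ?_, ?_, ?_⟩
      · intro d hd
        obtain ⟨e, -, rfl⟩ := List.mem_map.1 hd
        rw [e.2]
        exact hr
      · intro d hd
        obtain ⟨e, he, rfl⟩ := List.mem_map.1 hd
        exact h2 e he
      · exact List.pairwise_map.2 h3

/-- The paths copied from a node visit only demands of that node, so a single visit identifies it.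
Conversely, all types of the node follow the same paths, so a visit by one is a visit by all. -/
theorem met_colorSolution (i : Fin a) (d : D) : I.Met (colorSolution c sub i) d ↔
    I.node d ∈ colorClass c i ∧ (I.subproblem (I.node d)).Met (sub (I.node d)) ⟨d, rfl⟩ := by
  rw [Instance.subproblem_met]
  constructor
  · intro h
    obtain ⟨r, hr⟩ := I.M_nonempty d
    obtain ⟨s, p, hp, hd⟩ := h r hr
    by_cases hex : ∃ v ∈ colorClass c i, r ∈ v.1
    · obtain ⟨v, hv, hrv⟩ := hex
      rw [colorSolution_paths_of_mem c sub hv hrv] at hp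
      obtain ⟨p', hp', rfl⟩ := Multiset.mem_map.1 hp
      obtain ⟨e, he, rfl⟩ := List.mem_map.1 hd
      obtain ⟨d, hdv⟩ := e
      obtain rfl : I.node d = v := Subtype.ext hdv
      exact ⟨hv, s, p', hp', he⟩
    · rw [colorSolution_paths_of_notMem c sub (by simpa using hex)] at hp
      simp at hp
  · rintro ⟨hv, s, p, hp, hd⟩ r hr
    refine ⟨s, p.map Subtype.val, ?_, List.mem_map.2 ⟨_, hd, rfl⟩⟩
    rw [colorSolution_paths_of_mem c sub hv hr]
    exact Multiset.mem_map_of_mem _ hp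

/-- The met demands are grouped by their nodes. -/
theorem objective_colorSolution (i : Fin a) :
    I.objective (colorSolution c sub i) = colorValue c sub i := by
  classical
  have h1 := Finset.sum_fiberwise_of_maps_to (s := Finset.univ.filter (I.Met (colorSolution c sub i)))
    (t := colorClass c i) (g := I.node) (fun d hd =>
      ((met_colorSolution c sub i d).1 (Finset.mem_filter.1 hd).2).1) I.w
  rw [Instance.objective, colorValue]
  refine h1.symm.trans (Finset.sum_congr rfl fun v hv => ?_)
  rw [Instance.subproblem_objective I v (sub v) (I.Met (colorSolution c sub i))]
  · refine Finset.sum_congr (Finset.ext fun d => ?_) fun _ _ => rfl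
    simp only [Finset.mem_filter, Finset.mem_univ, true_and]
    exact ⟨fun h => ⟨congrArg Subtype.val h.2, h.1⟩, fun h => ⟨h.2, Subtype.ext h.1⟩⟩
  · rintro ⟨d, hd⟩
    obtain rfl : v = I.node d := Subtype.ext hd.symm
    rw [met_colorSolution]
    exact ⟨fun h => ⟨hv, h⟩, fun h => h.2⟩

/-- Replacement on ties selects the last maximizer. The strict inequality beyond it makes it unique,
so a program may search for it instead of replaying the fold. -/
theorem foldl_best {α : Type} {a : ℕ} (f : Fin a → ℤ) (g : Fin a → α) (x : α)
    (l : List (Fin a)) (hl : l.Pairwise (· < ·)) :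
    (l.foldl (fun (cur : ℤ × α) i => if cur.1 ≤ f i then (f i, g i) else cur) (0, x) = (0, x) ∧
      ∀ i ∈ l, f i < 0) ∨
    ∃ i ∈ l, l.foldl (fun (cur : ℤ × α) i => if cur.1 ≤ f i then (f i, g i) else cur) (0, x) =
      (f i, g i) ∧ 0 ≤ f i ∧ ∀ j ∈ l, f j ≤ f i ∧ (i < j → f j < f i) := by
  induction l using List.reverseRecOn with
  | nil => simp
  | append_singleton l k ih =>
    obtain ⟨hl1, -, hl2⟩ := List.pairwise_append.1 hl
    rw [List.foldl_append, List.foldl_cons, List.foldl_nil]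
    rcases ih hl1 with ⟨h1, h2⟩ | ⟨i, hi, h1, h2, h3⟩
    · rw [h1]
      by_cases hk : 0 ≤ f k
      · refine .inr ⟨k, by simp, by rw [if_pos hk], hk, fun j hj => ?_⟩
        rcases List.mem_append.1 hj with hj | hj
        · exact ⟨(h2 j hj).le.trans hk, fun hkj => (lt_asymm hkj (hl2 j hj k (by simp))).elim⟩
        · obtain rfl : j = k := by simpa using hj
          exact ⟨le_rfl, fun h => (lt_irrefl _ h).elim⟩
      · refine .inl ⟨by rw [if_neg hk], fun j hj => ?_⟩
        rcases List.mem_append.1 hj with hj | hj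
        · exact h2 j hj
        · obtain rfl : j = k := by simpa using hj
          exact not_le.1 hk
    · rw [h1]
      by_cases hk : f i ≤ f k
      · refine .inr ⟨k, by simp, by rw [if_pos hk], h2.trans hk, fun j hj => ?_⟩
        rcases List.mem_append.1 hj with hj | hj
        · exact ⟨(h3 j hj).1.trans hk, fun hkj => (lt_asymm hkj (hl2 j hj k (by simp))).elim⟩
        · obtain rfl : j = k := by simpa using hj
          exact ⟨le_rfl, fun h => (lt_irrefl _ h).elim⟩
      · refine .inr ⟨i, by simp [hi], by rw [if_neg hk], h2, fun j hj => ?_⟩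
        rcases List.mem_append.1 hj with hj | hj
        · exact h3 j hj
        · obtain rfl : j = k := by simpa using hj
          exact ⟨(not_le.1 hk).le, fun _ => not_le.1 hk⟩

/-- Algorithm C returns the last of the best colors if their value is nonnegative. -/
theorem algorithmC_eq :
    (algorithmC c sub = (0, Solution.empty D R L) ∧ ∀ i, colorValue c sub i < 0) ∨
    ∃ i, algorithmC c sub = (colorValue c sub i, colorSolution c sub i) ∧ 0 ≤ colorValue c sub i ∧
      ∀ j, colorValue c sub j ≤ colorValue c sub i ∧
        (i < j → colorValue c sub j < colorValue c sub i) := by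
  have := foldl_best (colorValue c sub) (colorSolution c sub) (Solution.empty D R L)
    (List.finRange a) (List.pairwise_lt_finRange a)
  simp only [List.mem_finRange, true_implies, true_and] at this
  exact this

theorem feasible_algorithmC (hs : I.SameStart s) (htri : I.TriangleInequality)
    (hsub : ∀ v, (I.subproblem v).Feasible (sub v)) : I.Feasible (algorithmC c sub).2 := by
  rcases algorithmC_eq c sub with ⟨h, -⟩ | ⟨i, h, -⟩
  · rw [h]
    exact I.feasible_empty
  · rw [h]
    exact feasible_colorSolution c sub hs htri hsub i

theorem objective_algorithmC : I.objective (algorithmC c sub).2 = (algorithmC c sub).1 := by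
  rcases algorithmC_eq c sub with ⟨h, -⟩ | ⟨i, h, -⟩
  · rw [h]
    exact I.objective_empty
  · rw [h]
    exact objective_colorSolution c sub i

theorem colorValue_le_algorithmC (i : Fin a) : colorValue c sub i ≤ (algorithmC c sub).1 := by
  rcases algorithmC_eq c sub with ⟨h, h'⟩ | ⟨j, h, -, h'⟩
  · rw [h]
    exact (h' i).le
  · rw [h]
    exact (h' i).1

/-- Double counting of the pairs of a node and one of its `b` colors. -/
theorem sum_colorValue :
    ∑ i, colorValue c sub i = b * ∑ v, (I.subproblem v).objective (sub v) := by
  simp only [colorValue]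
  rw [Finset.sum_comm' (t' := Finset.univ) (s' := fun v => c.colors v)
    (fun i v => by simp [mem_colorClass]), Finset.mul_sum]
  refine Finset.sum_congr rfl fun v _ => ?_
  rw [Finset.sum_const, c.card_colors, nsmul_eq_mul]

/-- The reward of `σ` is split over the nodes, bounded there by the optima of the subproblems, and
averaged over the colors. -/
theorem optValue_le_algorithmC (hs : I.SameStart s) (htri : I.TriangleInequality)
    (hsub : ∀ v, (I.subproblem v).IsOptimal (sub v)) {σ : Solution D R L} (hσ : I.Feasible σ) :
    b * I.objective σ ≤ a * (algorithmC c sub).1 := by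
  classical
  have h1 : I.objective σ ≤ ∑ v, (I.subproblem v).objective (sub v) := by
    rw [Instance.objective, ← Finset.sum_fiberwise _ I.node]
    refine Finset.sum_le_sum fun v _ => ?_
    obtain ⟨σ', hσ', hobj⟩ := Instance.exists_restriction hs htri hσ v
    refine le_trans (le_of_eq ?_) ((hsub v).2 σ' hσ')
    rw [hobj]
    refine Finset.sum_congr (Finset.ext fun d => ?_) fun _ _ => rfl
    simp only [Finset.mem_filter, Finset.mem_univ, true_and]
    exact ⟨fun h => ⟨congrArg Subtype.val h.2, h.1⟩, fun h => ⟨h.2, Subtype.ext h.1⟩⟩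
  calc (b : ℤ) * I.objective σ ≤ b * ∑ v, (I.subproblem v).objective (sub v) :=
        mul_le_mul_of_nonneg_left h1 (Int.natCast_nonneg b)
    _ = ∑ i, colorValue c sub i := (sum_colorValue c sub).symm
    _ ≤ ∑ _ : Fin a, (algorithmC c sub).1 :=
        Finset.sum_le_sum fun i _ => colorValue_le_algorithmC c sub i
    _ = a * (algorithmC c sub).1 := by simp

end AlgorithmC

/-! ### Running time of Algorithm C -/

namespace Instance

variable {n : ℕ} {R L : Type}

/-- The first demand of a node. -/
theorem exists_first (I : Instance (Fin n) R L) (v : I.Node) :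
    ∃ d, I.M d = v.1 ∧ ∀ d', I.M d' = v.1 → d ≤ d' := by
  obtain ⟨d, hd, hmin⟩ := WellFounded.has_min (α := Fin n) wellFounded_lt {d | I.M d = v.1} v.2
  exact ⟨d, hd, fun d' hd' => not_lt.1 (hmin d' hd')⟩

/-- The first demand of a node. -/
noncomputable def first (I : Instance (Fin n) R L) (v : I.Node) : Fin n := (I.exists_first v).choose

theorem node_first (I : Instance (Fin n) R L) (v : I.Node) : I.node (I.first v) = v :=
  Subtype.ext (I.exists_first v).choose_spec.1

/-- Nodes are not part of the coded data; this is the test by which a program recognizes their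
representatives. -/
theorem first_node_eq_iff {I : Instance (Fin n) R L} {d : Fin n} :
    I.first (I.node d) = d ↔ ∀ d', I.M d' = I.M d → d ≤ d' := by
  obtain ⟨h1, h2⟩ := (I.exists_first (I.node d)).choose_spec
  constructor
  · intro h d' hd'
    exact h ▸ h2 d' hd'
  · intro h
    exact le_antisymm (h2 d rfl) (h _ h1)

open Classical in
theorem sum_nodes (I : Instance (Fin n) R L) (X : Finset I.Node) (f : Fin n → ℤ) :
    ∑ v ∈ X, f (I.first v) =
      ∑ d, if I.node d ∈ X ∧ I.first (I.node d) = d then f d else 0 := by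
  classical
  rw [← Finset.sum_filter]
  refine Finset.sum_nbij' I.first I.node (fun v hv => ?_) (fun d hd => ?_) (fun v _ => ?_)
    (fun d hd => ?_) fun _ _ => rfl
  · simp [node_first, hv]
  · exact (Finset.mem_filter.1 hd).2.1
  · exact I.node_first v
  · exact (Finset.mem_filter.1 hd).2.2

/-- The paths of `chainSolution` are the given lists. -/
theorem map_chainSolution {I : Instance (Fin n) R L} [LinearOrder R] {s : L} {v : I.Node}
    {ps : List (List (Fin n))} (hps : ∀ p ∈ ps, ∀ d ∈ p, I.Eligible s v d) :
    ((I.chainSolution s v ps).paths () s).map (List.map Subtype.val) =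
      (ps : Multiset (List (Fin n))) := by
  simp only [chainSolution, if_true, Multiset.map_coe, List.map_map]
  refine congrArg _ ((List.map_congr_left fun p hp => ?_).trans (List.map_id ps))
  rw [Function.comp_apply, map_restrictPath, List.filter_eq_self.2]
  · rfl
  · intro d hd
    simpa using (hps p hp d hd).1

end Instance

/-- An instance with a coloring. -/
structure Input where
  n : ℕ
  k : ℕ
  q : ℕ
  I : Instance (Fin n) (Fin k) (Fin q)
  s : Fin q
  sameStart : I.SameStart s
  triangle : I.TriangleInequality
  a : ℕ
  b : ℕ
  c : ABColoring I.conflictGraph a b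

namespace Input

/-- The code of the input. -/
noncomputable def code (i : Input) : Datum := encodeInput i.I i.c

open PolyTime

/-- The final `()` has code 0, the end marker of a list, so the code of the instance is that of a
nested tuple and its parameters are projections. -/
theorem polyTime_instance : PolyTime code fun i => (i.n, i.k, i.q, (fun r s => s ∈ i.I.S r),
    (fun s r => i.I.l s r), (fun d r => r ∈ i.I.M d), (fun d => i.I.τ d), (fun d => i.I.Δ d),
    (fun d => i.I.w d), (fun s d => i.I.fStart s d), (fun d e => i.I.fDem d e), ()) :=
  of_enc (dfst (PolyTime.id _)) fun _ => rfl

theorem polyTime_S : PolyTime code fun i => fun r s => s ∈ i.I.S r :=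
  polyTime_instance.snd.snd.snd.fst

theorem polyTime_l : PolyTime code fun i => fun s r => i.I.l s r :=
  polyTime_instance.snd.snd.snd.snd.fst

theorem polyTime_M : PolyTime code fun i => fun d r => r ∈ i.I.M d :=
  polyTime_instance.snd.snd.snd.snd.snd.fst

theorem polyTime_τ : PolyTime code fun i => fun d => i.I.τ d :=
  polyTime_instance.snd.snd.snd.snd.snd.snd.fst

theorem polyTime_Δ : PolyTime code fun i => fun d => i.I.Δ d :=
  polyTime_instance.snd.snd.snd.snd.snd.snd.snd.fst

theorem polyTime_w : PolyTime code fun i => fun d => i.I.w d :=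
  polyTime_instance.snd.snd.snd.snd.snd.snd.snd.snd.fst

theorem polyTime_fStart : PolyTime code fun i => fun s d => i.I.fStart s d :=
  polyTime_instance.snd.snd.snd.snd.snd.snd.snd.snd.snd.fst

theorem polyTime_fDem : PolyTime code fun i => fun d e => i.I.fDem d e :=
  polyTime_instance.snd.snd.snd.snd.snd.snd.snd.snd.snd.snd.fst

theorem polyTime_colorClass :
    PolyTime code fun i => fun j d => i.I.node d ∈ colorClass i.c j :=
  (of_enc (z := fun i : Input => ((fun j d => i.I.node d ∈ colorClass i.c j), ()))
    (dsnd (dsnd (PolyTime.id _))) fun _ => rfl).fst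

theorem index_n : Index code n := polyTime_M.index

theorem index_k : Index code k := polyTime_S.index

theorem index_q : Index code q := polyTime_l.index

theorem index_a : Index code a := polyTime_colorClass.index

/-- The common starting location can be computed. -/
theorem exists_start : ∃ s : ∀ i : Input, Fin i.q, (∀ i : Input, i.I.SameStart (s i)) ∧
    PolyTime code s := by
  -- A location shared by all types is sought. If there are no types, any location passes and
  -- `SameStart` holds vacuously.
  obtain ⟨s, hs, hsP⟩ := find index_q (p := fun (i : Input) s => ∀ r, s ∈ i.I.S r)
    (all (index_k.wk _) (((polyTime_S.wk _).wk _).app (var _ _) |>.app ((var _ _).wk _)))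
    fun i => ⟨i.s, fun r => by simp [i.sameStart r]⟩
  refine ⟨s, fun i r => ?_, hsP⟩
  have := hs i r
  rw [i.sameStart r, Finset.mem_singleton] at this
  rw [i.sameStart r, this]

theorem polyTime_strictBefore : PolyTime code fun i => i.I.StrictBefore := by
  have hB : PolyTime code fun i => i.I.Before := by
    refine lam index_n (lam (index_n.wk _) (le_int (add (add ?_ (natCast ?_)) (natCast ?_)) ?_))
    · exact ((polyTime_τ.wk _).wk _).app ((var _ _).wk _)
    · exact ((polyTime_Δ.wk _).wk _).app ((var _ _).wk _)
    · exact (((polyTime_fDem.wk _).wk _).app ((var _ _).wk _)).app (var _ _)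
    · exact ((polyTime_τ.wk _).wk _).app (var _ _)
  refine lam index_n (lam (index_n.wk _) (and ?_ (not (and ?_ ?_))))
  · exact (((hB.wk _).wk _).app ((var _ _).wk _)).app (var _ _)
  · exact (((hB.wk _).wk _).app (var _ _)).app ((var _ _).wk _)
  · exact ((var _ _).val.le_int ((var _ _).wk _).val).congr_prop fun _ => by simp

variable {s : ∀ i : Input, Fin i.q}

theorem polyTime_scarcest (hs : ∀ i : Input, i.I.SameStart (s i)) (hsP : PolyTime code s) :
    PolyTime (Ext code n) fun p => p.1.I.scarcest (p.1.I.node p.2) := by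
  have hM : PolyTime (Ext (Ext code n) fun p => p.1.k) fun p => p.2 ∈ p.1.1.I.M p.1.2 :=
    (((polyTime_M.wk _).wk _).app ((var _ _).wk _)).app (var _ _)
  have hl : PolyTime code fun i => i.I.l (s i) := polyTime_l.app hsP
  have key := find (x := Ext code n) (n := fun p => p.1.k) (index_k.wk _)
    (p := fun p r => r ∈ p.1.I.M p.2 ∧ ∀ r', r' ∈ p.1.I.M p.2 →
      (p.1.I.l (s p.1) r : ℤ) < p.1.I.l (s p.1) r' ∨ p.1.I.l (s p.1) r = p.1.I.l (s p.1) r' ∧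
        (r : ℤ) ≤ (r' : ℤ)) ?_ ?_
  · obtain ⟨r, hr, hrP⟩ := key
    refine hrP.of_enc fun p => ?_
    have h : p.1.I.scarcest (p.1.I.node p.2) = r p := by
      refine Instance.scarcest_eq _ (p.1.I.node p.2) (hr p).1 fun r' hr' => ?_
      rw [Prod.Lex.toLex_le_toLex, (hs p.1).numRes, (hs p.1).numRes]
      exact ((hr p).2 r' hr').imp (fun h => by exact_mod_cast h) fun h => ⟨h.1, by
        have := h.2
        exact_mod_cast this⟩
    rw [h]
  · refine hM.and (all (x := Ext (Ext code n) fun p => p.1.k) (n := fun p => p.1.1.k)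
      (p := fun p r' => r' ∈ p.1.1.I.M p.1.2 →
        (p.1.1.I.l (s p.1.1) p.2 : ℤ) < p.1.1.I.l (s p.1.1) r' ∨
          p.1.1.I.l (s p.1.1) p.2 = p.1.1.I.l (s p.1.1) r' ∧ (p.2 : ℤ) ≤ (r' : ℤ))
      ((index_k.wk _).wk _) (imp ?_ (or ?_ (and ?_ ?_))))
    · exact ((((polyTime_M.wk _).wk _).wk _).app (((var _ _).wk _).wk _)).app (var _ _)
    · exact lt_int (natCast ((((hl.wk _).wk _).wk _).app ((var _ _).wk _)))
        (natCast ((((hl.wk _).wk _).wk _).app (var _ _)))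
    · exact ((((hl.wk _).wk _).wk _).app ((var _ _).wk _)).eq ((((hl.wk _).wk _).wk _).app (var _ _))
    · exact ((var _ _).wk _).val.le_int (var _ _).val
  · intro p
    obtain ⟨h1, h2⟩ := p.1.I.scarcest_spec (p.1.I.node p.2)
    refine ⟨_, h1, fun r' hr' => ?_⟩
    have := h2 r' hr'
    rw [Prod.Lex.toLex_le_toLex, (hs p.1).numRes, (hs p.1).numRes] at this
    exact this.imp (fun h => by exact_mod_cast h) fun h => ⟨h.1, by
      have := h.2
      exact_mod_cast this⟩

/-- All subproblems can be solved, the solutions being given by chains. -/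
theorem exists_chains (hs : ∀ i : Input, i.I.SameStart (s i)) (hsP : PolyTime code s) :
    ∃ y : ∀ i : Input, Fin i.n → ℤ × List (List (Fin i.n)),
      (∀ i d, (∀ p ∈ (y i d).2, ∀ e ∈ p, i.I.Eligible (s i) (i.I.node d) e) ∧
        (i.I.subproblem (i.I.node d)).IsOptimal
          (i.I.chainSolution (s i) (i.I.node d) (y i d).2) ∧
        (i.I.subproblem (i.I.node d)).objective
          (i.I.chainSolution (s i) (i.I.node d) (y i d).2) = (y i d).1) ∧
      PolyTime code y := by
  have hE : PolyTime (Ext code n) fun p => p.1.I.Eligible (s p.1) (p.1.I.node p.2) := by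
    refine lam (x := Ext code n) (n := fun p => p.1.n) (index_n.wk _) (and ?_ (le_int (natCast ?_) ?_))
    · refine (all (x := Ext (Ext code n) fun p => p.1.n) (n := fun p => p.1.1.k)
        (p := fun p r => r ∈ p.1.1.I.M p.2 ↔ r ∈ p.1.1.I.M p.1.2)
        ((index_k.wk _).wk _) (iff ?_ ?_)).congr_prop fun p => Finset.ext_iff
      · exact ((((polyTime_M.wk _).wk _).wk _).app ((var _ _).wk _)).app (var _ _)
      · exact ((((polyTime_M.wk _).wk _).wk _).app (((var _ _).wk _).wk _)).app (var _ _)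
    · exact (((polyTime_fStart.wk _).wk _).app ((hsP.wk _).wk _)).app (var _ _)
    · exact ((polyTime_τ.wk _).wk _).app (var _ _)
  -- The input is extended by a demand that stands for its node, so each subproblem is solved once
  -- per demand of the node.
  obtain ⟨y, hy, hyP⟩ := chains (n := fun p => p.1.n) (w := fun p => p.1.I.w) hE
    (polyTime_strictBefore.wk n) (polyTime_w.wk n)
    ((polyTime_l.wk n).app (hsP.wk n) |>.app (polyTime_scarcest hs hsP))
    (fun p => Instance.StrictBefore.irrefl p.1.I) fun p => Instance.StrictBefore.trans p.1.triangle
  refine ⟨fun i d => y ⟨i, d⟩, fun i d => ?_,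
    lam (α := fun i : Input => ℤ × List (List (Fin i.n))) index_n hyP⟩
  obtain ⟨h1, h2, h3, h4⟩ := hy ⟨i, d⟩
  exact ⟨fun p hp => (h3 p hp).2, i.I.chainSolution_isOptimal (hs i) i.triangle _ h2 h3 h1 h4⟩

/-- An output of Algorithm C can be computed. -/
theorem exists_algorithmC :
    ∃ out : ∀ i : Input, ℤ × (Fin i.k → Fin i.q → List (List (Fin i.n))),
      (∀ i, ∃ sub : ∀ v : i.I.Node, Solution (i.I.DBar v) Unit (Fin i.q),
        (∀ v, (i.I.subproblem v).IsOptimal (sub v)) ∧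
        (out i).1 = (algorithmC i.c sub).1 ∧
        ∀ r s, ((out i).2 r s : Multiset (List (Fin i.n))) = (algorithmC i.c sub).2.paths r s) ∧
      PolyTime code out := by
  classical
  obtain ⟨s, hs, hsP⟩ := exists_start
  obtain ⟨y, hy, hyP⟩ := exists_chains hs hsP
  -- Among the solutions computed for the demands of a node, the one for its first demand is used.
  let sub : ∀ i : Input, ∀ v : i.I.Node, Solution (i.I.DBar v) Unit (Fin i.q) := fun i v =>
    i.I.chainSolution (s i) v (y i (i.I.first v)).2
  have hsub : ∀ i v, (∀ p ∈ (y i (i.I.first v)).2, ∀ e ∈ p, i.I.Eligible (s i) v e) ∧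
      (i.I.subproblem v).IsOptimal (sub i v) ∧
      (i.I.subproblem v).objective (sub i v) = (y i (i.I.first v)).1 := fun i v => by
    have := hy i (i.I.first v)
    rwa [i.I.node_first] at this
  have hfirst : PolyTime code fun i => fun d => i.I.first (i.I.node d) = d := by
    refine lam index_n ((all (index_n.wk n)
      (p := fun p d' => (∀ r, r ∈ p.1.I.M d' ↔ r ∈ p.1.I.M p.2) → (p.2 : ℤ) ≤ (d' : ℤ))
      (imp (all ((index_k.wk _).wk _) (iff ?_ ?_)) (le_int ((var _ _).wk _).val (var _ _).val))
      ).congr_prop fun p => ?_)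
    · exact ((((polyTime_M.wk _).wk _).wk _).app ((var _ _).wk _)).app (var _ _)
    · exact ((((polyTime_M.wk _).wk _).wk _).app (((var _ _).wk _).wk _)).app (var _ _)
    · rw [Instance.first_node_eq_iff]
      simp [Finset.ext_iff]
  have hval : PolyTime code fun i => colorValue i.c (sub i) := by
    refine lam index_a ((sum (index_n.wk a)
      (f := fun p d => if p.1.I.node d ∈ colorClass p.1.c p.2 ∧ p.1.I.first (p.1.I.node d) = d
        then (y p.1 d).1 else 0) (PolyTime.ite (and ?_ ?_) ?_ (int _ 0))).of_enc fun p => ?_)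
    · exact (((polyTime_colorClass.wk _).wk _).app ((var _ _).wk _)).app (var _ _)
    · exact ((hfirst.wk _).wk _).app (var _ _)
    · exact (((hyP.wk _).wk _).app (var _ _)).fst
    · rw [← Instance.sum_nodes p.1.I (colorClass p.1.c p.2) fun d => (y p.1 d).1]
      exact congrArg _ (Finset.sum_congr rfl fun v _ => (hsub p.1 v).2.2)
  -- For a color and a type, the only possible node of that color containing the type is found
  -- through its first demand; without such a node the type stays idle.
  have key : ∃ l : ∀ p : Σ p : (Σ i : Input, Fin i.a), Fin p.1.k, List (List (Fin p.1.1.n)),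
      (∀ p, (l p : Multiset (List (Fin p.1.1.n))) =
        (colorSolution p.1.1.c (sub p.1.1) p.1.2).paths p.2 (s p.1.1)) ∧
      PolyTime (Ext (Ext code a) fun p => p.1.k) l := by
    let Q : (p : Σ p : (Σ i : Input, Fin i.a), Fin p.1.k) → Fin p.1.1.n → Prop := fun p d =>
      (p.1.1.I.node d ∈ colorClass p.1.1.c p.1.2 ∧ p.1.1.I.first (p.1.1.I.node d) = d) ∧
        p.2 ∈ p.1.1.I.M d
    have hQ : PolyTime (Ext (Ext (Ext code a) fun p => p.1.k) fun p => p.1.1.n)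
        fun p => Q p.1 p.2 := by
      refine and (and ?_ ?_) ?_
      · exact ((((polyTime_colorClass.wk _).wk _).wk _).app (((var _ _).wk _).wk _)).app (var _ _)
      · exact (((hfirst.wk _).wk _).wk _).app (var _ _)
      · exact ((((polyTime_M.wk _).wk _).wk _).app (var _ _)).app ((var _ _).wk _)
    have hnil : PolyTime
        (fun p : {p // ¬∃ d, Q p d} => Ext (Ext code a) (fun p => p.1.k) p.1)
        fun p => ([] : List (List (Fin p.1.1.1.n))) := nil
    refine exists_cases (α := fun p => List (List (Fin p.1.1.n))) (p := fun p => ∃ d, Q p d)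
      (R := fun p l => (l : Multiset (List (Fin p.1.1.n))) =
        (colorSolution p.1.1.c (sub p.1.1) p.1.2).paths p.2 (s p.1.1))
      (ex ((index_n.wk _).wk _) hQ) ?_ ?_
    · obtain ⟨d, hd, hdP⟩ := find (ι := {p // ∃ d, Q p d})
        (x := fun p => Ext (Ext code a) (fun p => p.1.k) p.1) (n := fun p => p.1.1.1.n)
        (p := fun p => Q p.1) (((index_n.wk _).wk _).sub_index fun p => ∃ d, Q p d)
        (hQ.reindex fun p : Σ p : {p // ∃ d, Q p d}, Fin p.1.1.1.n => ⟨p.1.1, p.2⟩) fun p => p.2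
      refine ⟨fun p => (y p.1.1.1 (d p)).2, fun p => ?_,
        ((((hyP.wk _).wk _).sub_index fun p => ∃ d, Q p d).app hdP).snd⟩
      obtain ⟨⟨h1, h2⟩, h3⟩ := hd p
      have h4 := Instance.map_chainSolution (hsub p.1.1.1 (p.1.1.1.I.node (d p))).1
      rw [colorSolution_paths_of_mem p.1.1.1.c (sub p.1.1.1) h1 h3]
      refine Eq.trans ?_ h4.symm
      rw [h2]
    · refine ⟨fun _ => [], fun p => ?_, hnil⟩
      refine (colorSolution_paths_of_notMem _ _ (fun v hv hr => p.2 ⟨p.1.1.1.I.first v, ?_⟩) _).symm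
      refine ⟨⟨?_, ?_⟩, ?_⟩
      · rwa [Instance.node_first]
      · rw [Instance.node_first]
      · have := congrArg Subtype.val (p.1.1.1.I.node_first v)
        exact (congrArg (p.1.2 ∈ ·) this).mpr hr
  obtain ⟨l, hl, hlP⟩ := key
  let paths : ∀ i : Input, Fin i.a → Fin i.k → Fin i.q → List (List (Fin i.n)) :=
    fun i j r s' => if s' = s i then l ⟨⟨i, j⟩, r⟩ else []
  have hpaths : PolyTime code paths := by
    refine lam index_a (lam (index_k.wk _) (lam ((index_q.wk _).wk _) ?_))
    exact PolyTime.ite ((var _ _).eq (((hsP.wk _).wk _).wk _)) (hlP.wk _) nil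
  have hpaths' : ∀ i j r s', (paths i j r s' : Multiset (List (Fin i.n))) =
      (colorSolution i.c (sub i) j).paths r s' := by
    intro i j r s'
    by_cases h : s' = s i
    · simp only [paths, h, if_true]
      exact hl ⟨⟨i, j⟩, r⟩
    · simp only [paths, h, if_false]
      refine ((feasible_colorSolution i.c (sub i) (hs i) i.triangle
        (fun v => (hsub i v).2.1.1) j).1 r s' ?_).symm
      simpa [hs i r] using h
  -- The last color among those of maximal value, provided that this value is nonnegative; by
  -- `algorithmC_eq` it is the color returned.
  let Best : ∀ i : Input, Fin i.a → Prop := fun i j => 0 ≤ colorValue i.c (sub i) j ∧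
    ∀ j', colorValue i.c (sub i) j' ≤ colorValue i.c (sub i) j ∧
      ((j : ℤ) < (j' : ℤ) → colorValue i.c (sub i) j' < colorValue i.c (sub i) j)
  have hBest : PolyTime (Ext code a) fun p => Best p.1 p.2 := by
    have h1 : PolyTime (Ext (Ext code a) fun p => p.1.a)
        fun p => colorValue p.1.1.c (sub p.1.1) p.1.2 := ((hval.wk _).app (var _ _)).wk _
    have h2 : PolyTime (Ext (Ext code a) fun p => p.1.a)
        fun p => colorValue p.1.1.c (sub p.1.1) p.2 := ((hval.wk _).wk _).app (var _ _)
    exact and (le_int (int _ 0) ((hval.wk _).app (var _ _))) (all (index_a.wk _)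
      (and (h2.le_int h1) (imp (((var _ _).wk _).val.lt_int (var _ _).val) (h2.lt_int h1))))
  have hout := exists_cases (x := code) (p := fun i => ∃ j, Best i j)
    (α := fun i => ℤ × (Fin i.k → Fin i.q → List (List (Fin i.n))))
    (R := fun i out => out.1 = (algorithmC i.c (sub i)).1 ∧
      ∀ r s, (out.2 r s : Multiset (List (Fin i.n))) = (algorithmC i.c (sub i)).2.paths r s)
    (ex index_a hBest) ?_ ?_
  · obtain ⟨out, h, hP⟩ := hout
    exact ⟨out, fun i => ⟨sub i, fun v => (hsub i v).2.1, h i⟩, hP⟩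
  · obtain ⟨j, hj, hjP⟩ := find (ι := {i // ∃ j, Best i j}) (x := fun i => code i.1)
      (n := fun i => i.1.a) (p := fun i => Best i.1) (index_a.sub_index fun i => ∃ j, Best i j)
      (hBest.reindex fun p : Σ i : {i // ∃ j, Best i j}, Fin i.1.a => ⟨p.1.1, p.2⟩) fun i => i.2
    refine ⟨fun i => (colorValue i.1.c (sub i.1) (j i), paths i.1 (j i)), fun i => ?_,
      PolyTime.mk ((hval.sub_index _).app hjP) ((hpaths.sub_index _).app hjP)⟩
    obtain ⟨h1, h2⟩ := hj i
    rcases algorithmC_eq i.1.c (sub i.1) with ⟨-, h⟩ | ⟨j', h, -, h3⟩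
    · exact (not_lt.2 h1 (h _)).elim
    · have hjj : j' = j i := by
        rcases lt_trichotomy j' (j i) with h4 | h4 | h4
        · exact (not_le.2 ((h3 _).2 h4) (h2 _).1).elim
        · exact h4
        · exact (not_le.2 ((h2 j').2 (by exact_mod_cast h4)) (h3 _).1).elim
      rw [h, hjj]
      exact ⟨rfl, hpaths' _ _⟩
  -- All color values are negative here, so the initial value and the empty solution survive.
  · refine ⟨fun i => (0, fun _ _ => []), fun i => ?_,
      PolyTime.mk (int _ 0) (lam (index_k.sub_index _) (lam ((index_q.sub_index _).wk _) nil))⟩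
    rcases algorithmC_eq i.1.c (sub i.1) with ⟨h, -⟩ | ⟨j, -, h1, h2⟩
    · rw [h]
      exact ⟨rfl, fun _ _ => rfl⟩
    · exact (i.2 ⟨j, h1, fun j' => ⟨(h2 j').1, fun h => (h2 j').2 (by exact_mod_cast h)⟩⟩).elim

end Input

end MRMD

theorem mainTheorem8 :
    -- every run of Algorithm C yields a feasible solution whose value is at least `b / a` times OPT
    (∀ (n k q : ℕ) (I : MRMD.Instance (Fin n) (Fin k) (Fin q)) (s : Fin q),
      I.SameStart s → I.TriangleInequality →
      ∀ (a b : ℕ), 0 < b → ∀ (c : MRMD.ABColoring I.conflictGraph a b)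
        (sub : ∀ v : I.Node, MRMD.Solution (I.DBar v) Unit (Fin q)),
        (∀ v, (I.subproblem v).IsOptimal (sub v)) →
        I.Feasible (MRMD.algorithmC c sub).2 ∧
        I.objective (MRMD.algorithmC c sub).2 = (MRMD.algorithmC c sub).1 ∧
        ∃ OPT : ℤ, I.IsOptValue OPT ∧
          (OPT : ℚ) ≤ (a : ℚ) / (b : ℚ) * ((MRMD.algorithmC c sub).1 : ℚ)) ∧
    -- Algorithm C runs in polynomial time
    (∃ (P : MRMD.Prog) (T : Polynomial ℕ),
      ∀ (n k q : ℕ) (I : MRMD.Instance (Fin n) (Fin k) (Fin q)) (s : Fin q),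
      I.SameStart s → I.TriangleInequality →
      ∀ (a b : ℕ), 0 < b → ∀ (c : MRMD.ABColoring I.conflictGraph a b),
        ∃ sub : ∀ v : I.Node, MRMD.Solution (I.DBar v) Unit (Fin q),
          (∀ v, (I.subproblem v).IsOptimal (sub v)) ∧
          MRMD.OutputsWithin P (MRMD.encodeInput I c) (MRMD.algorithmC c sub)
            (T.eval (MRMD.encodeInput I c).size)) := by
  constructor
  · intro n k q I s hs htri a b hb c sub hsub
    refine ⟨MRMD.feasible_algorithmC c sub hs htri fun v => (hsub v).1,
      MRMD.objective_algorithmC c sub, ?_⟩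
    obtain ⟨σ, hσ, hopt⟩ := I.exists_isOptValue
    refine ⟨_, hopt, ?_⟩
    have h : (b : ℚ) * (I.objective σ : ℚ) ≤ a * ((MRMD.algorithmC c sub).1 : ℚ) := by
      exact_mod_cast MRMD.optValue_le_algorithmC c sub hs htri hsub hσ
    have hb' : (0 : ℚ) < b := by exact_mod_cast hb
    rw [div_mul_eq_mul_div, le_div_iff₀ hb', mul_comm]
    exact h
  · obtain ⟨out, hout, P, t, ⟨m, hm⟩, hP⟩ := MRMD.Input.exists_algorithmC
    refine ⟨P, (Polynomial.X + 2) ^ m, fun n k q I s hs htri a b _ c => ?_⟩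
    let i : MRMD.Input := ⟨n, k, q, I, s, hs, htri, a, b, c⟩
    obtain ⟨sub, hsub, h1, h2⟩ := hout i
    refine ⟨sub, hsub, (out i).2, h2, t i, ?_, ?_⟩
    · simpa [i, MRMD.Input.code] using hm i
    · have h := hP i
      rwa [show MRMD.Enc.enc (out i) = MRMD.encodeOutput (out i).1 (out i).2 by
        simp only [MRMD.encodeOutput, MRMD.Enc.enc]
        rfl, h1] at h
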